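/- Let $n\ge 0$, let $(M,\omega)$ be a closed (compact, without boundary, not necessarily connected) smooth symplectic manifold of dimension $4n+2$, and let $J$ be a smooth almost complex structure on $M$ compatible with $\omega$, that is, $\omega(Ju,Jv)=\omega(u,v)$ and $\omega(u,Ju)>0$ for $u\neq 0$. Let $g(u,v)=\omega(u,Jv)$ be the associated Riemannian metric, orient $M$ by $\omega^{2n+1}$, and let $\mathrm{dvol}$ be the Riemannian volume form. Let $\Omega^k(M)$ be the space of smooth real $k$-forms ($\Omega^k(M)=0$ for $k<0$), $\psi=\omega\wedge\omega$, $C^k(M,\psi)=\Omega^k(M)\oplus\Omega^{k-3}(M)$ and $C^{\mathrm{even}}(M,\psi)=\bigoplus_{k\text{ even}}C^k(M,\psi)$. Let $$\partial_\psi=\begin{bmatrix} d&\psi\wedge\\ 0&-d\end{bmatrix},\qquad \partial_\psi(\alpha_1,\alpha_2)=(d\alpha_1+\psi\wedge\alpha_2,\,-d\alpha_2),$$ acting on $\bigoplus_k C^k(M,\psi)$, and let $\partial_\psi^*$ be its formal adjoint with respect to the $L^2$ inner product induced by $g$. For a tangent vector $v$ put $\hat c(v)=g(v,\cdot)\wedge{}+\iota_v$,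 acting on forms, and let $\hat c(\mathrm{dvol})=\hat c(e_1)\hat c(e_2)\cdots\hat c(e_{4n+2})$ for any local oriented orthonormal frame $e_1,\dots,e_{4n+2}$. Then the formal adjoint $\partial_\psi^*$ exists, the operator $$\widetilde{\mathbb D}=\begin{bmatrix}0&-1\\1&0\end{bmatrix}\begin{bmatrix}\hat c(\mathrm{dvol})&0\\0&\hat c(\mathrm{dvol})\end{bmatrix}(\partial_\psi+\partial_\psi^*)$$ maps $C^{\mathrm{even}}(M,\psi)$ linearly to itself, and it is (formally) skew-adjoint there: $\langle\widetilde{\mathbb D}u,v\rangle_{L^2}=-\langle u,\widetilde{\mathbb D}v\rangle_{L^2}$ for all $u,v\in C^{\mathrm{even}}(M,\psi)$. -/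

import Mathlib

open scoped Manifold ContDiff Bundle
open MeasureTheory

noncomputable section

namespace FilteredSymplectic

/-! ### Linear algebra on one tangent space -/

section Pointwise

variable {V : Type*} [NormedAddCommGroup V] [NormedSpace ℝ V]

/-- Inhomogeneous alternating forms on `V`: the component in degree `k` is a `k`-form. When `V` has
dimension `m` the components of degree `> m` vanish, so that this is `⨁ₖ Λᵏ V*`. -/
abbrev Forms (V : Type*) [NormedAddCommGroup V] [NormedSpace ℝ V] : Type _ :=
  (k : ℕ) → V [⋀^Fin k]→L[ℝ] ℝ

/-- The exterior product (sum over shuffles, no normalising factor) of a `k`-form and an `l`-form;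
the degree `m` of the product is given with a proof of `k + l = m`. -/
def wedge {k l m : ℕ} (h : k + l = m) (a : V [⋀^Fin k]→L[ℝ] ℝ) (b : V [⋀^Fin l]→L[ℝ] ℝ) :
    V [⋀^Fin m]→L[ℝ] ℝ :=
  { ((LinearMap.mul' ℝ ℝ).compAlternatingMap
      (a.toAlternatingMap.domCoprod b.toAlternatingMap)).domDomCongr
        (finSumFinEquiv.trans (finCongr h)) with
    cont := by
      change Continuous fun v : Fin m → V => LinearMap.mul' ℝ ℝ
        ((a.toAlternatingMap.domCoprod b.toAlternatingMap)
          (fun i => v ((finSumFinEquiv.trans (finCongr h)) i)))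
      simp only [AlternatingMap.domCoprod_apply, sum_apply, map_sum]
      refine continuous_finsetSum _ fun σ _ => ?_
      induction σ using Quotient.inductionOn' with
      | h σ =>
        simp only [AlternatingMap.domCoprod.summand_mk'', smul_apply,
          MultilinearMap.domDomCongr_apply, MultilinearMap.domCoprod_apply]
        simp only [map_zsmul_unit, LinearMap.mul'_apply]
        refine Continuous.const_smul (Continuous.mul ?_ ?_) _
        · exact a.cont.comp (by fun_prop)
        · exact b.cont.comp (by fun_prop) }

/-- The powers `ω ^ N = ω ∧ ⋯ ∧ ω` of a `2`-form. -/
def wedgePow (w : V [⋀^Fin 2]→L[ℝ] ℝ) : (N : ℕ) → V [⋀^Fin (2 * N)]→L[ℝ] ℝ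
  | 0 => ContinuousAlternatingMap.constOfIsEmpty ℝ V (Fin 0) 1
  | N + 1 => wedge (by ring) w (wedgePow w N)

/-- `ψ = ω ∧ ω`. -/
def psi (w : V [⋀^Fin 2]→L[ℝ] ℝ) : V [⋀^Fin 4]→L[ℝ] ℝ := wedge rfl w w

/-- The operator `ψ ∧ ·` on inhomogeneous forms. -/
def psiMul (w : V [⋀^Fin 2]→L[ℝ] ℝ) (a : Forms V) : Forms V
  | 0 => 0
  | 1 => 0
  | 2 => 0
  | 3 => 0
  | k + 4 => wedge (Nat.add_comm 4 k) (psi w) (a k)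

/-- The operator `θ ∧ ·` for a covector `θ`:
`(θ ∧ α) (v₀, …, vₖ) = ∑ᵢ (-1)ⁱ θ(vᵢ) α(v₀, …, v̂ᵢ, …, vₖ)`. -/
def extMul (θ : V →L[ℝ] ℝ) : Module.End ℝ (Forms V) where
  toFun a
    | 0 => 0
    | k + 1 => ContinuousAlternatingMap.alternatizeUncurryFin (θ.smulRight (a k))
  map_add' a b := by
    funext k
    cases k with
    | zero => exact (add_zero _).symm
    | succ k =>
      ext v
      simp [ContinuousAlternatingMap.alternatizeUncurryFin_apply, Finset.sum_add_distrib]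
  map_smul' c a := by
    funext k
    cases k with
    | zero => exact (smul_zero c).symm
    | succ k =>
      ext v
      simp [ContinuousAlternatingMap.alternatizeUncurryFin_apply, Finset.mul_sum, mul_left_comm]

/-- The interior product `ι_v`, inserting `v` in the first slot. -/
def intMul (v : V) : Module.End ℝ (Forms V) where
  toFun a k := (a (k + 1)).curryLeft v
  map_add' _ _ := rfl
  map_smul' _ _ := rfl

/-- The bilinear form `g(u, v) = ω(u, J v)`. -/
def metric (w : V [⋀^Fin 2]→L[ℝ] ℝ) (J : V →L[ℝ] V) : V →L[ℝ] V →L[ℝ] ℝ :=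
  ((((ContinuousAlternatingMap.ofSubsingletonLIE (𝕜 := ℝ) (E := V) (F := ℝ) (0 : Fin 1)).symm :
      (V [⋀^Fin 1]→L[ℝ] ℝ) ≃L[ℝ] (V →L[ℝ] ℝ)) :
      (V [⋀^Fin 1]→L[ℝ] ℝ) →L[ℝ] (V →L[ℝ] ℝ)).comp w.curryLeft).bilinearComp
    (ContinuousLinearMap.id ℝ V) J

theorem metric_apply (w : V [⋀^Fin 2]→L[ℝ] ℝ) (J : V →L[ℝ] V) (u v : V) :
    metric w J u v = w ![u, J v] := by
  change w (Fin.cons u fun _ => J v) = _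
  congr 1
  funext i
  fin_cases i <;> rfl

/-- The Clifford action `ĉ(v) = v^♭ ∧ + ι_v`, where `v^♭ = g(v, ·)`. -/
def chat (g : V →L[ℝ] V →L[ℝ] ℝ) (v : V) : Module.End ℝ (Forms V) :=
  extMul (g v) + intMul v

/-- `e` is a `g`-orthonormal frame of the `(4n+2)`-dimensional space `V`, `g = ω(·, J ·)`, which is
positive for the orientation given by `ω ^ (2n+1)`. -/
def IsOrientedFrame {n : ℕ} (w : V [⋀^Fin 2]→L[ℝ] ℝ) (J : V →L[ℝ] V)
    (e : Fin (4 * n + 2) → V) : Prop :=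
  (∀ i j, metric w J (e i) (e j) = if i = j then 1 else 0) ∧
    0 < wedgePow w (2 * n + 1) (fun i => e (Fin.cast (by ring) i))

/-- A choice of an oriented orthonormal frame. Such frames exist whenever `J` is compatible with
`ω`, and nothing below depends on the choice. -/
def frame (n : ℕ) (w : V [⋀^Fin 2]→L[ℝ] ℝ) (J : V →L[ℝ] V) : Fin (4 * n + 2) → V :=
  Classical.epsilon fun e => IsOrientedFrame w J e

/-- The inner product on inhomogeneous forms for which the `e^{i₁} ∧ ⋯ ∧ e^{iₖ}`, `i₁ < ⋯ < iₖ`,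
are orthonormal: `∑ₖ (1 / k!) ∑_{i₁, …, iₖ} α(e_{i₁}, …, e_{iₖ}) β(e_{i₁}, …, e_{iₖ})`. -/
def innerForms {m : ℕ} (e : Fin m → V) (a b : Forms V) : ℝ :=
  ∑ k ∈ Finset.range (m + 1), (1 / (k.factorial : ℝ)) *
    ∑ i : Fin k → Fin m, a k (fun s => e (i s)) * b k (fun s => e (i s))

/-- `ĉ(dvol) = ĉ(e₁) ĉ(e₂) ⋯ ĉ(e_m)`, where `dvol = e¹ ∧ ⋯ ∧ e^m` for an oriented orthonormal
frame. -/
def chatVol {m : ℕ} (g : V →L[ℝ] V →L[ℝ] ℝ) (e : Fin m → V) : Module.End ℝ (Forms V) :=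
  (List.ofFn fun i => chat g (e i)).prod

end Pointwise

/-! ### Forms on a manifold of dimension `4n+2` -/

/-- The model space. -/
abbrev E (n : ℕ) : Type := EuclideanSpace ℝ (Fin (4 * n + 2))

section Manifold

variable (n : ℕ) (M : Type*) [TopologicalSpace M] [ChartedSpace (E n) M]

/-- Families of alternating `k`-forms on the tangent spaces, without any regularity. -/
abbrev RoughForm (k : ℕ) : Type _ :=
  (x : M) → TangentSpace (𝓡 (4 * n + 2)) x [⋀^Fin k]→L[ℝ] ℝ

/-- Families of inhomogeneous alternating forms on the tangent spaces, without any regularity. -/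
abbrev RoughForms : Type _ :=
  (x : M) → (k : ℕ) → TangentSpace (𝓡 (4 * n + 2)) x [⋀^Fin k]→L[ℝ] ℝ

/-- Families of endomorphisms of the tangent spaces, without any regularity. -/
abbrev RoughEnd : Type _ :=
  (x : M) → TangentSpace (𝓡 (4 * n + 2)) x →L[ℝ] TangentSpace (𝓡 (4 * n + 2)) x

variable {n M}

/-- The expression of a `k`-form in the chart `φ` at `x₀`, that is, its pullback by `φ⁻¹`. -/
def chartForm {k : ℕ} (a : RoughForm n M k) (x₀ : M) (y : E n) : E n [⋀^Fin k]→L[ℝ] ℝ :=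
  (a ((extChartAt (𝓡 (4 * n + 2)) x₀).symm y)).compContinuousLinearMap
    (mfderiv 𝓘(ℝ, E n) (𝓡 (4 * n + 2)) (extChartAt (𝓡 (4 * n + 2)) x₀).symm y)

/-- The exterior derivative of a `k`-form, computed at `x` in the chart at `x`. -/
def formDeriv {k : ℕ} (a : RoughForm n M k) : RoughForm n M (k + 1) := fun x =>
  (extDeriv (chartForm a x) (extChartAt (𝓡 (4 * n + 2)) x x)).compContinuousLinearMap
    (mfderiv (𝓡 (4 * n + 2)) 𝓘(ℝ, E n) (extChartAt (𝓡 (4 * n + 2)) x) x)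

/-- The exterior derivative of inhomogeneous forms. -/
def dForms (a : RoughForms n M) : RoughForms n M := fun x k =>
  match k with
  | 0 => 0
  | k + 1 => formDeriv (fun y => a y k) x

/-- The operator `ψ ∧ ·`, `ψ = ω ∧ ω`. -/
def psiForms (w : RoughForm n M 2) (a : RoughForms n M) : RoughForms n M := fun x =>
  psiMul (V := E n) (w x) (a x)

/-- The operator `ĉ(dvol)`, for the volume form of the metric `ω(·, J ·)` and the orientation
given by `ω ^ (2n+1)`. -/
def chatVolForms (w : RoughForm n M 2) (J : RoughEnd n M) (a : RoughForms n M) :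
    RoughForms n M := fun x =>
  chatVol (V := E n) (metric (V := E n) (w x) (J x)) (frame (V := E n) n (w x) (J x)) (a x)

/-- The function `√ det (g(∂ᵢ, ∂ⱼ))` in the chart at `x₀`, for `g = ω(·, J ·)`. -/
def chartDensity (w : RoughForm n M 2) (J : RoughEnd n M) (x₀ : M) (y : E n) : ℝ :=
  let p : M := (extChartAt (𝓡 (4 * n + 2)) x₀).symm y
  let D : E n →L[ℝ] E n :=
    mfderiv 𝓘(ℝ, E n) (𝓡 (4 * n + 2)) (extChartAt (𝓡 (4 * n + 2)) x₀).symm y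
  Real.sqrt (Matrix.det (Matrix.of fun i j : Fin (4 * n + 2) =>
    metric (V := E n) (w p) (J p) (D (EuclideanSpace.single i 1)) (D (EuclideanSpace.single j 1))))

section Smooth

variable [IsManifold (𝓡 (4 * n + 2)) ∞ M]

/-- Smoothness of a `k`-form, as a section of the bundle `Λᵏ T*M`. -/
def IsSmoothForm {k : ℕ} (a : RoughForm n M k) : Prop :=
  ContMDiff (𝓡 (4 * n + 2)) ((𝓡 (4 * n + 2)).prod 𝓘(ℝ, E n [⋀^Fin k]→L[ℝ] ℝ)) ∞
    (fun x => Bundle.TotalSpace.mk' (E n [⋀^Fin k]→L[ℝ] ℝ)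
      (E := fun x : M => TangentSpace (𝓡 (4 * n + 2)) x [⋀^Fin k]→L[ℝ] Bundle.Trivial M ℝ x)
      x (a x))

/-- Smoothness of a family of endomorphisms, as a section of the bundle `End(TM)`. -/
def IsSmoothEnd (J : RoughEnd n M) : Prop :=
  ContMDiff (𝓡 (4 * n + 2)) ((𝓡 (4 * n + 2)).prod 𝓘(ℝ, E n →L[ℝ] E n)) ∞
    (fun x => Bundle.TotalSpace.mk' (E n →L[ℝ] E n)
      (E := fun x : M => TangentSpace (𝓡 (4 * n + 2)) x →L[ℝ] TangentSpace (𝓡 (4 * n + 2)) x)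
      x (J x))

/-- `ω` is a symplectic form: smooth, closed and nondegenerate. -/
structure IsSymplectic (w : RoughForm n M 2) : Prop where
  smooth : IsSmoothForm w
  closed : ∀ x, formDeriv w x = 0
  nondegenerate : ∀ x (u : TangentSpace (𝓡 (4 * n + 2)) x), (∀ v, w x ![u, v] = 0) → u = 0

/-- `J` is an almost complex structure compatible with `ω`. -/
structure IsCompatible (w : RoughForm n M 2) (J : RoughEnd n M) : Prop where
  smooth : IsSmoothEnd J
  sq : ∀ x (u : TangentSpace (𝓡 (4 * n + 2)) x), J x (J x u) = -u
  invariant : ∀ x (u v : TangentSpace (𝓡 (4 * n + 2)) x), w x ![J x u, J x v] = w x ![u, v]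
  tame : ∀ x (u : TangentSpace (𝓡 (4 * n + 2)) x), u ≠ 0 → 0 < w x ![u, J x u]

variable (n M) in
/-- The space `Ω(M) = ⨁ₖ Ωᵏ(M)` of smooth inhomogeneous forms. -/
def smoothForms : Submodule ℝ (RoughForms n M) where
  carrier := {a | ∀ k, IsSmoothForm fun x => a x k}
  add_mem' ha hb k := (ha k).add_section (hb k)
  zero_mem' _ := Bundle.contMDiff_zeroSection ℝ _
  smul_mem' _ _ ha k := ContMDiff.const_smul_section (ha k)

variable (n M) in
/-- The space `⨁ₖ Cᵏ(M, ψ)`, `Cᵏ(M, ψ) = Ωᵏ(M) ⊕ Ωᵏ⁻³(M)`, of smooth cochains. -/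
def cochains : Submodule ℝ (RoughForms n M × RoughForms n M) :=
  (smoothForms n M).prod (smoothForms n M)

variable (n M) in
/-- The space `C^even(M, ψ) = ⨁_{k even} Ωᵏ(M) ⊕ Ωᵏ⁻³(M)`. -/
def evenCochains : Submodule ℝ (RoughForms n M × RoughForms n M) where
  carrier := {u | u ∈ cochains n M ∧ (∀ x k, ¬ Even k → u.1 x k = 0) ∧
    ∀ x k, ¬ Even (k + 3) → u.2 x k = 0}
  add_mem' := by
    rintro u v ⟨hu, hu1, hu2⟩ ⟨hv, hv1, hv2⟩
    refine ⟨add_mem hu hv, fun x k hk => ?_, fun x k hk => ?_⟩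
    · simp [hu1 x k hk, hv1 x k hk]
    · simp [hu2 x k hk, hv2 x k hk]
  zero_mem' := ⟨zero_mem _, fun _ _ _ => rfl, fun _ _ _ => rfl⟩
  smul_mem' := by
    rintro c u ⟨hu, hu1, hu2⟩
    refine ⟨Submodule.smul_mem _ c hu, fun x k hk => ?_, fun x k hk => ?_⟩
    · simp [hu1 x k hk]
    · simp [hu2 x k hk]

variable [T2Space M] [CompactSpace M]

variable (n M) in
/-- A smooth partition of unity subordinate to the charts. -/
def chartPartition : SmoothPartitionOfUnity M (𝓡 (4 * n + 2)) M Set.univ :=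
  Classical.choose (SmoothPartitionOfUnity.exists_isSubordinate_chartAt_source (𝓡 (4 * n + 2)) M)

variable [MeasurableSpace M]

/-- The Riemannian volume measure of `g = ω(·, J ·)`: the sum over the charts `φ` of the images
under `φ⁻¹` of `ρ √ det (g(∂ᵢ, ∂ⱼ)) dx`, where `ρ` runs through a partition of unity subordinate
to the charts. It does not depend on the partition. -/
def volumeMeasure (w : RoughForm n M 2) (J : RoughEnd n M) : Measure M :=
  Measure.sum fun x₀ : M =>
    Measure.map (extChartAt (𝓡 (4 * n + 2)) x₀).symm
      ((volume.restrict (extChartAt (𝓡 (4 * n + 2)) x₀).target).withDensity fun y =>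
        ENNReal.ofReal (chartPartition n M x₀ ((extChartAt (𝓡 (4 * n + 2)) x₀).symm y) *
          chartDensity w J x₀ y))

/-- The `L²` inner product of inhomogeneous forms. -/
def l2Inner (w : RoughForm n M 2) (J : RoughEnd n M) (a b : RoughForms n M) : ℝ :=
  ∫ x, innerForms (V := E n) (frame (V := E n) n (w x) (J x)) (a x) (b x) ∂(volumeMeasure w J)

/-- The `L²` inner product of cochains. -/
def cochainInner (w : RoughForm n M 2) (J : RoughEnd n M)
    (u v : RoughForms n M × RoughForms n M) : ℝ :=
  l2Inner w J u.1 v.1 + l2Inner w J u.2 v.2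

end Smooth

/-- The coboundary map `∂_ψ (α₁, α₂) = (dα₁ + ψ ∧ α₂, -dα₂)`. -/
def coboundary (w : RoughForm n M 2) (u : RoughForms n M × RoughForms n M) :
    RoughForms n M × RoughForms n M :=
  (dForms u.1 + psiForms w u.2, -dForms u.2)

section Operator

variable [IsManifold (𝓡 (4 * n + 2)) ∞ M] [T2Space M] [CompactSpace M] [MeasurableSpace M]

/-- The smooth cochain `z` is the value at `v` of the formal adjoint of `∂_ψ`:
`⟨∂_ψ u, v⟩ = ⟨u, z⟩` for all smooth cochains `u`. -/
def IsAdjointValue (w : RoughForm n M 2) (J : RoughEnd n M)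
    (v z : RoughForms n M × RoughForms n M) : Prop :=
  z ∈ cochains n M ∧
    ∀ u ∈ cochains n M, cochainInner w J (coboundary w u) v = cochainInner w J u z

open Classical in
/-- The formal adjoint `∂_ψ^*` of `∂_ψ`. The smooth cochain `∂_ψ^* v` is determined by its inner
products with the smooth cochains. -/
def coboundaryAdjoint (w : RoughForm n M 2) (J : RoughEnd n M)
    (v : RoughForms n M × RoughForms n M) : RoughForms n M × RoughForms n M :=
  if h : ∃ z, IsAdjointValue w J v z then h.choose else 0

/-- The operator `[[0, -1], [1, 0]] diag(ĉ(dvol), ĉ(dvol)) (∂_ψ + ∂_ψ^*)`. -/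
def signatureOperator (w : RoughForm n M 2) (J : RoughEnd n M)
    (u : RoughForms n M × RoughForms n M) : RoughForms n M × RoughForms n M :=
  let z := coboundary w u + coboundaryAdjoint w J u
  (-chatVolForms w J z.2, chatVolForms w J z.1)

end Operator

end Manifold

end FilteredSymplectic

end

/-! Write c for ĉ(dvol) and m = 4n+2. The letters ĉ(eᵢ) are self-adjoint, square to 1 and
anticommute, so c² and the sign in c* = ±c are both governed by reversing m letters. For m = 4n+2
this sign is -1: c² = -1 and c* = -c (`chatVol_chatVol`, `innerForms_chatVol`).

The pairing ⟨a, c b⟩ is, up to signs, the top degree part of a ∧ b. A covector crosses it with a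
minus sign, ⟨θ ∧ a, c b⟩ = -⟨a, c (θ ∧ b)⟩ (`pairing_extMul`). Hence the 4-form ψ crosses it with no
sign (`pairing_psiMul`). For d the sign of the symbol is compensated by the sign of integration by
parts, so ⟨da, c b⟩ = ⟨a, c db⟩ in L² (`l2Inner_dForms`). Inserting b = -c c b gives d* = -c d c and
ψ* = -c ψ c, hence an explicit formula for the formal adjoint. The adjoint is unique because the L²
product is nondegenerate on smooth forms (`eq_zero_of_l2Inner`).

With c² = -1 the operator becomes the matrix [[-ψc, cd + dc], [cd + dc, cψ]]. Each of cd, dc, cψ, ψc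
is skew-adjoint, and a symmetric matrix with skew-adjoint entries is skew-adjoint
(`cochainInner_operatorFormula`). Evenness is a count of degrees: c preserves parity, d changes it,
and ψ has degree 4.

The analytic difficulty is that the orthonormal frame is chosen pointwise, with no regularity. It
enters c and the pairing only through its determinant in a chart (`pairing_eq_det_mul`,
`contDiffAt_chatVol`), and this determinant times the Riemannian density is a locally constant sign
(`det_mul_chartDensity`). So c preserves smoothness, and in a chart the integrand ⟨a, c b⟩ dvol is a
locally constant sign times the Euclidean pairing of the local expressions. Stokes' formula is then
the vanishing of the integral of a compactly supported divergence, globalised by a partition of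
unity. -/

noncomputable section

namespace FilteredSymplectic

/-! ### Exterior and interior multiplication on a vector space -/

section Exterior

variable {V : Type*} [NormedAddCommGroup V] [NormedSpace ℝ V]

/-- The product `θ ∧ a` of a covector and a `k`-form. -/
abbrev covectorMul {k : ℕ} (θ : V →L[ℝ] ℝ) (a : V [⋀^Fin k]→L[ℝ] ℝ) : V [⋀^Fin (k + 1)]→L[ℝ] ℝ :=
  ContinuousAlternatingMap.alternatizeUncurryFin (θ.smulRight a)

theorem covectorMul_apply {k : ℕ} (θ : V →L[ℝ] ℝ) (a : V [⋀^Fin k]→L[ℝ] ℝ) (v : Fin (k + 1) → V) :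
    covectorMul θ a v = ∑ i : Fin (k + 1), (-1) ^ (i : ℕ) * (θ (v i) * a (i.removeNth v)) := by
  simp [covectorMul, ContinuousAlternatingMap.alternatizeUncurryFin_apply]

theorem extMul_zero_apply (θ : V →L[ℝ] ℝ) (a : Forms V) : extMul θ a 0 = 0 := rfl

theorem extMul_succ_apply (θ : V →L[ℝ] ℝ) (a : Forms V) (k : ℕ) :
    extMul θ a (k + 1) = covectorMul θ (a k) := rfl

theorem intMul_apply (v : V) (a : Forms V) (k : ℕ) (u : Fin k → V) :
    intMul v a k u = a (k + 1) (Matrix.vecCons v u) := rfl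

theorem extMul_add (θ η : V →L[ℝ] ℝ) : extMul (θ + η) = extMul θ + extMul η := by
  ext a k v
  cases k with
  | zero => simp [extMul_zero_apply]
  | succ k =>
    simp only [LinearMap.add_apply, Pi.add_apply, ContinuousAlternatingMap.add_apply,
      extMul_succ_apply, covectorMul_apply, ← Finset.sum_add_distrib]
    exact Finset.sum_congr rfl fun i _ => by simp; ring

theorem extMul_smul (c : ℝ) (θ : V →L[ℝ] ℝ) : extMul (c • θ) = c • extMul θ := by
  ext a k v
  cases k with
  | zero => simp [extMul_zero_apply]
  | succ k =>
    simp only [LinearMap.smul_apply, Pi.smul_apply, ContinuousAlternatingMap.smul_apply,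
      extMul_succ_apply, covectorMul_apply, Finset.smul_sum]
    exact Finset.sum_congr rfl fun i _ => by simp; ring

theorem intMul_intMul (u v : V) (a : Forms V) :
    intMul u (intMul v a) = -intMul v (intMul u a) := by
  ext k x
  simp only [Pi.neg_apply, ContinuousAlternatingMap.neg_apply, intMul_apply]
  have h := (a (k + 1 + 1)).toAlternatingMap.map_swap
    (v := Matrix.vecCons u (Matrix.vecCons v x)) (i := 0) (j := 1) (by simp)
  have h' : (Matrix.vecCons u (Matrix.vecCons v x)) ∘ Equiv.swap (0 : Fin (k + 1 + 1)) 1 =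
      Matrix.vecCons v (Matrix.vecCons u x) := by
    funext i
    refine Fin.cases ?_ (fun i => Fin.cases ?_ (fun i => ?_) i) i
    · simp
    · simp
    · have h0 : (i.succ.succ : Fin (k + 1 + 1)) ≠ 0 := Fin.succ_ne_zero _
      have h1 : (i.succ.succ : Fin (k + 1 + 1)) ≠ 1 := by
        rw [← Fin.succ_zero_eq_one]; exact fun h => Fin.succ_ne_zero _ (Fin.succ_injective _ h)
      simp [Equiv.swap_apply_of_ne_of_ne h0 h1]
  rw [h'] at h
  rw [← neg_eq_iff_eq_neg] at h
  exact (neg_eq_iff_eq_neg.mpr h.symm).symm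

/-- In the alternating sum, the term where θ takes the first slot gives θ(v) a. In the others, v
stays in the first slot of a and the index shift produces the minus sign. -/
theorem intMul_extMul (v : V) (θ : V →L[ℝ] ℝ) (a : Forms V) :
    intMul v (extMul θ a) = θ v • a - extMul θ (intMul v a) := by
  ext k x
  simp only [Pi.sub_apply, Pi.smul_apply, ContinuousAlternatingMap.sub_apply,
    ContinuousAlternatingMap.smul_apply, intMul_apply, extMul_succ_apply, covectorMul_apply]
  rw [Fin.sum_univ_succ]
  cases k with
  | zero =>
    simp [extMul_zero_apply]
  | succ k =>
    rw [extMul_succ_apply, covectorMul_apply, sub_eq_add_neg]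
    congr 1
    · simp
    · rw [← Finset.sum_neg_distrib]
      refine Finset.sum_congr rfl fun i _ => ?_
      rw [intMul_apply]
      have : (Fin.succ i).removeNth (Matrix.vecCons v x) = Matrix.vecCons v (i.removeNth x) := by
        funext j
        refine Fin.cases ?_ (fun j => ?_) j
        · rfl
        · simp [Fin.removeNth]
      rw [this]
      simp [pow_succ]

theorem form_eq_zero_of_curryLeft {k : ℕ} (a : V [⋀^Fin (k + 1)]→L[ℝ] ℝ)
    (h : ∀ v, a.curryLeft v = 0) : a = 0 := by
  ext x
  have := DFunLike.congr_fun (h (x 0)) (Fin.tail x)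
  simpa [ContinuousAlternatingMap.curryLeft_apply_apply, Matrix.vecCons] using this

/-- A form of positive degree is determined by its contractions, so induction on the degree applies.
This reduces operator identities to the antiderivation rule. -/
theorem forms_eq_zero_of_intMul {X : Forms V → Forms V} (h0 : ∀ a, X a 0 = 0)
    (hc : ∀ v a, intMul v (X a) = X (intMul v a)) (a : Forms V) : X a = 0 := by
  have : ∀ k a, X a k = 0 := by
    intro k
    induction k with
    | zero => exact h0
    | succ k ih =>
      intro a
      refine form_eq_zero_of_curryLeft _ fun v => ?_
      have := congrFun (hc v a) k
      rw [ih] at this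
      exact this
  exact funext fun k => this k a

/-- By `intMul_extMul` the scalar terms in ι_v of the anticommutator cancel, so the anticommutator
commutes with every contraction and has no degree 0 component. -/
theorem extMul_extMul (θ η : V →L[ℝ] ℝ) (a : Forms V) :
    extMul θ (extMul η a) = -extMul η (extMul θ a) := by
  refine eq_neg_of_add_eq_zero_left (forms_eq_zero_of_intMul
    (X := fun a => extMul θ (extMul η a) + extMul η (extMul θ a)) (fun a => ?_) (fun v a => ?_) a)
  · exact add_zero _
  · simp only [map_add, intMul_extMul, map_sub, map_smul]
    abel

/-- The covectors dual to a basis. -/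
def coframe {m : ℕ} [FiniteDimensional ℝ V] (b : Module.Basis (Fin m) ℝ V) (i : Fin m) :
    V →L[ℝ] ℝ := LinearMap.toContinuousLinearMap (b.coord i)

section Basis

variable [FiniteDimensional ℝ V] {m : ℕ} (b : Module.Basis (Fin m) ℝ V)

theorem coframe_apply (i : Fin m) (v : V) : coframe b i v = b.repr v i := rfl

theorem sum_coframe_smul (v : V) : ∑ i, coframe b i v • b i = v := b.sum_repr v

theorem covector_eq_sum (θ : V →L[ℝ] ℝ) : θ = ∑ i, θ (b i) • coframe b i := by
  ext v
  conv_lhs => rw [← sum_coframe_smul b v]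
  simp [mul_comm]

/-- Serves twice: with f the contraction of a form it yields Euler's identity, with f a derivative
it yields d = ∑ eⁱ ∧ ∂ᵢ. -/
theorem alternatize_eq_sum {k : ℕ} (f : V →L[ℝ] V [⋀^Fin k]→L[ℝ] ℝ) :
    ContinuousAlternatingMap.alternatizeUncurryFin f =
      ∑ i, covectorMul (coframe b i) (f (b i)) := by
  have : f = ∑ i, (coframe b i).smulRight (f (b i)) := by
    ext v : 1
    conv_lhs => rw [← sum_coframe_smul b v]
    simp
  conv_lhs => rw [this]
  rw [← ContinuousAlternatingMap.alternatizeUncurryFinCLM_apply, map_sum]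
  rfl

/-- Euler's identity. -/
theorem sum_covectorMul_curryLeft {k : ℕ} (a : V [⋀^Fin (k + 1)]→L[ℝ] ℝ) :
    ∑ i, covectorMul (coframe b i) (a.curryLeft (b i)) = ((k : ℝ) + 1) • a := by
  rw [← alternatize_eq_sum, ContinuousAlternatingMap.alternatizeUncurryFin_curryLeft]
  ext v
  simp

theorem form_eq_sum {k : ℕ} (a : V [⋀^Fin (k + 1)]→L[ℝ] ℝ) :
    a = ((k : ℝ) + 1)⁻¹ • ∑ i, covectorMul (coframe b i) (a.curryLeft (b i)) := by
  rw [sum_covectorMul_curryLeft, smul_smul, inv_mul_cancel₀ (by positivity), one_smul]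

theorem form_eq_zero_of_lt {k : ℕ} (b : Module.Basis (Fin m) ℝ V) (h : m < k)
    (a : V [⋀^Fin k]→L[ℝ] ℝ) : a = 0 := by
  ext v
  refine a.toAlternatingMap.map_linearDependent v fun hv => ?_
  have := hv.fintype_card_le_finrank
  rw [Module.finrank_eq_card_basis b] at this
  simp at this
  omega

end Basis

theorem form_apply_basis_eq_det_mul {m : ℕ} (f : Module.Basis (Fin m) ℝ V)
    (a : V [⋀^Fin m]→L[ℝ] ℝ) (e : Fin m → V) : a e = f.det e * a f := by
  have := AlternatingMap.eq_smul_basis_det f a.toAlternatingMap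
  have h : a.toAlternatingMap e = _ :=
    congrArg (fun A : V [⋀^Fin m]→ₗ[ℝ] ℝ => A e) this
  simpa [mul_comm] using h

end Exterior

/-! ### The exterior product -/

section Wedge

/-- The permutation sending `0` to `p` and `j.succ` to `p.succAbove (τ j)`. -/
def consPerm {n : ℕ} (p : Fin (n + 1)) (τ : Equiv.Perm (Fin n)) : Equiv.Perm (Fin (n + 1)) :=
  p.cycleRange.symm * Equiv.Perm.decomposeFin.symm (0, τ)

theorem consPerm_zero {n : ℕ} (p : Fin (n + 1)) (τ : Equiv.Perm (Fin n)) : consPerm p τ 0 = p := by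
  simp [consPerm]

theorem consPerm_succ {n : ℕ} (p : Fin (n + 1)) (τ : Equiv.Perm (Fin n)) (j : Fin n) :
    consPerm p τ j.succ = p.succAbove (τ j) := by
  simp [consPerm]

theorem sign_consPerm {n : ℕ} (p : Fin (n + 1)) (τ : Equiv.Perm (Fin n)) :
    Equiv.Perm.sign (consPerm p τ) = (-1) ^ (p : ℕ) * Equiv.Perm.sign τ := by
  simp [consPerm, Equiv.Perm.sign_mul, Fin.sign_cycleRange]

theorem consPerm_bijective (n : ℕ) :
    Function.Bijective fun x : Fin (n + 1) × Equiv.Perm (Fin n) => consPerm x.1 x.2 := by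
  rw [Fintype.bijective_iff_injective_and_card]
  constructor
  · rintro ⟨p, τ⟩ ⟨q, σ⟩ h
    have h0 := DFunLike.congr_fun h 0
    simp only [consPerm_zero] at h0
    subst h0
    congr 1
    ext j
    have hj := DFunLike.congr_fun h j.succ
    simp only [consPerm_succ] at hj
    rw [Fin.succAbove_right_injective hj]
  · simp [Fintype.card_perm, Nat.factorial_succ]

/-- Laplace expansion: a permutation is a choice p of the first value, of sign (-1)^p, followed by a
permutation of the remaining entries. -/
theorem sum_perm_succ {X : Type*} {n : ℕ} (G : (Fin (n + 1) → X) → ℝ) (v : Fin (n + 1) → X) :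
    ∑ σ : Equiv.Perm (Fin (n + 1)), (Equiv.Perm.sign σ : ℝ) * G (v ∘ σ) =
      ∑ p : Fin (n + 1), (-1) ^ (p : ℕ) * ∑ τ : Equiv.Perm (Fin n),
        (Equiv.Perm.sign τ : ℝ) * G (Fin.cons (v p) (p.removeNth v ∘ τ)) := by
  rw [← Function.Bijective.sum_comp (consPerm_bijective n), Fintype.sum_prod_type]
  refine Finset.sum_congr rfl fun p _ => ?_
  rw [Finset.mul_sum]
  refine Finset.sum_congr rfl fun τ _ => ?_
  have : v ∘ consPerm p τ = Fin.cons (v p) (p.removeNth v ∘ τ) := by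
    funext j
    refine Fin.cases ?_ (fun j => ?_) j
    · simp [consPerm_zero]
    · simp [consPerm_succ, Fin.removeNth]
  rw [this, sign_consPerm]
  push_cast
  ring

variable {V : Type*} [NormedAddCommGroup V] [NormedSpace ℝ V]

/-- Each class of permutations modulo those of the two blocks is counted k! l! times. Later facts
about `wedge` are read off from this sum, so that the quotient by block permutations is never
handled again. -/
theorem factorial_mul_wedge_apply {k l m : ℕ} (h : k + l = m) (a : V [⋀^Fin k]→L[ℝ] ℝ)
    (b : V [⋀^Fin l]→L[ℝ] ℝ) (v : Fin m → V) :
    ((k.factorial : ℝ) * l.factorial) * wedge h a b v =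
      ∑ σ : Equiv.Perm (Fin m), (Equiv.Perm.sign σ : ℝ) *
        (a (fun i => (v ∘ σ) (Fin.cast h (Fin.castAdd l i))) *
          b (fun i => (v ∘ σ) (Fin.cast h (Fin.natAdd k i)))) := by
  subst h
  have h1 := congrArg (LinearMap.mul' ℝ ℝ) (DFunLike.congr_fun
    (MultilinearMap.domCoprod_alternization_eq a.toAlternatingMap b.toAlternatingMap)
    (fun i => v (finSumFinEquiv i)))
  simp only [Fintype.card_fin, AlternatingMap.smul_apply, map_nsmul] at h1
  have h2 : wedge rfl a b v = LinearMap.mul' ℝ ℝ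
    ((a.toAlternatingMap.domCoprod b.toAlternatingMap) (fun i => v (finSumFinEquiv i))) := rfl
  rw [h2]
  rw [nsmul_eq_mul] at h1
  push_cast at h1
  rw [← h1, MultilinearMap.alternatization_apply, map_sum,
    ← Equiv.sum_comp (finSumFinEquiv (m := k) (n := l)).permCongr]
  refine Finset.sum_congr rfl fun σ _ => ?_
  rw [Equiv.Perm.sign_permCongr]
  rcases Int.units_eq_one_or (Equiv.Perm.sign σ) with h | h <;>
    simp [h, MultilinearMap.domCoprod_apply, Equiv.permCongr_apply]

theorem wedge_zero_left {l m : ℕ} (h : 0 + l = m) (a : V [⋀^Fin 0]→L[ℝ] ℝ)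
    (b : V [⋀^Fin l]→L[ℝ] ℝ) (v : Fin m → V) :
    wedge h a b v = a ![] * b (fun i => v (Fin.cast (by omega) i)) := by
  obtain rfl : l = m := by omega
  have h1 := factorial_mul_wedge_apply h a b v
  have h2 : ∀ σ : Equiv.Perm (Fin l), (Equiv.Perm.sign σ : ℝ) *
        (a (fun i => (v ∘ σ) (Fin.cast h (Fin.castAdd l i))) *
          b (fun i => (v ∘ σ) (Fin.cast h (Fin.natAdd 0 i)))) = a ![] * b v := by
    intro σ
    have e1 : (fun i => (v ∘ σ) (Fin.cast h (Fin.castAdd l i))) = ![] := Subsingleton.elim _ _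
    have e2 : (fun i => (v ∘ σ) (Fin.cast h (Fin.natAdd 0 i))) = v ∘ σ := by
      funext i
      simp [Fin.cast]
    have e3 := b.toAlternatingMap.map_perm v σ
    rw [e1, e2]
    have e4 : b (v ∘ σ) = (Equiv.Perm.sign σ : ℝ) * b v := by
      simpa [Units.smul_def] using e3
    rw [e4]
    have : ((Equiv.Perm.sign σ : ℤ) : ℝ) * (Equiv.Perm.sign σ : ℤ) = 1 := by
      rcases Int.units_eq_one_or (Equiv.Perm.sign σ) with h | h <;> simp [h]
    linear_combination (a ![] * b v) * this
  rw [Finset.sum_congr rfl fun σ _ => h2 σ] at h1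
  simp [Fintype.card_perm] at h1
  rcases h1 with h1 | h1
  · simpa using h1
  · exact absurd h1 (Nat.factorial_ne_zero _)

/-- Grouping the permutations by the vector that lands in the first slot of a. The factor k + 1 is
the quotient of (k+1)! by k!. -/
theorem succ_mul_wedge_apply {k l m : ℕ} (h : k + 1 + l = m + 1) (h' : k + l = m)
    (a : V [⋀^Fin (k + 1)]→L[ℝ] ℝ) (b : V [⋀^Fin l]→L[ℝ] ℝ) (v : Fin (m + 1) → V) :
    ((k : ℝ) + 1) * wedge h a b v =
      ∑ p : Fin (m + 1), (-1) ^ (p : ℕ) * wedge h' (a.curryLeft (v p)) b (p.removeNth v) := by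
  have hk : ((k.factorial : ℝ) * l.factorial) ≠ 0 := by positivity
  apply mul_left_cancel₀ hk
  have h1 := factorial_mul_wedge_apply h a b v
  rw [Nat.factorial_succ] at h1
  push_cast at h1
  have h3 := sum_perm_succ (fun u : Fin (m + 1) → V =>
    (a (fun i => u (Fin.cast h (Fin.castAdd l i))) *
      b (fun i => u (Fin.cast h (Fin.natAdd (k + 1) i))))) v
  calc _ = ((k : ℝ) + 1) * k.factorial * l.factorial * wedge h a b v := by ring
    _ = _ := h1
    _ = _ := h3
    _ = _ := by
      rw [Finset.mul_sum]
      refine Finset.sum_congr rfl fun p _ => ?_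
      have h4 := factorial_mul_wedge_apply h' (a.curryLeft (v p)) b (p.removeNth v)
      calc _ = (-1) ^ (p : ℕ) * ((k.factorial : ℝ) * l.factorial *
          wedge h' (a.curryLeft (v p)) b (p.removeNth v)) := by
            rw [h4]
            congr 1
            refine Finset.sum_congr rfl fun τ _ => ?_
            congr 2
            · rw [ContinuousAlternatingMap.curryLeft_apply_apply]
              congr 1
              funext i
              refine Fin.cases ?_ (fun i => ?_) i
              · rfl
              · rfl
            · congr 1
              funext i
              have : Fin.cast h (Fin.natAdd (k + 1) i) = (Fin.cast h' (Fin.natAdd k i)).succ := by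
                ext; simp; omega
              rw [this]
              rfl
        _ = _ := by ring

/-- Lowers the degree of the left factor by one. Iterated down to degree 0, it writes multiplication
by a form as a combination of products of covector multiplications. -/
theorem succ_smul_wedge [FiniteDimensional ℝ V] {d : ℕ} (f : Module.Basis (Fin d) ℝ V)
    {k l m : ℕ} (h : k + 1 + l = m + 1) (h' : k + l = m)
    (a : V [⋀^Fin (k + 1)]→L[ℝ] ℝ) (b : V [⋀^Fin l]→L[ℝ] ℝ) :
    ((k : ℝ) + 1) • wedge h a b =
      ∑ i, covectorMul (coframe f i) (wedge h' (a.curryLeft (f i)) b) := by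
  have hk : ((k.factorial : ℝ) * l.factorial) ≠ 0 := by positivity
  ext v
  rw [ContinuousAlternatingMap.smul_apply, smul_eq_mul, succ_mul_wedge_apply h h',
    ContinuousAlternatingMap.sum_apply]
  simp only [covectorMul_apply]
  rw [Finset.sum_comm]
  refine Finset.sum_congr rfl fun p _ => ?_
  rw [← Finset.mul_sum]
  congr 1
  have hv : a.curryLeft (v p) = ∑ i, coframe f i (v p) • a.curryLeft (f i) := by
    conv_lhs => rw [← sum_coframe_smul f (v p)]
    simp
  -- Linearity of the wedge in its left factor is obtained from the permutation formula.
  apply mul_left_cancel₀ hk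
  rw [factorial_mul_wedge_apply, Finset.mul_sum]
  have h5 : ∀ i, (k.factorial : ℝ) * l.factorial * (coframe f i (v p) *
      wedge h' (a.curryLeft (f i)) b (p.removeNth v)) = coframe f i (v p) *
        ((k.factorial : ℝ) * l.factorial * wedge h' (a.curryLeft (f i)) b (p.removeNth v)) :=
    fun i => by ring
  simp only [h5, factorial_mul_wedge_apply]
  simp only [Finset.mul_sum]
  rw [Finset.sum_comm]
  refine Finset.sum_congr rfl fun σ _ => ?_
  rw [hv, ContinuousAlternatingMap.sum_apply, Finset.sum_mul, Finset.mul_sum]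
  refine Finset.sum_congr rfl fun i _ => ?_
  rw [ContinuousAlternatingMap.smul_apply, smul_eq_mul]
  ring

end Wedge

/-! ### The inner product of forms and the adjoint of exterior multiplication -/

section Inner

variable {V : Type*} [NormedAddCommGroup V] [NormedSpace ℝ V] {m : ℕ}

theorem innerForms_comm (e : Fin m → V) (a b : Forms V) : innerForms e a b = innerForms e b a := by
  simp only [innerForms, mul_comm]

theorem innerForms_add_left (e : Fin m → V) (a a' b : Forms V) :
    innerForms e (a + a') b = innerForms e a b + innerForms e a' b := by
  simp [innerForms, add_mul, Finset.sum_add_distrib, mul_add]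

theorem innerForms_smul_left (e : Fin m → V) (c : ℝ) (a b : Forms V) :
    innerForms e (c • a) b = c * innerForms e a b := by
  simp only [innerForms, Pi.smul_apply, ContinuousAlternatingMap.smul_apply, smul_eq_mul,
    Finset.mul_sum]
  refine Finset.sum_congr rfl fun k _ => Finset.sum_congr rfl fun i _ => ?_
  ring

/-- The pointwise inner product as a bilinear form. -/
def innerFormsBilin (e : Fin m → V) : Forms V →ₗ[ℝ] Forms V →ₗ[ℝ] ℝ :=
  LinearMap.mk₂ ℝ (innerForms e) (innerForms_add_left e) (innerForms_smul_left e)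
    (fun a b b' => by
      rw [innerForms_comm, innerForms_add_left, innerForms_comm, innerForms_comm e b'])
    (fun c a b => by rw [innerForms_comm, innerForms_smul_left, innerForms_comm]; rfl)

theorem innerFormsBilin_apply (e : Fin m → V) (a b : Forms V) :
    innerFormsBilin e a b = innerForms e a b := rfl

theorem innerForms_add_right (e : Fin m → V) (a b b' : Forms V) :
    innerForms e a (b + b') = innerForms e a b + innerForms e a b' :=
  map_add (innerFormsBilin e a) b b'

theorem innerForms_smul_right (e : Fin m → V) (c : ℝ) (a b : Forms V) :
    innerForms e a (c • b) = c * innerForms e a b :=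
  map_smul (innerFormsBilin e a) c b

theorem innerForms_neg_right (e : Fin m → V) (a b : Forms V) :
    innerForms e a (-b) = -innerForms e a b :=
  map_neg (innerFormsBilin e a) b

theorem innerForms_neg_left (e : Fin m → V) (a b : Forms V) :
    innerForms e (-a) b = -innerForms e a b := by
  rw [innerForms_comm, innerForms_neg_right, innerForms_comm]

theorem innerForms_sum_left {ι : Type*} (s : Finset ι) (e : Fin m → V) (a : ι → Forms V)
    (b : Forms V) : innerForms e (∑ i ∈ s, a i) b = ∑ i ∈ s, innerForms e (a i) b := by
  simp only [← innerFormsBilin_apply, map_sum, LinearMap.sum_apply]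

theorem innerForms_sum_right {ι : Type*} (s : Finset ι) (e : Fin m → V) (a : Forms V)
    (b : ι → Forms V) : innerForms e a (∑ i ∈ s, b i) = ∑ i ∈ s, innerForms e a (b i) :=
  map_sum (innerFormsBilin e a) b s

theorem innerForms_self_nonneg (e : Fin m → V) (a : Forms V) : 0 ≤ innerForms e a a :=
  Finset.sum_nonneg fun _ _ => mul_nonneg (by positivity)
    (Finset.sum_nonneg fun _ _ => mul_self_nonneg _)

/-- `Forms` is a product over all degrees, not a direct sum, but the inner product sees only degrees
at most m. This allows reduction to homogeneous forms. -/
theorem innerForms_eq_sum_single (e : Fin m → V) (a b : Forms V) :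
    innerForms e a b = ∑ k ∈ Finset.range (m + 1), innerForms e (Pi.single k (a k)) b := by
  have : innerForms e a b = innerForms e (∑ k ∈ Finset.range (m + 1), Pi.single k (a k)) b := by
    unfold innerForms
    refine Finset.sum_congr rfl fun k hk => ?_
    congr 1
    refine Finset.sum_congr rfl fun i _ => ?_
    congr 2
    rw [Finset.sum_apply, Finset.sum_eq_single k]
    · simp
    · intro l _ hl
      exact Pi.single_eq_of_ne hl.symm _
    · exact fun h => absurd hk h
  rw [this, innerForms_sum_left]

theorem innerForms_single_zero (e : Fin m → V) (a : V [⋀^Fin 0]→L[ℝ] ℝ) (b : Forms V) :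
    innerForms e (Pi.single 0 a) b = a ![] * b 0 ![] := by
  unfold innerForms
  rw [Finset.sum_eq_single 0]
  · simp only [Nat.factorial_zero, Finset.univ_unique, Finset.sum_singleton]
    have : ∀ i : Fin 0 → V, i = ![] := fun i => Subsingleton.elim _ _
    rw [this fun s => e _]
    simp
  · intro k _ hk
    simp [Pi.single_eq_of_ne hk]
  · intro h
    simp at h

theorem extMul_single {k : ℕ} (θ : V →L[ℝ] ℝ) (a : V [⋀^Fin k]→L[ℝ] ℝ) :
    extMul θ (Pi.single k a) = Pi.single (k + 1) (covectorMul θ a) := by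
  funext l
  rcases l with _ | l
  · rw [extMul_zero_apply, Pi.single_eq_of_ne (by omega)]
  · rw [extMul_succ_apply]
    by_cases h : l = k
    · subst h; simp
    · rw [Pi.single_eq_of_ne h, Pi.single_eq_of_ne (by omega)]
      ext v
      simp [covectorMul_apply]

/-- All k + 1 terms of the alternating sum contribute equally: moving the p-th argument of b to the
front costs (-1)^p, which cancels the sign of the term. -/
theorem sum_covectorMul_apply_mul {k : ℕ} (e : Fin m → V) (θ : V →L[ℝ] ℝ)
    (a : V [⋀^Fin k]→L[ℝ] ℝ) (b : V [⋀^Fin (k + 1)]→L[ℝ] ℝ) :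
    ∑ i : Fin (k + 1) → Fin m, covectorMul θ a (fun s => e (i s)) * b (fun s => e (i s)) =
      ((k : ℝ) + 1) * ∑ l, θ (e l) *
        ∑ j : Fin k → Fin m, a (fun s => e (j s)) * b.curryLeft (e l) (fun s => e (j s)) := by
  simp only [covectorMul_apply, Finset.sum_mul]
  rw [Finset.sum_comm]
  have hp : ∀ p : Fin (k + 1), ∑ i : Fin (k + 1) → Fin m,
      (-1) ^ (p : ℕ) * (θ (e (i p)) * a (p.removeNth fun s => e (i s))) * b (fun s => e (i s)) =
      ∑ l, θ (e l) *
        ∑ j : Fin k → Fin m, a (fun s => e (j s)) * b.curryLeft (e l) (fun s => e (j s)) := by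
    intro p
    rw [← (Fin.insertNthEquiv (fun _ => Fin m) p).sum_comp, Fintype.sum_prod_type]
    refine Finset.sum_congr rfl fun l _ => ?_
    rw [Finset.mul_sum]
    refine Finset.sum_congr rfl fun j _ => ?_
    have h1 : (fun s => e ((Fin.insertNthEquiv (fun _ => Fin m) p) (l, j) s)) =
        p.insertNth (e l) (fun s => e (j s)) := by
      funext s
      refine Fin.succAboveCases p ?_ (fun s => ?_) s
      · simp
      · simp
    rw [h1, ContinuousAlternatingMap.map_insertNth]
    have h2 : p.removeNth (p.insertNth (α := fun _ => V) (e l) fun s => e (j s)) =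
      fun s => e (j s) := by simp
    have h3 : e ((Fin.insertNthEquiv (fun _ => Fin m) p) (l, j) p) = e l := by simp
    rw [h2, h3, ContinuousAlternatingMap.curryLeft_apply_apply]
    have h4 : ((-1 : ℝ) ^ (p : ℕ)) * (-1) ^ (p : ℕ) = 1 := by
      rw [← mul_pow]; simp
    simp only [zsmul_eq_mul]
    push_cast
    linear_combination (θ (e l) * a (fun s => e (j s)) *
      b (Matrix.vecCons (e l) fun s => e (j s))) * h4
  rw [Finset.sum_congr rfl fun p _ => hp p]
  simp

theorem apply_frame_eq_zero (e : Fin m → V) (b : V [⋀^Fin (m + 1)]→L[ℝ] ℝ)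
    (i : Fin (m + 1) → Fin m) : b (fun s => e (i s)) = 0 := by
  obtain ⟨p, q, hpq, h⟩ := Fintype.exists_ne_map_eq_of_card_lt i (by simp)
  exact b.map_eq_zero_of_eq _ (by rw [h]) hpq

/-- Valid for any tuple e: the adjoint of θ ∧ is contraction with ∑ θ(eₗ) eₗ. The factor k + 1 of
`sum_covectorMul_apply_mul` turns 1/(k+1)! into 1/k!. -/
theorem innerForms_extMul (e : Fin m → V) (θ : V →L[ℝ] ℝ) (a b : Forms V) :
    innerForms e (extMul θ a) b = ∑ l, θ (e l) * innerForms e a (intMul (e l) b) := by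
  unfold innerForms
  rw [Finset.sum_range_succ']
  simp only [Finset.mul_sum (Finset.range (m + 1))]
  rw [Finset.sum_comm, Finset.sum_range_succ]
  congr 1
  · refine Finset.sum_congr rfl fun k _ => ?_
    have := sum_covectorMul_apply_mul e θ (a k) (b (k + 1))
    rw [extMul_succ_apply, this, Nat.factorial_succ, ← mul_assoc, Finset.mul_sum]
    refine Finset.sum_congr rfl fun l _ => ?_
    have hk : (k.factorial : ℝ) ≠ 0 := by positivity
    have : (1 / ((k + 1) * k.factorial : ℕ) : ℝ) * (k + 1) = 1 / k.factorial := by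
      push_cast
      field_simp
    rw [this]
    change _ = θ (e l) * (1 / (k.factorial : ℝ) * ∑ i : Fin k → Fin m,
      a k (fun s => e (i s)) * (b (k + 1)).curryLeft (e l) (fun s => e (i s)))
    ring
  -- The two ends of the degree shift both vanish: degree 0 on the left, and on the right degree m,
  -- where m + 1 vectors are taken from an m-tuple and one is repeated.
  · rw [extMul_zero_apply]
    simp only [ContinuousAlternatingMap.coe_zero, Pi.zero_apply, zero_mul, Finset.sum_const_zero,
      mul_zero]
    symm
    refine Finset.sum_eq_zero fun l _ => ?_
    have : ∀ i : Fin m → Fin m, intMul (e l) b m (fun s => e (i s)) = 0 := by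
      intro i
      rw [intMul_apply]
      have := apply_frame_eq_zero e (b (m + 1)) (Fin.cons l i)
      convert this using 2
      funext s
      refine Fin.cases ?_ (fun s => ?_) s <;> simp
    simp [this]

end Inner

/-! ### Clifford multiplication -/

section ListProd

/-- The sign of the reversal of `k` letters. -/
def reverseSign : ℕ → ℝ
  | 0 => 1
  | k + 1 => (-1) ^ k * reverseSign k

/-- The point where the dimension mod 4 matters: the sign is (-1)^(m(m-1)/2), which has period 4 in
m. -/
theorem reverseSign_four_mul_add_two (n : ℕ) : reverseSign (4 * n + 2) = -1 := by
  induction n with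
  | zero => norm_num [reverseSign]
  | succ n ih =>
    have h : 4 * (n + 1) + 2 = 4 * n + 2 + 1 + 1 + 1 + 1 := by ring
    rw [h]
    simp only [reverseSign] at ih ⊢
    have h1 : ((-1 : ℝ) ^ (4 * n)) = 1 := by rw [pow_mul]; norm_num
    simp only [pow_succ, h1] at ih ⊢
    linarith

variable {W ι : Type*} [AddCommGroup W] [Module ℝ W]

theorem apply_list_prod {X : ι → Module.End ℝ W} (Y : Module.End ℝ W) (s : ι → ℝ) (l : List ι)
    (h : ∀ i ∈ l, ∀ a, Y (X i a) = s i • X i (Y a)) (a : W) :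
    Y ((l.map X).prod a) = (l.map s).prod • (l.map X).prod (Y a) := by
  induction l with
  | nil => simp
  | cons i l ih =>
    simp only [List.map_cons, List.prod_cons, Module.End.mul_apply]
    rw [h i (by simp), ih fun j hj => h j (by simp [hj]), map_smul, smul_smul]

theorem apply_list_prod_of_anticomm {X : ι → Module.End ℝ W} (Y : Module.End ℝ W) (l : List ι)
    (h : ∀ i ∈ l, ∀ a, Y (X i a) = -X i (Y a)) (a : W) :
    Y ((l.map X).prod a) = (-1 : ℝ) ^ l.length • (l.map X).prod (Y a) := by
  rw [apply_list_prod Y (fun _ => -1) l (fun i hi a => by rw [h i hi]; simp)]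
  simp

theorem list_prod_list_prod {X : ι → Module.End ℝ W}
    (hX : ∀ i j, i ≠ j → ∀ a, X i (X j a) = -X j (X i a)) (hX' : ∀ i a, X i (X i a) = a)
    (l : List ι) (hl : l.Nodup) (a : W) :
    (l.map X).prod ((l.map X).prod a) = reverseSign l.length • a := by
  induction l generalizing a with
  | nil => simp [reverseSign]
  | cons i l ih =>
    rw [List.nodup_cons] at hl
    have h := apply_list_prod_of_anticomm (X := X) (X i) l
      (fun j hj => hX i j fun h => hl.1 (h ▸ hj)) a
    simp only [List.map_cons, List.prod_cons, Module.End.mul_apply, List.length_cons, reverseSign]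
    rw [h, map_smul, ih hl.2, map_smul, map_smul, hX', smul_smul]

/-- The adjoint of a product of self-adjoint letters is the reversed product, and restoring the
order of anticommuting letters costs `reverseSign`. -/
theorem list_prod_adjoint {X : ι → Module.End ℝ W} (B : W →ₗ[ℝ] W →ₗ[ℝ] ℝ)
    (hX : ∀ i j, i ≠ j → ∀ a, X i (X j a) = -X j (X i a))
    (hB : ∀ i a b, B (X i a) b = B a (X i b)) (l : List ι) (hl : l.Nodup) (a b : W) :
    B ((l.map X).prod a) b = reverseSign l.length * B a ((l.map X).prod b) := by
  induction l generalizing a b with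
  | nil => simp [reverseSign]
  | cons i l ih =>
    rw [List.nodup_cons] at hl
    have h := apply_list_prod_of_anticomm (X := X) (X i) l
      (fun j hj => hX i j fun h => hl.1 (h ▸ hj)) b
    simp only [List.map_cons, List.prod_cons, Module.End.mul_apply, List.length_cons, reverseSign]
    rw [h, hB, ih hl.2, map_smul, smul_eq_mul, mul_assoc, mul_left_comm]
    have h4 : ((-1 : ℝ) ^ l.length) * (-1) ^ l.length = 1 := by
      rw [← mul_pow]; simp
    linear_combination (-(reverseSign l.length * B a ((l.map X).prod (X i b)))) * h4

end ListProd

section Clifford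

variable {V : Type*} [NormedAddCommGroup V] [NormedSpace ℝ V] {m : ℕ}
  {g : V →L[ℝ] V →L[ℝ] ℝ} {e : Fin m → V}

theorem chat_apply (g : V →L[ℝ] V →L[ℝ] ℝ) (v : V) (a : Forms V) :
    chat g v a = extMul (g v) a + intMul v a := rfl

theorem chat_chat (u v : V) (a : Forms V) :
    chat g u (chat g v a) = (g u v + g v u) • a - chat g v (chat g u a) := by
  simp only [chat_apply, map_add, intMul_extMul]
  rw [extMul_extMul (g u) (g v), intMul_intMul u v]
  module

theorem chat_frame_anticomm (he : ∀ i j, g (e i) (e j) = if i = j then 1 else 0)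
    (i j : Fin m) (hij : i ≠ j) (a : Forms V) :
    chat g (e i) (chat g (e j) a) = -chat g (e j) (chat g (e i) a) := by
  rw [chat_chat, he, he]
  simp [hij, hij.symm]

theorem chat_frame_self (he : ∀ i j, g (e i) (e j) = if i = j then 1 else 0) (i : Fin m)
    (a : Forms V) : chat g (e i) (chat g (e i) a) = a := by
  have h := chat_chat (g := g) (e i) (e i) a
  rw [he] at h
  simp only [if_true] at h
  have h2 : (2 : ℝ) • chat g (e i) (chat g (e i) a) = (2 : ℝ) • a := by
    rw [two_smul]
    nth_rewrite 1 [h]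
    module
  exact smul_right_injective _ (two_ne_zero (α := ℝ)) h2

theorem intMul_chat_frame (he : ∀ i j, g (e i) (e j) = if i = j then 1 else 0)
    (i j : Fin m) (hij : i ≠ j) (a : Forms V) :
    intMul (e i) (chat g (e j) a) = -chat g (e j) (intMul (e i) a) := by
  simp only [chat_apply, map_add, intMul_extMul]
  rw [intMul_intMul, he]
  simp [hij.symm]
  module

/-- The second Clifford action v^♭ ∧ - ι_v anticommutes with the first, also for i = j: the two
scalar terms g(eᵢ, eⱼ) and g(eⱼ, eᵢ) come with opposite signs and cancel. -/
theorem extMul_sub_intMul_chat_frame (he : ∀ i j, g (e i) (e j) = if i = j then 1 else 0)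
    (i j : Fin m) (a : Forms V) :
    extMul (g (e i)) (chat g (e j) a) - intMul (e i) (chat g (e j) a) =
      -chat g (e j) (extMul (g (e i)) a - intMul (e i) a) := by
  simp only [chat_apply, map_add, map_sub, intMul_extMul]
  rw [intMul_intMul (e i), extMul_extMul (g (e i)), he, he]
  simp only [eq_comm]
  module

theorem chatVol_eq (g : V →L[ℝ] V →L[ℝ] ℝ) (e : Fin m → V) :
    chatVol g e = ((List.finRange m).map fun i => chat g (e i)).prod := by
  rw [chatVol, List.ofFn_eq_map]

theorem chatVol_chatVol (he : ∀ i j, g (e i) (e j) = if i = j then 1 else 0) (a : Forms V) :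
    chatVol g e (chatVol g e a) = reverseSign m • a := by
  rw [chatVol_eq]
  have := list_prod_list_prod (X := fun i => chat g (e i)) (chat_frame_anticomm he)
    (chat_frame_self he) (List.finRange m) (List.nodup_finRange m) a
  rwa [List.length_finRange] at this

theorem innerForms_extMul_frame (he : ∀ i j, g (e i) (e j) = if i = j then 1 else 0) (i : Fin m)
    (a b : Forms V) : innerForms e (extMul (g (e i)) a) b = innerForms e a (intMul (e i) b) := by
  rw [innerForms_extMul]
  simp [he]

theorem innerForms_chat (he : ∀ i j, g (e i) (e j) = if i = j then 1 else 0) (i : Fin m)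
    (a b : Forms V) : innerForms e (chat g (e i) a) b = innerForms e a (chat g (e i) b) := by
  rw [chat_apply, chat_apply, innerForms_add_left, innerForms_add_right,
    innerForms_extMul_frame he, innerForms_comm e a (extMul _ _), innerForms_extMul_frame he,
    innerForms_comm e b, add_comm]

theorem innerForms_chatVol (he : ∀ i j, g (e i) (e j) = if i = j then 1 else 0) (a b : Forms V) :
    innerForms e (chatVol g e a) b = reverseSign m * innerForms e a (chatVol g e b) := by
  rw [chatVol_eq]
  have := list_prod_adjoint (X := fun i => chat g (e i)) (innerFormsBilin e)
    (chat_frame_anticomm he) (innerForms_chat he) (List.finRange m) (List.nodup_finRange m) a b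
  rwa [List.length_finRange] at this

/-- Iterated interior product. -/
def iterIntMul (e : Fin m → V) : List (Fin m) → Forms V → Forms V
  | [], a => a
  | i :: l, a => iterIntMul e l (intMul (e i) a)

theorem iterIntMul_zero_apply (e : Fin m → V) (l : List (Fin m)) (a : Forms V) :
    iterIntMul e l a 0 ![] = a l.length (fun t => e (l.get t)) := by
  induction l generalizing a with
  | nil => 
    rw [iterIntMul]
    congr 1
    exact Subsingleton.elim _ _
  | cons i l ih =>
    rw [iterIntMul, ih, intMul_apply]
    change (a (l.length + 1)) _ = (a (l.length + 1)) _
    congr 1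
    funext t
    refine Fin.cases ?_ (fun t => ?_) t <;> simp

/-- Exterior multiplication never produces degree 0, so the outermost letter acts through ι only.
That contraction anticommutes past the remaining letters, and the argument repeats. -/
theorem list_prod_chat_zero (he : ∀ i j, g (e i) (e j) = if i = j then 1 else 0)
    (l : List (Fin m)) (hl : l.Nodup) (a : Forms V) :
    (l.map fun i => chat g (e i)).prod a 0 = reverseSign l.length • iterIntMul e l a 0 := by
  induction l generalizing a with
  | nil => simp [reverseSign, iterIntMul]
  | cons i l ih =>
    rw [List.nodup_cons] at hl
    have h := apply_list_prod_of_anticomm (X := fun i => chat g (e i)) (intMul (e i)) l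
      (fun j hj => intMul_chat_frame he i j fun h => hl.1 (h ▸ hj)) a
    simp only [List.map_cons, List.prod_cons, Module.End.mul_apply, List.length_cons, reverseSign]
    rw [chat_apply, Pi.add_apply, extMul_zero_apply, zero_add, h, Pi.smul_apply, ih hl.2, smul_smul]
    rfl

/-- The degree 0 component involves the frame only through the value of a top form, that is, through
a determinant. It is the base of the inductions that remove the frame. -/
theorem chatVol_apply_zero (he : ∀ i j, g (e i) (e j) = if i = j then 1 else 0) (a : Forms V) :
    chatVol g e a 0 ![] = reverseSign m * a m e := by
  rw [chatVol_eq, list_prod_chat_zero he _ (List.nodup_finRange m), List.length_finRange,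
    ContinuousAlternatingMap.smul_apply, iterIntMul_zero_apply, smul_eq_mul]
  congr 1
  have key : ∀ (l : List (Fin m)) (h : l.length = m),
      a l.length (fun t => e (l.get t)) = a m (fun t => e (l.get (Fin.cast h.symm t))) := by
    intro l h
    have : ∀ (k : ℕ) (h : l.length = k),
        a l.length (fun t => e (l.get t)) = a k (fun t => e (l.get (Fin.cast h.symm t))) := by
      rintro k rfl
      rfl
    exact this m h
  rw [key _ (List.length_finRange)]
  congr 1
  funext t
  simp

/-- The letter commutes with itself and anticommutes with the other m - 1, an odd number. -/
theorem chat_chatVol_of_even (hm : Even m) (he : ∀ i j, g (e i) (e j) = if i = j then 1 else 0)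
    (i : Fin m) (a : Forms V) :
    chat g (e i) (chatVol g e a) = -chatVol g e (chat g (e i) a) := by
  rw [chatVol_eq]
  have h := apply_list_prod (X := fun i => chat g (e i)) (chat g (e i))
    (fun j => if i = j then 1 else -1) (List.finRange m) (fun j _ a => by
      by_cases hij : i = j
      · subst hij; simp
      · rw [chat_frame_anticomm he i j hij]; simp [hij]) a
  rw [h, ← List.ofFn_eq_map, List.prod_ofFn, Finset.prod_ite]
  have : (Finset.univ.filter fun j => ¬ i = j).card + 1 = m := by
    have := Finset.card_filter_add_card_filter_not (s := (Finset.univ : Finset (Fin m)))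
      (fun j => i = j)
    rw [Finset.filter_eq] at this
    simp at this
    omega
  have hodd : Odd (Finset.univ.filter fun j => ¬ i = j).card := by
    rw [← this] at hm
    by_contra h
    rw [Nat.not_odd_iff_even] at h
    exact (Nat.not_even_iff_odd.mpr h.add_one) hm
  simp only [Finset.prod_const, one_pow, one_mul]
  rw [hodd.neg_one_pow]
  simp

theorem extMul_sub_intMul_chatVol (hm : Even m)
    (he : ∀ i j, g (e i) (e j) = if i = j then 1 else 0) (i : Fin m) (a : Forms V) :
    extMul (g (e i)) (chatVol g e a) - intMul (e i) (chatVol g e a) =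
      chatVol g e (extMul (g (e i)) a - intMul (e i) a) := by
  rw [chatVol_eq]
  have h := apply_list_prod_of_anticomm (X := fun i => chat g (e i))
    (extMul (g (e i)) - intMul (e i)) (List.finRange m)
    (fun j _ a => extMul_sub_intMul_chat_frame he i j a) a
  rw [List.length_finRange, hm.neg_one_pow, one_smul] at h
  exact h

/-- Since ι is half the difference of the two Clifford actions, and ĉ(dvol) anticommutes with the
first and commutes with the second, contraction turns into exterior multiplication, as with the
Hodge star. -/
theorem intMul_frame_chatVol (hm : Even m)
    (he : ∀ i j, g (e i) (e j) = if i = j then 1 else 0) (i : Fin m) (a : Forms V) :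
    intMul (e i) (chatVol g e a) = -chatVol g e (extMul (g (e i)) a) := by
  have h1 := chat_chatVol_of_even hm he i a
  have h2 := extMul_sub_intMul_chatVol hm he i a
  rw [chat_apply, chat_apply] at h1
  rw [map_sub] at h2
  rw [map_add] at h1
  have h3 : (2 : ℝ) • intMul (e i) (chatVol g e a) =
      (2 : ℝ) • -chatVol g e (extMul (g (e i)) a) := by
    have h4 : (2 : ℝ) • intMul (e i) (chatVol g e a) =
      (extMul (g (e i)) (chatVol g e a) + intMul (e i) (chatVol g e a)) -
      (extMul (g (e i)) (chatVol g e a) - intMul (e i) (chatVol g e a)) := by module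
    rw [h4, h1, h2]
    module
  exact smul_right_injective _ (two_ne_zero (α := ℝ)) h3

end Clifford

/-! ### The pairing ⟨a, ĉ(dvol) b⟩ and its independence of the metric up to a scalar -/

section Pairing

variable {V : Type*} [NormedAddCommGroup V] [NormedSpace ℝ V] {m : ℕ}

theorem intMul_add (u v : V) (a : Forms V) : intMul (u + v) a = intMul u a + intMul v a := by
  ext k x
  simp only [intMul_apply, Pi.add_apply, ContinuousAlternatingMap.add_apply]
  exact (a (k + 1)).toAlternatingMap.map_vecCons_add _ u v

theorem intMul_smul (c : ℝ) (v : V) (a : Forms V) : intMul (c • v) a = c • intMul v a := by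
  ext k x
  simp only [intMul_apply, Pi.smul_apply, ContinuousAlternatingMap.smul_apply]
  exact (a (k + 1)).toAlternatingMap.map_vecCons_smul _ c v

/-- The interior product as a linear map in the vector. -/
def intMulLin (a : Forms V) : V →ₗ[ℝ] Forms V where
  toFun v := intMul v a
  map_add' u v := intMul_add u v a
  map_smul' c v := intMul_smul c v a

/-- The exterior product as a linear map in the covector. -/
def extMulLin (a : Forms V) : (V →L[ℝ] ℝ) →ₗ[ℝ] Forms V where
  toFun θ := extMul θ a
  map_add' θ η := by rw [extMul_add]; rfl
  map_smul' c θ := by rw [extMul_smul]; rfl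

theorem intMul_sum (c : Fin m → ℝ) (v : Fin m → V) (a : Forms V) :
    intMul (∑ i, c i • v i) a = ∑ i, c i • intMul (v i) a := by
  change intMulLin a _ = _
  simp only [map_sum, map_smul]
  rfl

theorem extMul_sum_smul (c : Fin m → ℝ) (θ : Fin m → V →L[ℝ] ℝ) (a : Forms V) :
    extMul (∑ i, c i • θ i) a = ∑ i, c i • extMul (θ i) a := by
  change extMulLin a _ = _
  simp only [map_sum, map_smul]
  rfl

/-- The bilinear form `⟨a, ĉ(dvol) b⟩`. Up to signs this is the top degree part of `a ∧ b`. -/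
def pairing (g : V →L[ℝ] V →L[ℝ] ℝ) (e : Fin m → V) (a b : Forms V) : ℝ :=
  innerForms e a (chatVol g e b)

variable {g : V →L[ℝ] V →L[ℝ] ℝ} {e : Module.Basis (Fin m) ℝ V}

theorem pairing_single_zero (he : ∀ i j, g (e i) (e j) = if i = j then 1 else 0)
    (a : V [⋀^Fin 0]→L[ℝ] ℝ) (b : Forms V) :
    pairing g e (Pi.single 0 a) b = a ![] * (reverseSign m * b m e) := by
  rw [pairing, innerForms_single_zero, chatVol_apply_zero he]

variable [FiniteDimensional ℝ V]

theorem intMul_chatVol (hm : Even m) (he : ∀ i j, g (e i) (e j) = if i = j then 1 else 0)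
    (v : V) (a : Forms V) : intMul v (chatVol g e a) = -chatVol g e (extMul (g v) a) := by
  conv_lhs => rw [← sum_coframe_smul e v]
  conv_rhs => rw [← sum_coframe_smul e v]
  simp only [map_sum, map_smul]
  rw [intMul_sum, extMul_sum_smul]
  simp only [map_sum, map_smul, intMul_frame_chatVol hm he, smul_neg, Finset.sum_neg_distrib]

theorem covector_eq_sum_metric (he : ∀ i j, g (e i) (e j) = if i = j then 1 else 0)
    (θ : V →L[ℝ] ℝ) : θ = ∑ i, θ (e i) • g (e i) := by
  have h : ∀ i, g (e i) = coframe e i := by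
    intro i
    rw [covector_eq_sum e (g (e i))]
    simp [he]
  simp only [h]
  exact covector_eq_sum e θ

/-- The adjoint of θ ∧ is a contraction, which `intMul_chatVol` turns back into exterior
multiplication. Raising the index and lowering it again cancel, so no metric appears in the result.
-/
theorem pairing_extMul (hm : Even m) (he : ∀ i j, g (e i) (e j) = if i = j then 1 else 0)
    (θ : V →L[ℝ] ℝ) (a b : Forms V) :
    pairing g e (extMul θ a) b = -pairing g e a (extMul θ b) := by
  unfold pairing
  rw [innerForms_extMul]
  conv_rhs => rw [covector_eq_sum_metric he θ, extMul_sum_smul]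
  simp only [map_sum, map_smul, intMul_chatVol hm he, innerForms_sum_right, innerForms_smul_right,
    innerForms_neg_right, mul_neg, Finset.sum_neg_distrib]

theorem single_eq_sum (f : Module.Basis (Fin m) ℝ V) {k : ℕ} (a : V [⋀^Fin (k + 1)]→L[ℝ] ℝ) :
    (Pi.single (k + 1) a : Forms V) = ((k : ℝ) + 1)⁻¹ •
      ∑ i, extMul (coframe f i) (Pi.single k (a.curryLeft (f i))) := by
  simp only [extMul_single]
  conv_lhs => rw [form_eq_sum f a]
  funext l
  by_cases h : l = k + 1
  · subst h
    simp [Finset.sum_apply]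
  · rw [Pi.single_eq_of_ne h, Pi.smul_apply, Finset.sum_apply, Finset.sum_eq_zero, smul_zero]
    intro i _
    rw [Pi.single_eq_of_ne h]

/-- The pairings of two metrics differ by the determinant of the change of frame. -/
theorem pairing_eq_det_mul (hm : Even m) (he : ∀ i j, g (e i) (e j) = if i = j then 1 else 0)
    {g' : V →L[ℝ] V →L[ℝ] ℝ} {f : Module.Basis (Fin m) ℝ V}
    (hf : ∀ i j, g' (f i) (f j) = if i = j then 1 else 0) (a b : Forms V) :
    pairing g e a b = f.det e * pairing g' f a b := by
  -- Induction on the degree of a. A form of degree k + 1 is a combination of products of covectors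
  -- of f with k-forms, and such covectors cross both pairings by the same rule. In degree 0 only
  -- the value of a top form on the frame remains, which is where the determinant appears.
  have key : ∀ (k : ℕ) (a : V [⋀^Fin k]→L[ℝ] ℝ) (b : Forms V),
      pairing g e (Pi.single k a) b = f.det e * pairing g' f (Pi.single k a) b := by
    intro k
    induction k with
    | zero =>
      intro a b
      rw [pairing_single_zero he, pairing_single_zero hf, form_apply_basis_eq_det_mul f (b m) e]
      ring
    | succ k ih =>
      intro a b
      rw [single_eq_sum f]
      have h : ∀ (g : V →L[ℝ] V →L[ℝ] ℝ) (e : Module.Basis (Fin m) ℝ V)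
          (he : ∀ i j, g (e i) (e j) = if i = j then 1 else 0),
          pairing g e (((k : ℝ) + 1)⁻¹ •
            ∑ i, extMul (coframe f i) (Pi.single k (a.curryLeft (f i)))) b =
          ((k : ℝ) + 1)⁻¹ * ∑ i, -pairing g e (Pi.single k (a.curryLeft (f i)))
            (extMul (coframe f i) b) := by
        intro g e he
        rw [pairing, innerForms_smul_left, innerForms_sum_left]
        congr 1
        exact Finset.sum_congr rfl fun i _ => pairing_extMul hm he _ _ _
      rw [h g e he, h g' f hf, mul_left_comm, Finset.mul_sum (a := f.det e)]
      congr 1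
      refine Finset.sum_congr rfl fun i _ => ?_
      rw [ih]
      ring
  have h1 := innerForms_eq_sum_single e a (chatVol g e b)
  have h2 := innerForms_eq_sum_single f a (chatVol g' f b)
  rw [pairing, pairing, h1, h2, Finset.mul_sum]
  exact Finset.sum_congr rfl fun k _ => key k (a k) b

/-- The four signs cancel, and reversing four anticommuting factors takes six transpositions, an
even permutation. -/
theorem pairing_extMul_four (hm : Even m) (he : ∀ i j, g (e i) (e j) = if i = j then 1 else 0)
    (θ₁ θ₂ θ₃ θ₄ : V →L[ℝ] ℝ) (a b : Forms V) :
    pairing g e (extMul θ₁ (extMul θ₂ (extMul θ₃ (extMul θ₄ a)))) b =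
      pairing g e a (extMul θ₁ (extMul θ₂ (extMul θ₃ (extMul θ₄ b)))) := by
  rw [pairing_extMul hm he, pairing_extMul hm he, pairing_extMul hm he, pairing_extMul hm he]
  simp only [neg_neg]
  congr 1
  rw [extMul_extMul θ₂ θ₁ b, map_neg, extMul_extMul θ₃ θ₁, neg_neg, extMul_extMul θ₄ θ₁,
    extMul_extMul θ₃ θ₂ b, map_neg, extMul_extMul θ₄ θ₂, neg_neg, extMul_extMul θ₄ θ₃ b, map_neg,
    map_neg, neg_neg]

end Pairing

/-! ### Multiplication by ψ in coordinates -/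

section Psi

variable {V : Type*} [NormedAddCommGroup V] [NormedSpace ℝ V] {m : ℕ}

theorem covectorMul_smul {d : ℕ} (θ : V →L[ℝ] ℝ) (c : ℝ) (x : V [⋀^Fin d]→L[ℝ] ℝ) :
    covectorMul θ (c • x) = c • covectorMul θ x := by
  ext v
  simp only [covectorMul_apply, ContinuousAlternatingMap.smul_apply, Finset.smul_sum]
  exact Finset.sum_congr rfl fun i _ => by simp; ring

theorem covectorMul_zero {d : ℕ} (θ : V →L[ℝ] ℝ) :
    covectorMul θ (0 : V [⋀^Fin d]→L[ℝ] ℝ) = 0 := by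
  simpa using covectorMul_smul θ 0 (0 : V [⋀^Fin d]→L[ℝ] ℝ)

theorem covectorMul_sum {d : ℕ} (θ : V →L[ℝ] ℝ) (x : Fin m → V [⋀^Fin d]→L[ℝ] ℝ) :
    covectorMul θ (∑ i, x i) = ∑ i, covectorMul θ (x i) := by
  ext v
  simp only [covectorMul_apply, ContinuousAlternatingMap.sum_apply, Finset.mul_sum]
  rw [Finset.sum_comm]

theorem wedge_zero_left_eq_smul {l : ℕ} (h : 0 + l = l) (a : V [⋀^Fin 0]→L[ℝ] ℝ)
    (b : V [⋀^Fin l]→L[ℝ] ℝ) : wedge h a b = a ![] • b := by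
  ext v
  rw [wedge_zero_left]
  rfl

variable [FiniteDimensional ℝ V]

/-- Four uses of `succ_smul_wedge` with factors 4, 3, 2, 1, hence 24. In degrees below 4 both sides
vanish. -/
theorem psiMul_eq_sum (f : Module.Basis (Fin m) ℝ V) (w : V [⋀^Fin 2]→L[ℝ] ℝ) (a : Forms V) :
    psiMul w a = (24 : ℝ)⁻¹ • ∑ i, ∑ j, ∑ k, ∑ l, psi w ![f i, f j, f k, f l] •
      extMul (coframe f i) (extMul (coframe f j) (extMul (coframe f k)
        (extMul (coframe f l) a))) := by
  have key : ∀ (d : ℕ) (p : V [⋀^Fin 4]→L[ℝ] ℝ) (b : V [⋀^Fin d]→L[ℝ] ℝ),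
      wedge (Nat.add_comm 4 d) p b = (24 : ℝ)⁻¹ • ∑ i, ∑ j, ∑ k, ∑ l, p ![f i, f j, f k, f l] •
      covectorMul (coframe f i) (covectorMul (coframe f j) (covectorMul (coframe f k)
        (covectorMul (coframe f l) b))) := by
    intro d p b
    have h4 := succ_smul_wedge f (k := 3) (l := d) (m := d + 3) (by omega) (by omega) p b
    have h3 := fun i => succ_smul_wedge f (k := 2) (l := d) (m := d + 2) (by omega) (by omega)
      (p.curryLeft (f i)) b
    have h2 := fun i j => succ_smul_wedge f (k := 1) (l := d) (m := d + 1) (by omega) (by omega)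
      ((p.curryLeft (f i)).curryLeft (f j)) b
    have h1 := fun i j k => succ_smul_wedge f (k := 0) (l := d) (m := d) (by omega) (by omega)
      (((p.curryLeft (f i)).curryLeft (f j)).curryLeft (f k)) b
    simp only [wedge_zero_left_eq_smul, covectorMul_smul] at h1
    have e1 : ∀ i j k, wedge (by omega) (((p.curryLeft (f i)).curryLeft (f j)).curryLeft (f k)) b =
        ∑ l, p ![f i, f j, f k, f l] • covectorMul (coframe f l) b := by
      intro i j k
      have := h1 i j k
      norm_num at this
      exact this
    have e2 : ∀ i j, wedge (by omega) ((p.curryLeft (f i)).curryLeft (f j)) b = (2 : ℝ)⁻¹ •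
        ∑ k, ∑ l, p ![f i, f j, f k, f l] •
          covectorMul (coframe f k) (covectorMul (coframe f l) b) := by
      intro i j
      have := h2 i j
      simp only [e1, covectorMul_sum, covectorMul_smul] at this
      rw [← this]
      simp only [smul_smul]
      norm_num
    have e3 : ∀ i, wedge (by omega) (p.curryLeft (f i)) b = (6 : ℝ)⁻¹ •
        ∑ j, ∑ k, ∑ l, p ![f i, f j, f k, f l] • covectorMul (coframe f j)
          (covectorMul (coframe f k) (covectorMul (coframe f l) b)) := by
      intro i
      have := h3 i
      simp only [e2, covectorMul_sum, covectorMul_smul] at this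
      rw [← Finset.smul_sum, ← inv_smul_eq_iff₀ (by norm_num)] at this
      rw [← this]
      simp only [smul_smul]
      norm_num
    simp only [e3, covectorMul_sum, covectorMul_smul] at h4
    rw [← Finset.smul_sum, ← inv_smul_eq_iff₀ (by norm_num)] at h4
    rw [← h4]
    simp only [smul_smul]
    norm_num
  funext d
  simp only [Pi.smul_apply, Finset.sum_apply]
  rcases d with _ | _ | _ | _ | d
  · simp [psiMul, extMul_zero_apply]
  · simp [psiMul, extMul_zero_apply, extMul_succ_apply, covectorMul_zero]
  · simp [psiMul, extMul_zero_apply, extMul_succ_apply, covectorMul_zero]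
  · simp [psiMul, extMul_zero_apply, extMul_succ_apply, covectorMul_zero]
  · exact key d (psi w) (a d)

end Psi

/-! ### Symmetry of ψ ∧ for the pairing -/

section PairingPsi

variable {V : Type*} [NormedAddCommGroup V] [NormedSpace ℝ V] {m : ℕ} [FiniteDimensional ℝ V]
  {g : V →L[ℝ] V →L[ℝ] ℝ} {e : Module.Basis (Fin m) ℝ V}

theorem pairing_psiMul (hm : Even m) (he : ∀ i j, g (e i) (e j) = if i = j then 1 else 0)
    (w : V [⋀^Fin 2]→L[ℝ] ℝ) (a b : Forms V) :
    pairing g e (psiMul w a) b = pairing g e a (psiMul w b) := by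
  rw [psiMul_eq_sum e, psiMul_eq_sum e]
  have h : ∀ θ₁ θ₂ θ₃ θ₄ : V →L[ℝ] ℝ,
      innerForms e (extMul θ₁ (extMul θ₂ (extMul θ₃ (extMul θ₄ a)))) (chatVol g e b) =
      innerForms e a (chatVol g e (extMul θ₁ (extMul θ₂ (extMul θ₃ (extMul θ₄ b))))) :=
    fun _ _ _ _ => pairing_extMul_four hm he _ _ _ _ a b
  simp only [pairing, map_smul, map_sum, innerForms_smul_left, innerForms_sum_left,
    innerForms_smul_right, innerForms_sum_right, h]

theorem psiMul_add (f : Module.Basis (Fin m) ℝ V) (w : V [⋀^Fin 2]→L[ℝ] ℝ) (a b : Forms V) :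
    psiMul w (a + b) = psiMul w a + psiMul w b := by
  simp only [psiMul_eq_sum f, map_add, smul_add, Finset.sum_add_distrib]

theorem psiMul_smul (f : Module.Basis (Fin m) ℝ V) (w : V [⋀^Fin 2]→L[ℝ] ℝ) (c : ℝ)
    (a : Forms V) : psiMul w (c • a) = c • psiMul w a := by
  simp only [psiMul_eq_sum f, map_smul, Finset.smul_sum, smul_comm _ c]

end PairingPsi

/-! ### Powers of a nondegenerate `2`-form -/

section Power

variable {V : Type*} [NormedAddCommGroup V] [NormedSpace ℝ V] {m : ℕ} [FiniteDimensional ℝ V]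

theorem wedge_two_eq_sum (f : Module.Basis (Fin m) ℝ V) {d l : ℕ} (h : 2 + d = l) (h' : l = d + 2)
    (w : V [⋀^Fin 2]→L[ℝ] ℝ) (b : V [⋀^Fin d]→L[ℝ] ℝ) :
    (Pi.single l (wedge h w b) : Forms V) = (2 : ℝ)⁻¹ • ∑ i, ∑ j, w ![f i, f j] •
      extMul (coframe f i) (extMul (coframe f j) (Pi.single d b)) := by
  subst h'
  have h2 := succ_smul_wedge f (k := 1) (l := d) (m := d + 1) (by omega) (by omega) w b
  have h1 := fun i => succ_smul_wedge f (k := 0) (l := d) (m := d) (by omega) (by omega)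
    (w.curryLeft (f i)) b
  simp only [wedge_zero_left_eq_smul, covectorMul_smul] at h1
  have e1 : ∀ i, wedge (by omega) (w.curryLeft (f i)) b =
      ∑ j, w ![f i, f j] • covectorMul (coframe f j) b := by
    intro i
    have := h1 i
    norm_num at this
    exact this
  have e2 : wedge h w b = (2 : ℝ)⁻¹ • ∑ i, ∑ j, w ![f i, f j] •
      covectorMul (coframe f i) (covectorMul (coframe f j) b) := by
    simp only [e1, covectorMul_sum, covectorMul_smul] at h2
    rw [← h2]
    simp only [smul_smul]
    norm_num
  rw [e2]
  simp only [extMul_single]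
  funext l
  by_cases hl : l = d + 2
  · subst hl
    simp [Finset.sum_apply]
  · rw [Pi.single_eq_of_ne hl]
    simp only [Pi.smul_apply, Finset.sum_apply]
    symm
    simp [Pi.single_eq_of_ne hl]

/-- The operator `w ∧ ·` in a basis. -/
def lefschetz (f : Module.Basis (Fin m) ℝ V) (w : V [⋀^Fin 2]→L[ℝ] ℝ) (a : Forms V) : Forms V :=
  (2 : ℝ)⁻¹ • ∑ i, ∑ j, w ![f i, f j] • extMul (coframe f i) (extMul (coframe f j) a)

/-- The contraction `w(v, ·)`. -/
def contraction (w : V [⋀^Fin 2]→L[ℝ] ℝ) (v : V) : V →L[ℝ] ℝ :=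
  metric w (ContinuousLinearMap.id ℝ V) v

omit [FiniteDimensional ℝ V] in
theorem contraction_apply (w : V [⋀^Fin 2]→L[ℝ] ℝ) (u v : V) : contraction w u v = w ![u, v] :=
  metric_apply _ _ _ _

omit [FiniteDimensional ℝ V] in
theorem twoForm_swap (w : V [⋀^Fin 2]→L[ℝ] ℝ) (u v : V) : w ![u, v] = -w ![v, u] := by
  have h := w.toAlternatingMap.map_swap (v := ![v, u]) (i := 0) (j := 1) (by simp)
  have h' : ![v, u] ∘ Equiv.swap (0 : Fin 2) 1 = ![u, v] := by
    funext i
    fin_cases i <;> simp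
  rw [h'] at h
  exact h

theorem extMul_lefschetz (f : Module.Basis (Fin m) ℝ V) (w : V [⋀^Fin 2]→L[ℝ] ℝ)
    (θ : V →L[ℝ] ℝ) (a : Forms V) :
    extMul θ (lefschetz f w a) = lefschetz f w (extMul θ a) := by
  simp only [lefschetz, map_smul, map_sum]
  congr 1
  refine Finset.sum_congr rfl fun i _ => Finset.sum_congr rfl fun j _ => ?_
  rw [extMul_extMul θ, extMul_extMul θ, map_neg, neg_neg]

/-- The contraction meets either of the two covectors. By antisymmetry of w both cross terms equal
w(v, ·) ∧ a, which absorbs the factor 1/2. -/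
theorem intMul_lefschetz (f : Module.Basis (Fin m) ℝ V) (w : V [⋀^Fin 2]→L[ℝ] ℝ)
    (v : V) (a : Forms V) :
    intMul v (lefschetz f w a) = lefschetz f w (intMul v a) + extMul (contraction w v) a := by
  have h1 : ∀ i j, intMul v (extMul (coframe f i) (extMul (coframe f j) a)) =
      coframe f i v • extMul (coframe f j) a - coframe f j v • extMul (coframe f i) a +
        extMul (coframe f i) (extMul (coframe f j) (intMul v a)) := by
    intro i j
    rw [intMul_extMul, intMul_extMul, map_sub, map_smul]
    abel
  have h2 : extMul (contraction w v) a =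
      ∑ i, ∑ j, (w ![f i, f j] * coframe f i v) • extMul (coframe f j) a := by
    have : contraction w v = ∑ j, (∑ i, w ![f i, f j] * coframe f i v) • coframe f j := by
      conv_lhs => rw [covector_eq_sum f (contraction w v)]
      refine Finset.sum_congr rfl fun j _ => ?_
      congr 1
      conv_lhs => rw [← sum_coframe_smul f v]
      unfold contraction
      simp only [map_sum, map_smul, sum_apply, smul_apply,
        metric_apply]
      exact Finset.sum_congr rfl fun i _ => by simp [mul_comm]
    rw [this, extMul_sum_smul, Finset.sum_comm]
    exact Finset.sum_congr rfl fun j _ => by rw [Finset.sum_smul]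
  have h3 : ∑ i, ∑ j, w ![f i, f j] • (coframe f j v • extMul (coframe f i) a) =
      -extMul (contraction w v) a := by
    rw [h2, Finset.sum_comm, ← Finset.sum_neg_distrib]
    refine Finset.sum_congr rfl fun i _ => ?_
    rw [← Finset.sum_neg_distrib]
    refine Finset.sum_congr rfl fun j _ => ?_
    rw [twoForm_swap w (f j) (f i), smul_smul]
    module
  have h4 : ∑ i, ∑ j, w ![f i, f j] • (coframe f i v • extMul (coframe f j) a) =
      extMul (contraction w v) a := by
    rw [h2]
    simp only [smul_smul]
  simp only [lefschetz, map_smul, map_sum, h1, smul_add, smul_sub, Finset.sum_add_distrib,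
    Finset.sum_sub_distrib]
  rw [← smul_sub, h3, h4]
  module

/-- `w ^ N` as an inhomogeneous form. -/
def powerForm (w : V [⋀^Fin 2]→L[ℝ] ℝ) (N : ℕ) : Forms V := Pi.single (2 * N) (wedgePow w N)

theorem powerForm_succ (f : Module.Basis (Fin m) ℝ V) (w : V [⋀^Fin 2]→L[ℝ] ℝ) (N : ℕ) :
    powerForm w (N + 1) = lefschetz f w (powerForm w N) :=
  wedge_two_eq_sum f (by ring) (by ring) w (wedgePow w N)

omit [FiniteDimensional ℝ V] in
theorem intMul_single_zero (v : V) (a : V [⋀^Fin 0]→L[ℝ] ℝ) :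
    intMul v (Pi.single 0 a) = (0 : Forms V) := by
  ext k x
  rw [intMul_apply, Pi.single_eq_of_ne (by omega)]
  rfl

theorem intMul_powerForm_succ (f : Module.Basis (Fin m) ℝ V) (w : V [⋀^Fin 2]→L[ℝ] ℝ) (v : V)
    (N : ℕ) : intMul v (powerForm w (N + 1)) =
      ((N : ℝ) + 1) • extMul (contraction w v) (powerForm w N) := by
  induction N with
  | zero =>
    rw [powerForm_succ f, intMul_lefschetz]
    have : intMul v (powerForm w 0) = 0 := intMul_single_zero v _
    rw [this]
    simp [lefschetz]
  | succ N ih =>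
    rw [powerForm_succ f, intMul_lefschetz, ih]
    have : lefschetz f w (((N : ℝ) + 1) • extMul (contraction w v) (powerForm w N)) =
        ((N : ℝ) + 1) • extMul (contraction w v) (powerForm w (N + 1)) := by
      rw [powerForm_succ f, extMul_lefschetz]
      simp only [lefschetz, map_smul, Finset.smul_sum]
      simp only [smul_comm ((N : ℝ) + 1)]
    rw [this]
    push_cast
    module

/-- The sum of the anticommutators of ι and eⁱ ∧ is m, while the sum in the opposite order is k by
Euler's identity. -/
theorem sum_intMul_extMul_single (f : Module.Basis (Fin m) ℝ V) {k : ℕ} (a : V [⋀^Fin k]→L[ℝ] ℝ) :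
    ∑ i, intMul (f i) (extMul (coframe f i) (Pi.single k a)) =
      ((m : ℝ) - k) • (Pi.single k a : Forms V) := by
  have h1 : ∀ i, intMul (f i) (extMul (coframe f i) (Pi.single k a)) = (Pi.single k a : Forms V) -
      extMul (coframe f i) (intMul (f i) (Pi.single k a)) := by
    intro i
    rw [intMul_extMul, coframe_apply]
    simp
  simp only [h1, Finset.sum_sub_distrib]
  have h2 : ∑ i, extMul (coframe f i) (intMul (f i) (Pi.single k a)) =
      (k : ℝ) • (Pi.single k a : Forms V) := by
    rcases k with _ | k
    · simp [intMul_single_zero]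
    · have : ∀ i, intMul (f i) (Pi.single (k + 1) a) =
          (Pi.single k (a.curryLeft (f i)) : Forms V) := by
        intro i
        funext l
        by_cases hl : l = k
        · subst hl
          ext x
          simp [intMul_apply]
        · ext x
          rw [intMul_apply, Pi.single_eq_of_ne (by omega), Pi.single_eq_of_ne hl]
          rfl
      simp only [this]
      have := single_eq_sum f a
      rw [this, smul_smul]
      push_cast
      rw [mul_inv_cancel₀ (by positivity), one_smul]
  rw [h2]
  simp
  module

theorem contraction_surjective (w : V [⋀^Fin 2]→L[ℝ] ℝ)
    (hw : ∀ u, (∀ v, w ![u, v] = 0) → u = 0) (θ : V →L[ℝ] ℝ) : ∃ v, contraction w v = θ := by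
  let φ : V →ₗ[ℝ] (V →L[ℝ] ℝ) := (metric w (ContinuousLinearMap.id ℝ V)).toLinearMap
  have hinj : Function.Injective φ := by
    rw [← LinearMap.ker_eq_bot, LinearMap.ker_eq_bot']
    intro u hu
    refine hw u fun v => ?_
    rw [← contraction_apply]
    exact DFunLike.congr_fun hu v
  have hfin : Module.finrank ℝ V = Module.finrank ℝ (V →L[ℝ] ℝ) := by
    rw [← LinearEquiv.finrank_eq (LinearMap.toContinuousLinearMap (𝕜 := ℝ) (E := V) (F' := ℝ))]
    exact (Subspace.dual_finrank_eq (K := ℝ) (V := V)).symm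
  exact (LinearMap.injective_iff_surjective_of_finrank_eq_finrank hfin).mp hinj θ

/-- The powers of a nondegenerate form do not vanish in degrees at most the dimension. -/
theorem powerForm_ne_zero (f : Module.Basis (Fin m) ℝ V) (w : V [⋀^Fin 2]→L[ℝ] ℝ)
    (hw : ∀ u, (∀ v, w ![u, v] = 0) → u = 0) (N : ℕ) (hN : 2 * N ≤ m) : powerForm w N ≠ 0 := by
  induction N with
  | zero =>
    intro h
    have := congrFun h 0
    have h1 : powerForm w 0 0 = wedgePow w 0 := Pi.single_eq_same _ _
    rw [h1] at this
    have h2 := DFunLike.congr_fun this ![]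
    simp [wedgePow] at h2
  | succ N ih =>
    intro h
    apply ih (by omega)
    -- Contracting w^(N+1) = 0 with v gives w(v, ·) ∧ w^N = 0, and nondegeneracy makes w(v, ·) an
    -- arbitrary covector. Then `sum_intMul_extMul_single` gives (m - 2N) w^N = 0 with 2N < m.
    have h1 : ∀ θ, extMul θ (powerForm w N) = 0 := by
      intro θ
      obtain ⟨v, rfl⟩ := contraction_surjective w hw θ
      have := intMul_powerForm_succ f w v N
      rw [h, map_zero] at this
      exact (smul_eq_zero.mp this.symm).resolve_left (by positivity)
    have h2 := sum_intMul_extMul_single f (wedgePow w N)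
    have h3 : (Pi.single (2 * N) (wedgePow w N) : Forms V) = powerForm w N := rfl
    simp only [h3, h1, map_zero, Finset.sum_const_zero] at h2
    refine (smul_eq_zero.mp h2.symm).resolve_left ?_
    have : ((2 * N : ℕ) : ℝ) < m := by exact_mod_cast (by omega : 2 * N < m)
    linarith

omit [FiniteDimensional ℝ V] in
theorem form_eq_zero_of_apply_basis (f : Module.Basis (Fin m) ℝ V) (a : V [⋀^Fin m]→L[ℝ] ℝ)
    (h : a f = 0) : a = 0 := by
  have h1 := AlternatingMap.eq_smul_basis_det f a.toAlternatingMap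
  have h2 : a.toAlternatingMap f = 0 := h
  rw [h2, zero_smul] at h1
  ext v
  exact DFunLike.congr_fun h1 v

/-- The value of the top power of `w` on a tuple of vectors. -/
def topPower {n : ℕ} (w : V [⋀^Fin 2]→L[ℝ] ℝ) (e : Fin (4 * n + 2) → V) : ℝ :=
  wedgePow w (2 * n + 1) (fun i => e (Fin.cast (by ring) i))

theorem topPower_ne_zero {n : ℕ} (f : Module.Basis (Fin (4 * n + 2)) ℝ V)
    (w : V [⋀^Fin 2]→L[ℝ] ℝ) (hw : ∀ u, (∀ v, w ![u, v] = 0) → u = 0) : topPower w f ≠ 0 := by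
  intro h
  refine powerForm_ne_zero f w hw (2 * n + 1) (by omega) ?_
  have : wedgePow w (2 * n + 1) = 0 := by
    refine form_eq_zero_of_apply_basis (f.reindex (finCongr (by ring))) _ ?_
    rw [← h, topPower]
    congr 1
    funext i
    simp
  rw [powerForm, this, Pi.single_zero]

omit [FiniteDimensional ℝ V] in
theorem topPower_eq_det_mul {n : ℕ} (f : Module.Basis (Fin (4 * n + 2)) ℝ V)
    (w : V [⋀^Fin 2]→L[ℝ] ℝ) (e : Fin (4 * n + 2) → V) :
    topPower w e = f.det e * topPower w f := by
  have h : 4 * n + 2 = 2 * (2 * n + 1) := by ring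
  have := form_apply_basis_eq_det_mul (f.reindex (finCongr h)) (wedgePow w (2 * n + 1))
    (fun i => e (Fin.cast (by ring) i))
  rw [Module.Basis.det_reindex] at this
  have h2 : (⇑(f.reindex (finCongr h))) = fun i => f (Fin.cast (by ring) i) := by
    funext i
    simp
  rw [h2] at this
  exact this

end Power

/-! ### Oriented orthonormal frames and the Gram determinant -/

section OrientedFrame

variable {V : Type*} [NormedAddCommGroup V] [NormedSpace ℝ V]

/-- A linear symplectic form with a compatible complex structure. -/
structure IsCompatiblePair (w : V [⋀^Fin 2]→L[ℝ] ℝ) (J : V →L[ℝ] V) : Prop where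
  sq : ∀ u, J (J u) = -u
  invariant : ∀ u v, w ![J u, J v] = w ![u, v]
  tame : ∀ u, u ≠ 0 → 0 < w ![u, J u]

variable {w : V [⋀^Fin 2]→L[ℝ] ℝ} {J : V →L[ℝ] V}

theorem IsCompatiblePair.nondegenerate (h : IsCompatiblePair w J) (u : V)
    (hu : ∀ v, w ![u, v] = 0) : u = 0 := by
  by_contra hne
  exact (h.tame u hne).ne' (hu _)

theorem IsCompatiblePair.metric_comm (h : IsCompatiblePair w J) (u v : V) :
    metric w J u v = metric w J v u := by
  rw [metric_apply, metric_apply, twoForm_swap w v, ← h.invariant u, h.sq]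
  have : w ![J u, -v] = -w ![J u, v] := by
    rw [← contraction_apply, ← contraction_apply, map_neg]
  rw [this]

theorem orthonormal_linearIndependent {m : ℕ} {g : V →L[ℝ] V →L[ℝ] ℝ} {e : Fin m → V}
    (he : ∀ i j, g (e i) (e j) = if i = j then 1 else 0) : LinearIndependent ℝ e := by
  rw [Fintype.linearIndependent_iff]
  intro c hc i
  have := congrArg (fun v => g v (e i)) hc
  simpa [he] using this

/-- An orthonormal family of the right size is a basis. -/
def frameBasis {m : ℕ} {g : V →L[ℝ] V →L[ℝ] ℝ} {e : Fin m → V}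
    (he : ∀ i j, g (e i) (e j) = if i = j then 1 else 0) (f : Module.Basis (Fin m) ℝ V) :
    Module.Basis (Fin m) ℝ V :=
  haveI : FiniteDimensional ℝ V := f.finiteDimensional_of_finite
  haveI := orthonormal_linearIndependent he
  Module.Basis.mk this (by
    have := this.span_eq_top_of_card_eq_finrank' (by simp [Module.finrank_eq_card_basis f])
    exact this.ge)

theorem coe_frameBasis {m : ℕ} {g : V →L[ℝ] V →L[ℝ] ℝ} {e : Fin m → V}
    (he : ∀ i j, g (e i) (e j) = if i = j then 1 else 0) (f : Module.Basis (Fin m) ℝ V) :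
    ⇑(frameBasis he f) = e := by
  simp [frameBasis]

theorem exists_orthonormal_basis {m : ℕ} (f : Module.Basis (Fin m) ℝ V)
    (h : IsCompatiblePair w J) :
    ∃ e : Module.Basis (Fin m) ℝ V, ∀ i j, metric w J (e i) (e j) = if i = j then 1 else 0 := by
  have : FiniteDimensional ℝ V := f.finiteDimensional_of_finite
  let B : LinearMap.BilinForm ℝ V :=
    LinearMap.mk₂ ℝ (fun u v => metric w J u v) (by simp) (by simp) (by simp) (by simp)
  have hB : LinearMap.IsSymm B := ⟨fun u v => h.metric_comm u v⟩
  obtain ⟨v, hv⟩ := LinearMap.BilinForm.exists_orthogonal_basis hB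
  have hd : Module.finrank ℝ V = m := by simp [Module.finrank_eq_card_basis f]
  let v' := v.reindex (finCongr hd)
  have hpos : ∀ i, 0 < metric w J (v' i) (v' i) := fun i => by
    rw [metric_apply]; exact h.tame _ (v'.ne_zero i)
  have horth : ∀ i j, i ≠ j → metric w J (v' i) (v' j) = 0 := by
    intro i j hij
    have : (finCongr hd).symm i ≠ (finCongr hd).symm j :=
      fun h => hij ((finCongr hd).symm.injective h)
    have h0 : metric w J (v ((finCongr hd).symm i)) (v ((finCongr hd).symm j)) = 0 := hv this
    rw [Module.Basis.reindex_apply, Module.Basis.reindex_apply]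
    exact h0
  have hu : ∀ i, IsUnit (Real.sqrt (metric w J (v' i) (v' i)))⁻¹ := fun i =>
    (isUnit_iff_ne_zero.mpr (by have := Real.sqrt_pos.mpr (hpos i); positivity))
  refine ⟨v'.isUnitSMul hu, fun i j => ?_⟩
  simp only [Module.Basis.isUnitSMul_apply, map_smul, smul_apply, smul_eq_mul]
  by_cases hij : i = j
  · subst hij
    have h1 := Real.mul_self_sqrt (hpos i).le
    have h2 := (Real.sqrt_pos.mpr (hpos i)).ne'
    simp only [if_true]
    field_simp
    linarith
  · rw [horth i j hij]
    simp [hij]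

theorem exists_isOrientedFrame {n : ℕ} (f : Module.Basis (Fin (4 * n + 2)) ℝ V)
    (h : IsCompatiblePair w J) : ∃ e : Fin (4 * n + 2) → V, IsOrientedFrame w J e := by
  have : FiniteDimensional ℝ V := f.finiteDimensional_of_finite
  obtain ⟨e, he⟩ := exists_orthonormal_basis f h
  have hne := topPower_ne_zero e w h.nondegenerate
  rcases hne.lt_or_gt with hlt | hgt
  -- Reversing the first vector keeps orthonormality and changes the orientation.
  · let s : Fin (4 * n + 2) → ℝ := fun i => if i = 0 then -1 else 1
    have hs : ∀ i, s i * s i = 1 := fun i => by by_cases hi : i = 0 <;> simp [s, hi]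
    refine ⟨fun i => s i • e i, fun i j => ?_, ?_⟩
    · simp only [map_smul, smul_apply, he, smul_eq_mul]
      by_cases hij : i = j
      · subst hij
        simp [hs]
      · simp [hij]
    · have h1 : topPower w (fun i => s i • e i) = (∏ i, s i) * topPower w e := by
        rw [topPower_eq_det_mul e, AlternatingMap.map_smul_univ, Module.Basis.det_self]
        simp
      have h2 : ∏ i, s i = -1 := by simp [s, Finset.prod_ite_eq']
      change 0 < topPower w (fun i => s i • e i)
      rw [h1, h2]
      linarith
  · exact ⟨e, he, hgt⟩

theorem isOrientedFrame_frame {n : ℕ} (f : Module.Basis (Fin (4 * n + 2)) ℝ V)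
    (h : IsCompatiblePair w J) : IsOrientedFrame w J (frame n w J) :=
  Classical.epsilon_spec (exists_isOrientedFrame f h)

/-- If P expresses e in the basis f and G is the Gram matrix of f, orthonormality of e reads Pᵀ G P
= 1. -/
theorem det_sq_mul_det_gram {m : ℕ} {g : V →L[ℝ] V →L[ℝ] ℝ} (e f : Module.Basis (Fin m) ℝ V)
    (he : ∀ i j, g (e i) (e j) = if i = j then 1 else 0) :
    f.det e ^ 2 * (Matrix.of fun i j => g (f i) (f j)).det = 1 := by
  let B : LinearMap.BilinForm ℝ V :=
    LinearMap.mk₂ ℝ (fun u v => g u v) (by simp) (by simp) (by simp) (by simp)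
  have h := LinearMap.BilinForm.toMatrix_mul_basis_toMatrix (b := f) e B
  have h1 : LinearMap.BilinForm.toMatrix e B = 1 := by
    ext i j
    rw [LinearMap.BilinForm.toMatrix_apply, Matrix.one_apply]
    exact he i j
  have h2 : LinearMap.BilinForm.toMatrix f B = Matrix.of fun i j => g (f i) (f j) := by
    ext i j
    rw [LinearMap.BilinForm.toMatrix_apply]
    rfl
  rw [h1, h2] at h
  have h3 := congrArg Matrix.det h
  rw [Matrix.det_mul, Matrix.det_mul, Matrix.det_transpose, Matrix.det_one,
    ← Module.Basis.det_apply] at h3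
  linarith

theorem det_gram_pos {m : ℕ} {g : V →L[ℝ] V →L[ℝ] ℝ} (e f : Module.Basis (Fin m) ℝ V)
    (he : ∀ i j, g (e i) (e j) = if i = j then 1 else 0) :
    0 < (Matrix.of fun i j => g (f i) (f j)).det := by
  have h := det_sq_mul_det_gram e f he
  by_contra hneg
  have : f.det e ^ 2 * (Matrix.of fun i j => g (f i) (f j)).det ≤ 0 :=
    mul_nonpos_of_nonneg_of_nonpos (sq_nonneg _) (not_lt.mp hneg)
  linarith

/-- The orientation of a basis relative to the top power of `w`. -/
def orientationSign {n : ℕ} (w : V [⋀^Fin 2]→L[ℝ] ℝ) (f : Fin (4 * n + 2) → V) : ℝ :=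
  if 0 < topPower w f then 1 else -1

/-- The square is 1 by `det_sq_mul_det_gram`. The sign is that of the top power of w on f, because
the top power is positive on e and scales by the determinant. -/
theorem det_mul_sqrt_det_gram {n : ℕ} (e f : Module.Basis (Fin (4 * n + 2)) ℝ V)
    (he : IsOrientedFrame w J e) :
    f.det e * Real.sqrt (Matrix.of fun i j => metric w J (f i) (f j)).det =
      orientationSign w f := by
  have hpos := det_gram_pos e f he.1
  have hsq := det_sq_mul_det_gram e f he.1
  have hor : 0 < f.det e * topPower w f := by
    rw [← topPower_eq_det_mul]
    exact he.2
  set G := (Matrix.of fun i j => metric w J (f i) (f j)).det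
  have hs := Real.sqrt_pos.mpr hpos
  have h1 : (f.det e * Real.sqrt G) ^ 2 = 1 := by
    rw [mul_pow, Real.sq_sqrt hpos.le, hsq]
  unfold orientationSign
  split_ifs with h
  · have : 0 < f.det e := pos_of_mul_pos_left hor h.le
    have h2 : 0 < f.det e * Real.sqrt G := mul_pos this hs
    nlinarith
  · have : f.det e < 0 := by
      by_contra hge
      exact absurd hor (not_lt.mpr (mul_nonpos_of_nonneg_of_nonpos (not_lt.mp hge) (not_lt.mp h)))
    have h2 : f.det e * Real.sqrt G < 0 := mul_neg_of_neg_of_pos this hs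
    nlinarith

end OrientedFrame

/-! ### Pullbacks -/

section Pullback

variable {V W : Type*} [NormedAddCommGroup V] [NormedSpace ℝ V] [NormedAddCommGroup W]
  [NormedSpace ℝ W] {m : ℕ}

/-- The pullback of inhomogeneous forms. -/
def pullForms (L : V →L[ℝ] W) : Forms W →ₗ[ℝ] Forms V where
  toFun a k := (a k).compContinuousLinearMap L
  map_add' _ _ := rfl
  map_smul' _ _ := rfl

theorem pullForms_apply (L : V →L[ℝ] W) (a : Forms W) (k : ℕ) :
    pullForms L a k = (a k).compContinuousLinearMap L := rfl

theorem pullForms_extMul (L : V →L[ℝ] W) (θ : W →L[ℝ] ℝ) (a : Forms W) :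
    pullForms L (extMul θ a) = extMul (θ.comp L) (pullForms L a) := by
  funext k
  rcases k with _ | k
  · ext v; simp [pullForms_apply, extMul_zero_apply]
  · ext v
    simp only [pullForms_apply, extMul_succ_apply,
      ContinuousAlternatingMap.compContinuousLinearMap_apply, covectorMul_apply]
    rfl

theorem pullForms_intMul (L : V →L[ℝ] W) (v : V) (a : Forms W) :
    pullForms L (intMul (L v) a) = intMul v (pullForms L a) := by
  ext k x
  simp only [pullForms_apply, ContinuousAlternatingMap.compContinuousLinearMap_apply, intMul_apply]
  congr 1
  funext i
  refine Fin.cases ?_ (fun i => ?_) i <;> simp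

theorem pullForms_chat (L : V →L[ℝ] W) (g : W →L[ℝ] W →L[ℝ] ℝ) (v : V) (a : Forms W) :
    pullForms L (chat g (L v) a) = chat (g.bilinearComp L L) v (pullForms L a) := by
  rw [chat_apply, map_add, pullForms_extMul, pullForms_intMul]
  rfl

/-- Each letter ĉ(Lv) is natural under pullback once the metric is pulled back as well; L need not
be invertible. -/
theorem pullForms_chatVol (L : V →L[ℝ] W) (g : W →L[ℝ] W →L[ℝ] ℝ) (e : Fin m → V) (a : Forms W) :
    pullForms L (chatVol g (fun i => L (e i)) a) =
      chatVol (g.bilinearComp L L) e (pullForms L a) := by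
  rw [chatVol_eq, chatVol_eq]
  induction List.finRange m generalizing a with
  | nil => simp
  | cons i l ih =>
    simp only [List.map_cons, List.prod_cons, Module.End.mul_apply]
    rw [pullForms_chat, ih]

theorem innerForms_pullForms (L : V →L[ℝ] W) (e : Fin m → V) (a b : Forms W) :
    innerForms (fun i => L (e i)) a b = innerForms e (pullForms L a) (pullForms L b) := rfl

theorem wedge_compContinuousLinearMap (L : V →L[ℝ] W) {k l d : ℕ} (h : k + l = d)
    (a : W [⋀^Fin k]→L[ℝ] ℝ) (b : W [⋀^Fin l]→L[ℝ] ℝ) :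
    (wedge h a b).compContinuousLinearMap L =
      wedge h (a.compContinuousLinearMap L) (b.compContinuousLinearMap L) := by
  have hk : ((k.factorial : ℝ) * l.factorial) ≠ 0 := by positivity
  ext v
  apply mul_left_cancel₀ hk
  rw [ContinuousAlternatingMap.compContinuousLinearMap_apply, factorial_mul_wedge_apply,
    factorial_mul_wedge_apply]
  rfl

theorem pullForms_psiMul (L : V →L[ℝ] W) (w : W [⋀^Fin 2]→L[ℝ] ℝ) (a : Forms W) :
    pullForms L (psiMul w a) = psiMul (w.compContinuousLinearMap L) (pullForms L a) := by
  funext k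
  rw [pullForms_apply]
  rcases k with _ | _ | _ | _ | k
  · rfl
  · rfl
  · rfl
  · rfl
  · simp only [psiMul]
    rw [wedge_compContinuousLinearMap, psi, psi, wedge_compContinuousLinearMap]
    rfl

theorem wedgePow_compContinuousLinearMap (L : V →L[ℝ] W) (w : W [⋀^Fin 2]→L[ℝ] ℝ) (N : ℕ) :
    (wedgePow w N).compContinuousLinearMap L = wedgePow (w.compContinuousLinearMap L) N := by
  induction N with
  | zero => rfl
  | succ N ih =>
    rw [wedgePow, wedgePow, wedge_compContinuousLinearMap, ih]

theorem metric_pull (L : V →L[ℝ] W) (w : W [⋀^Fin 2]→L[ℝ] ℝ) (J : W →L[ℝ] W) (J' : V →L[ℝ] V)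
    (hJ : ∀ v, L (J' v) = J (L v)) :
    metric (w.compContinuousLinearMap L) J' = (metric w J).bilinearComp L L := by
  ext u v
  rw [metric_apply, ContinuousLinearMap.bilinearComp_apply, metric_apply,
    ContinuousAlternatingMap.compContinuousLinearMap_apply]
  congr 1
  funext i
  fin_cases i <;> simp [hJ]

theorem isOrientedFrame_pull {n : ℕ} (L : V →L[ℝ] W) (w : W [⋀^Fin 2]→L[ℝ] ℝ) (J : W →L[ℝ] W)
    (J' : V →L[ℝ] V) (hJ : ∀ v, L (J' v) = J (L v)) (e : Fin (4 * n + 2) → V)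
    (he : IsOrientedFrame w J fun i => L (e i)) :
    IsOrientedFrame (w.compContinuousLinearMap L) J' e := by
  refine ⟨fun i j => ?_, ?_⟩
  · rw [metric_pull L w J J' hJ]
    exact he.1 i j
  · rw [← wedgePow_compContinuousLinearMap]
    exact he.2

end Pullback

/-! ### Smooth families of forms on a vector space -/

section SmoothFamilies

variable {X V W : Type*} [NormedAddCommGroup X] [NormedSpace ℝ X] [NormedAddCommGroup V]
  [NormedSpace ℝ V] [NormedAddCommGroup W] [NormedSpace ℝ W] {m : ℕ} {x : X} {r : WithTop ℕ∞}

theorem contDiffAt_curryLeft {k : ℕ} {A : X → V [⋀^Fin (k + 1)]→L[ℝ] ℝ} (hA : ContDiffAt ℝ r A x) :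
    ContDiffAt ℝ r (fun y => (A y).curryLeft) x := by
  have h : ContDiff ℝ r fun a : V [⋀^Fin (k + 1)]→L[ℝ] ℝ => a.curryLeft :=
    LinearIsometry.contDiff (𝕜 := ℝ) (E := V [⋀^Fin (k + 1)]→L[ℝ] ℝ)
      (F := V →L[ℝ] V [⋀^Fin k]→L[ℝ] ℝ)
      (ContinuousAlternatingMap.curryLeftLI (𝕜 := ℝ) (E := V) (F := ℝ) (n := k))
  exact ContDiffAt.comp (g := fun a : V [⋀^Fin (k + 1)]→L[ℝ] ℝ => a.curryLeft) x h.contDiffAt hA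

theorem contDiffAt_form_apply {k : ℕ} {A : X → V [⋀^Fin k]→L[ℝ] ℝ} (hA : ContDiffAt ℝ r A x)
    {u : X → Fin k → V} (hu : ∀ i, ContDiffAt ℝ r (fun y => u y i) x) :
    ContDiffAt ℝ r (fun y => A y (u y)) x := by
  induction k with
  | zero =>
    have : (fun y => A y (u y)) = fun y => A y ![] := by
      funext y
      congr 1
      exact Subsingleton.elim _ _
    rw [this]
    exact (ContinuousAlternatingMap.apply ℝ V ℝ ![]).contDiff.contDiffAt.comp x hA
  | succ k ih =>
    have h1 := (contDiffAt_curryLeft hA).clm_apply (hu 0)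
    have h2 := ih h1 (u := fun y => Fin.tail (u y)) fun i => hu i.succ
    convert h2 using 2 with y
    rw [ContinuousAlternatingMap.curryLeft_apply_apply]
    congr 1
    exact (Fin.cons_self_tail _).symm

theorem contDiffAt_form_apply_const {k : ℕ} {A : X → V [⋀^Fin k]→L[ℝ] ℝ}
    (hA : ContDiffAt ℝ r A x) (u : Fin k → V) : ContDiffAt ℝ r (fun y => A y u) x :=
  contDiffAt_form_apply hA fun _ => contDiffAt_const

theorem contDiffAt_covectorMul {k : ℕ} {θ : X → V →L[ℝ] ℝ} {A : X → V [⋀^Fin k]→L[ℝ] ℝ}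
    (hθ : ContDiffAt ℝ r θ x) (hA : ContDiffAt ℝ r A x) :
    ContDiffAt ℝ r (fun y => covectorMul (θ y) (A y)) x := by
  have h := ContinuousLinearMap.contDiff (𝕜 := ℝ) (n := r) (E := V →L[ℝ] V [⋀^Fin k]→L[ℝ] ℝ)
    (F := V [⋀^Fin (k + 1)]→L[ℝ] ℝ) (ContinuousAlternatingMap.alternatizeUncurryFinCLM ℝ V ℝ)
  exact ContDiffAt.comp
    (g := fun a => ContinuousAlternatingMap.alternatizeUncurryFinCLM (n := k) ℝ V ℝ a)
    x h.contDiffAt (hθ.smulRight hA)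

variable [FiniteDimensional ℝ V]

/-- Euler's identity rebuilds a form from its contractions with a basis, so smoothness can be tested
one degree lower. -/
theorem contDiffAt_form_succ (f : Module.Basis (Fin m) ℝ V) {k : ℕ}
    {A : X → V [⋀^Fin (k + 1)]→L[ℝ] ℝ}
    (hA : ∀ i, ContDiffAt ℝ r (fun y => (A y).curryLeft (f i)) x) : ContDiffAt ℝ r A x := by
  have : A = fun y => ((k : ℝ) + 1)⁻¹ • ∑ i, covectorMul (coframe f i) ((A y).curryLeft (f i)) :=
    funext fun y => form_eq_sum f (A y)
  rw [this]
  exact (ContDiffAt.sum fun i _ => contDiffAt_covectorMul contDiffAt_const (hA i)).const_smul _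

omit [FiniteDimensional ℝ V] in
theorem contDiffAt_form_zero {A : X → V [⋀^Fin 0]→L[ℝ] ℝ}
    (hA : ContDiffAt ℝ r (fun y => A y ![]) x) : ContDiffAt ℝ r A x := by
  have h : A = fun y => ContinuousAlternatingMap.constOfIsEmptyLIE ℝ V ℝ (Fin 0) (A y ![]) := by
    funext y
    ext v
    rw [Subsingleton.elim v ![]]
    rfl
  rw [h]
  exact (ContinuousAlternatingMap.constOfIsEmptyLIE ℝ V ℝ
    (Fin 0)).toContinuousLinearEquiv.contDiff.contDiffAt.comp x hA

theorem contDiffAt_form_of_apply (f : Module.Basis (Fin m) ℝ V) {k : ℕ}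
    {A : X → V [⋀^Fin k]→L[ℝ] ℝ} (hA : ∀ v : Fin k → V, ContDiffAt ℝ r (fun y => A y v) x) :
    ContDiffAt ℝ r A x := by
  induction k with
  | zero => exact contDiffAt_form_zero (hA _)
  | succ k ih => exact contDiffAt_form_succ f fun i => ih fun v => hA (Matrix.vecCons (f i) v)

theorem contDiffAt_compContinuousLinearMap (f : Module.Basis (Fin m) ℝ V) {k : ℕ}
    {A : X → W [⋀^Fin k]→L[ℝ] ℝ} {L : X → V →L[ℝ] W} (hA : ContDiffAt ℝ r A x)
    (hL : ContDiffAt ℝ r L x) :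
    ContDiffAt ℝ r (fun y => (A y).compContinuousLinearMap (L y)) x :=
  contDiffAt_form_of_apply f fun _ => contDiffAt_form_apply hA fun _ =>
    hL.clm_apply contDiffAt_const

theorem contDiffAt_wedge (f : Module.Basis (Fin m) ℝ V) {k l d : ℕ} (h : k + l = d)
    {A : X → V [⋀^Fin k]→L[ℝ] ℝ} {B : X → V [⋀^Fin l]→L[ℝ] ℝ} (hA : ContDiffAt ℝ r A x)
    (hB : ContDiffAt ℝ r B x) : ContDiffAt ℝ r (fun y => wedge h (A y) (B y)) x := by
  refine contDiffAt_form_of_apply f fun v => ?_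
  have hk : ((k.factorial : ℝ) * l.factorial) ≠ 0 := by positivity
  have : (fun y => wedge h (A y) (B y) v) = fun y => ((k.factorial : ℝ) * l.factorial)⁻¹ *
      ∑ σ : Equiv.Perm (Fin d), (Equiv.Perm.sign σ : ℝ) *
        (A y (fun i => (v ∘ σ) (Fin.cast h (Fin.castAdd l i))) *
          B y (fun i => (v ∘ σ) (Fin.cast h (Fin.natAdd k i)))) := by
    funext y
    rw [← factorial_mul_wedge_apply, inv_mul_cancel_left₀ hk]
  rw [this]
  exact contDiffAt_const.mul (ContDiffAt.sum fun σ _ => contDiffAt_const.mul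
    ((contDiffAt_form_apply_const hA _).mul
      (contDiffAt_form_apply_const hB _)))

theorem contDiffAt_wedgePow (f : Module.Basis (Fin m) ℝ V) {w : X → V [⋀^Fin 2]→L[ℝ] ℝ}
    (hw : ContDiffAt ℝ r w x) (N : ℕ) : ContDiffAt ℝ r (fun y => wedgePow (w y) N) x := by
  induction N with
  | zero => exact contDiffAt_const
  | succ N ih => exact contDiffAt_wedge f _ hw ih

theorem contDiffAt_psiMul (f : Module.Basis (Fin m) ℝ V) {w : X → V [⋀^Fin 2]→L[ℝ] ℝ}
    (hw : ContDiffAt ℝ r w x) {A : X → Forms V} (hA : ∀ k, ContDiffAt ℝ r (fun y => A y k) x)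
    (k : ℕ) : ContDiffAt ℝ r (fun y => psiMul (w y) (A y) k) x := by
  rcases k with _ | _ | _ | _ | k
  · exact contDiffAt_const
  · exact contDiffAt_const
  · exact contDiffAt_const
  · exact contDiffAt_const
  · exact contDiffAt_wedge f _ (contDiffAt_wedge f _ hw hw) (hA k)

theorem contDiffAt_bilin (f : Module.Basis (Fin m) ℝ V) {g : X → V →L[ℝ] V →L[ℝ] ℝ}
    (hg : ∀ u v, ContDiffAt ℝ r (fun y => g y u v) x) : ContDiffAt ℝ r g x := by
  have h1 : ∀ u, ContDiffAt ℝ r (fun y => g y u) x := by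
    intro u
    have : (fun y => g y u) = fun y => ∑ i, g y u (f i) • coframe f i :=
      funext fun y => covector_eq_sum f (g y u)
    rw [this]
    exact ContDiffAt.sum fun i _ => (hg u (f i)).smul contDiffAt_const
  have : g = fun y => ∑ i, (coframe f i).smulRight (g y (f i)) := by
    funext y
    ext v : 1
    conv_lhs => rw [← sum_coframe_smul f v]
    simp
  rw [this]
  exact ContDiffAt.sum fun i _ => contDiffAt_const.smulRight (h1 (f i))

omit [FiniteDimensional ℝ V] in
theorem contDiffAt_extMul {θ : X → V →L[ℝ] ℝ} {A : X → Forms V} (hθ : ContDiffAt ℝ r θ x)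
    (hA : ∀ k, ContDiffAt ℝ r (fun y => A y k) x) (k : ℕ) :
    ContDiffAt ℝ r (fun y => extMul (θ y) (A y) k) x := by
  rcases k with _ | k
  · exact contDiffAt_const
  · exact contDiffAt_covectorMul hθ (hA k)

/-- Smoothness of `ĉ(dvol)` applied to a smooth family of forms. No smoothness of the frame is
needed beyond that of its determinant. -/
theorem contDiffAt_chatVol (hm : Even m) (f : Module.Basis (Fin m) ℝ V)
    {g : X → V →L[ℝ] V →L[ℝ] ℝ} {e : X → Fin m → V} (hg : ContDiffAt ℝ r g x)
    (he : ∀ᶠ y in nhds x, ∀ i j, g y (e y i) (e y j) = if i = j then 1 else 0)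
    (hdet : ContDiffAt ℝ r (fun y => f.det (e y)) x)
    {A : X → Forms V} (hA : ∀ k, ContDiffAt ℝ r (fun y => A y k) x) (k : ℕ) :
    ContDiffAt ℝ r (fun y => chatVol (g y) (e y) (A y) k) x := by
  induction k generalizing A with
  | zero =>
    refine contDiffAt_form_zero ?_
    -- In degree 0 the frame is visible only through its determinant.
    have : (fun y => chatVol (g y) (e y) (A y) 0 ![]) =ᶠ[nhds x]
        fun y => reverseSign m * (f.det (e y) * A y m f) := by
      filter_upwards [he] with y hy
      rw [chatVol_apply_zero hy, form_apply_basis_eq_det_mul f]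
    refine ContDiffAt.congr_of_eventuallyEq ?_ this
    exact contDiffAt_const.mul (hdet.mul (contDiffAt_form_apply (hA m) fun _ => contDiffAt_const))
  | succ k ih =>
    refine contDiffAt_form_succ f fun i => ?_
    -- Contracting ĉ(dvol) A with f i gives -ĉ(dvol)(g(f i, ·) ∧ A) by `intMul_chatVol`: one degree
    -- lower, for another smooth family. This is why the induction generalises A.
    have h1 := ih (A := fun y => extMul (g y (f i)) (A y))
      (contDiffAt_extMul (hg.clm_apply contDiffAt_const) hA)
    refine ContDiffAt.congr_of_eventuallyEq h1.neg ?_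
    filter_upwards [he] with y hy
    have hb : ⇑(frameBasis hy f) = e y := coe_frameBasis hy f
    have h2 := intMul_chatVol (g := g y) (e := frameBasis hy f) hm
      (by rw [hb]; exact hy) (f i) (A y)
    rw [hb] at h2
    exact congrFun h2 k

end SmoothFamilies

/-! ### Forms in the charts of a manifold -/

section Charts

variable {n : ℕ} {M : Type*} [TopologicalSpace M] [ChartedSpace (E n) M]

/-- The preferred extended chart at `x₀`. -/
abbrev phi (x₀ : M) : PartialEquiv M (E n) := extChartAt (𝓡 (4 * n + 2)) x₀

/-- The derivative of the inverse of the chart at `x₀`. -/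
def chartD (x₀ : M) (y : E n) : E n →L[ℝ] E n :=
  mfderiv 𝓘(ℝ, E n) (𝓡 (4 * n + 2)) (extChartAt (𝓡 (4 * n + 2)) x₀).symm y

/-- The derivative of the chart at `x₀`. -/
def chartT (x₀ p : M) : E n →L[ℝ] E n :=
  mfderiv (𝓡 (4 * n + 2)) 𝓘(ℝ, E n) (extChartAt (𝓡 (4 * n + 2)) x₀) p

/-- The transition map from the chart at `x₀` to the chart at `x₁`. -/
def transition (x₀ x₁ : M) (y : E n) : E n := phi x₁ ((phi x₀).symm y)

/-- The value of a form at a point, as a form on the model space. -/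
def valueAt {k : ℕ} (a : RoughForm n M k) (p : M) : E n [⋀^Fin k]→L[ℝ] ℝ := a p

theorem chartForm_eq {k : ℕ} (a : RoughForm n M k) (x₀ : M) (y : E n) :
    chartForm a x₀ y =
      (valueAt a ((phi x₀).symm y)).compContinuousLinearMap (chartD x₀ y) := rfl

theorem isOpen_target (x₀ : M) : IsOpen (phi (n := n) x₀).target := isOpen_extChartAt_target x₀

theorem isOpen_source (x₀ : M) : IsOpen (phi (n := n) x₀).source := isOpen_extChartAt_source x₀

theorem transition_mem {x₀ x₁ : M} {y : E n}
    (hy1 : (phi x₀).symm y ∈ (phi (n := n) x₁).source) : transition x₀ x₁ y ∈ (phi x₁).target :=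
  (phi x₁).map_source hy1

theorem symm_transition {x₀ x₁ : M} {y : E n}
    (hy1 : (phi x₀).symm y ∈ (phi (n := n) x₁).source) :
    (phi x₁).symm (transition x₀ x₁ y) = (phi x₀).symm y :=
  (phi x₁).left_inv hy1

variable [IsManifold (𝓡 (4 * n + 2)) ∞ M]

theorem isManifold_one : IsManifold (𝓡 (4 * n + 2)) 1 M :=
  IsManifold.of_le (n := ∞) (by norm_cast)

theorem chartT_comp_chartD {x₀ : M} {y : E n} (hy : y ∈ (phi x₀).target) (v : E n) :
    chartT x₀ ((phi x₀).symm y) (chartD x₀ y v) = v := by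
  have : IsManifold (𝓡 (4 * n + 2)) 1 M := isManifold_one
  have h := mfderiv_extChartAt_comp_mfderivWithin_extChartAt_symm (I := 𝓡 (4 * n + 2)) hy
  have h2 : Set.range (𝓡 (4 * n + 2)) = Set.univ := ModelWithCorners.range_eq_univ _
  rw [h2, mfderivWithin_univ] at h
  exact DFunLike.congr_fun h v

theorem chartD_comp_chartT {x₀ p : M} (hp : p ∈ (phi (n := n) x₀).source) (v : E n) :
    chartD x₀ (phi x₀ p) (chartT x₀ p v) = v := by
  have : IsManifold (𝓡 (4 * n + 2)) 1 M := isManifold_one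
  have h := mfderivWithin_extChartAt_symm_comp_mfderiv_extChartAt' (I := 𝓡 (4 * n + 2)) hp
  have h2 : Set.range (𝓡 (4 * n + 2)) = Set.univ := ModelWithCorners.range_eq_univ _
  rw [h2, mfderivWithin_univ] at h
  exact DFunLike.congr_fun h v

theorem chartD_comp_chartT_symm {x₀ : M} {y : E n} (hy : y ∈ (phi x₀).target) (v : E n) :
    chartD x₀ y (chartT x₀ ((phi x₀).symm y) v) = v := by
  have := chartD_comp_chartT (n := n) ((phi x₀).map_target hy) v
  rwa [(phi x₀).right_inv hy] at this

theorem symmL_eq_chartD {x₀ x : M} (hx : x ∈ (phi (n := n) x₀).source) :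
    have : IsManifold (𝓡 (4 * n + 2)) 1 M := isManifold_one
    (trivializationAt (E n) (TangentSpace (𝓡 (4 * n + 2))) x₀).symmL ℝ x =
      chartD x₀ (phi x₀ x) := by
  have : IsManifold (𝓡 (4 * n + 2)) 1 M := isManifold_one
  have h2 : Set.range (𝓡 (4 * n + 2)) = Set.univ := ModelWithCorners.range_eq_univ _
  have h := TangentBundle.symmL_trivializationAt (I := 𝓡 (4 * n + 2)) (x₀ := x₀) (x := x)
    (by rwa [← extChartAt_source (𝓡 (4 * n + 2))])
  rw [h2, mfderivWithin_univ] at h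
  exact h

theorem continuousLinearMapAt_eq_chartT {x₀ x : M} (hx : x ∈ (phi (n := n) x₀).source) :
    have : IsManifold (𝓡 (4 * n + 2)) 1 M := isManifold_one
    (trivializationAt (E n) (TangentSpace (𝓡 (4 * n + 2))) x₀).continuousLinearMapAt ℝ x =
      chartT x₀ x := by
  have : IsManifold (𝓡 (4 * n + 2)) 1 M := isManifold_one
  exact TangentBundle.continuousLinearMapAt_trivializationAt (I := 𝓡 (4 * n + 2)) (x₀ := x₀)
    (x := x) (by rwa [← extChartAt_source (𝓡 (4 * n + 2))])

theorem contMDiffAt_phi_symm {x₀ : M} {y : E n} (hy : y ∈ (phi x₀).target) :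
    ContMDiffAt 𝓘(ℝ, E n) (𝓡 (4 * n + 2)) ∞ (phi x₀).symm y :=
  (contMDiffOn_extChartAt_symm (I := 𝓡 (4 * n + 2)) x₀).contMDiffAt
    ((isOpen_target x₀).mem_nhds hy)

theorem contMDiffAt_phi {x₀ p : M} (hp : p ∈ (phi (n := n) x₀).source) :
    ContMDiffAt (𝓡 (4 * n + 2)) 𝓘(ℝ, E n) ∞ (phi (n := n) x₀) p :=
  contMDiffAt_extChartAt' (by rwa [← extChartAt_source (𝓡 (4 * n + 2))])

theorem contDiffAt_transition {x₀ x₁ : M} {y : E n} (hy : y ∈ (phi x₀).target)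
    (hy1 : (phi x₀).symm y ∈ (phi (n := n) x₁).source) :
    ContDiffAt ℝ ∞ (transition x₀ x₁) y := by
  have h := (contMDiffAt_phi hy1).comp y (contMDiffAt_phi_symm hy)
  exact h.contDiffAt

theorem eventually_mem_overlap {x₀ x₁ : M} {y : E n} (hy : y ∈ (phi x₀).target)
    (hy1 : (phi x₀).symm y ∈ (phi (n := n) x₁).source) :
    ∀ᶠ z in nhds y, z ∈ (phi x₀).target ∧ (phi x₀).symm z ∈ (phi (n := n) x₁).source :=
  Filter.Eventually.and ((isOpen_target x₀).mem_nhds hy)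
    ((contMDiffAt_phi_symm hy).continuousAt.eventually ((isOpen_source x₁).mem_nhds hy1))

theorem chartD_eq_comp_fderiv {x₀ x₁ : M} {y : E n} (hy : y ∈ (phi x₀).target)
    (hy1 : (phi x₀).symm y ∈ (phi (n := n) x₁).source) :
    chartD x₀ y = (chartD x₁ (transition x₀ x₁ y)).comp (fderiv ℝ (transition x₀ x₁) y) := by
  have h1 : (phi (n := n) x₀).symm =ᶠ[nhds y] (phi x₁).symm ∘ transition x₀ x₁ := by
    filter_upwards [eventually_mem_overlap hy hy1] with z hz
    exact (symm_transition hz.2).symm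
  have h2 := mfderiv_comp (I := 𝓘(ℝ, E n)) (I' := 𝓘(ℝ, E n)) (I'' := 𝓡 (4 * n + 2)) y
    ((contMDiffAt_phi_symm (transition_mem hy1)).mdifferentiableAt (by simp))
    ((contDiffAt_transition hy hy1).contMDiffAt.mdifferentiableAt (by simp))
  have h3 := h1.mfderiv_eq (I := 𝓘(ℝ, E n)) (I' := 𝓡 (4 * n + 2))
  rw [mfderiv_eq_fderiv] at h2
  exact h3.trans h2

theorem chartForm_eq_transition {k : ℕ} (a : RoughForm n M k) {x₀ x₁ : M} {y : E n}
    (hy : y ∈ (phi x₀).target) (hy1 : (phi x₀).symm y ∈ (phi (n := n) x₁).source) :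
    chartForm a x₀ y = (chartForm a x₁ (transition x₀ x₁ y)).compContinuousLinearMap
      (fderiv ℝ (transition x₀ x₁) y) := by
  rw [chartForm_eq, chartForm_eq, chartD_eq_comp_fderiv hy hy1, symm_transition hy1]
  rfl

end Charts

/-! ### Smoothness of forms and of the metric, read in charts -/

section Charts

variable {n : ℕ} {M : Type*} [TopologicalSpace M] [ChartedSpace (E n) M]

/-- The standard basis of the model space. -/
def stdBasis (n : ℕ) : Module.Basis (Fin (4 * n + 2)) ℝ (E n) :=
  (EuclideanSpace.basisFun (Fin (4 * n + 2)) ℝ).toBasis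

theorem stdBasis_apply (i : Fin (4 * n + 2)) : stdBasis n i = EuclideanSpace.single i 1 := by
  simp [stdBasis]

/-- The value of a family of endomorphisms at a point, on the model space. -/
def endAt (J : RoughEnd n M) (p : M) : E n →L[ℝ] E n := J p

/-- A family of endomorphisms in the chart at `x₀`. -/
def chartEnd (J : RoughEnd n M) (x₀ : M) (y : E n) : E n →L[ℝ] E n :=
  (chartT x₀ ((phi x₀).symm y)).comp ((endAt J ((phi x₀).symm y)).comp (chartD x₀ y))

/-- The metric `ω(·, J ·)` in the chart at `x₀`. -/
def chartMetric (w : RoughForm n M 2) (J : RoughEnd n M) (x₀ : M) (y : E n) :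
    E n →L[ℝ] E n →L[ℝ] ℝ :=
  (metric (valueAt w ((phi x₀).symm y)) (endAt J ((phi x₀).symm y))).bilinearComp
    (chartD x₀ y) (chartD x₀ y)

theorem chartMetric_apply (w : RoughForm n M 2) (J : RoughEnd n M) (x₀ : M) (y u v : E n) :
    chartMetric w J x₀ y u v = metric (valueAt w ((phi x₀).symm y)) (endAt J ((phi x₀).symm y))
      (chartD x₀ y u) (chartD x₀ y v) := rfl

variable [IsManifold (𝓡 (4 * n + 2)) ∞ M]

theorem contDiffAt_fderiv_transition {x₀ x₁ : M} {y : E n} (hy : y ∈ (phi x₀).target)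
    (hy1 : (phi x₀).symm y ∈ (phi (n := n) x₁).source) :
    ContDiffAt ℝ ∞ (fderiv ℝ (transition x₀ x₁)) y :=
  (contDiffAt_transition hy hy1).fderiv_right (m := ∞) (by simp)

/-- Smoothness of a section at a point is read in the trivialization at that point, so it controls a
chart only at its center. The transition map carries it to the other points of the chart. -/
theorem contDiffAt_chartForm_of_center {k : ℕ} {a : RoughForm n M k}
    (h : ∀ x₀, ContDiffAt ℝ ∞ (chartForm a x₀) (phi x₀ x₀)) {x₀ : M} {y : E n}
    (hy : y ∈ (phi x₀).target) : ContDiffAt ℝ ∞ (chartForm a x₀) y := by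
  set x₁ := (phi x₀).symm y with hx₁
  have hy1 : (phi x₀).symm y ∈ (phi (n := n) x₁).source := mem_extChartAt_source _
  have h1 : chartForm a x₀ =ᶠ[nhds y] fun z =>
      (chartForm a x₁ (transition x₀ x₁ z)).compContinuousLinearMap
        (fderiv ℝ (transition x₀ x₁) z) := by
    filter_upwards [eventually_mem_overlap hy hy1] with z hz
    exact chartForm_eq_transition a hz.1 hz.2
  refine ContDiffAt.congr_of_eventuallyEq ?_ h1
  refine contDiffAt_compContinuousLinearMap (stdBasis n) ?_ (contDiffAt_fderiv_transition hy hy1)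
  exact ContDiffAt.comp (g := chartForm a x₁) y (h x₁) (contDiffAt_transition hy hy1)

theorem contMDiffAt_comp_phi_iff {F : Type*} [NormedAddCommGroup F] [NormedSpace ℝ F] {x₀ p : M}
    (hp : p ∈ (phi (n := n) x₀).source) (f : E n → F) :
    ContMDiffAt (𝓡 (4 * n + 2)) 𝓘(ℝ, F) ∞ (fun x => f (phi x₀ x)) p ↔
      ContDiffAt ℝ ∞ f (phi x₀ p) := by
  constructor
  · intro h
    have h2 : (phi x₀).symm (phi x₀ p) = p := (phi x₀).left_inv hp
    have ht : phi x₀ p ∈ (phi (n := n) x₀).target := (phi x₀).map_source hp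
    have h1 := ContMDiffAt.comp_of_eq (x := phi x₀ p) h (contMDiffAt_phi_symm ht) h2
    have h3 := h1.contDiffAt
    refine h3.congr_of_eventuallyEq ?_
    filter_upwards [(isOpen_target x₀).mem_nhds ht] with z hz
    simp only [Function.comp_apply]
    rw [(phi x₀).right_inv hz]
  · intro h
    exact h.contMDiffAt.comp p (contMDiffAt_phi hp)

/-- Near x₀ the inverse of the tangent trivialization is the derivative of the inverse chart, so the
section in coordinates is `chartForm a x₀` composed with the chart. -/
theorem contMDiffAt_form_iff {k : ℕ} (a : RoughForm n M k) (x₀ : M) :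
    ContMDiffAt (𝓡 (4 * n + 2)) ((𝓡 (4 * n + 2)).prod 𝓘(ℝ, E n [⋀^Fin k]→L[ℝ] ℝ)) ∞
    (fun x => Bundle.TotalSpace.mk' (E n [⋀^Fin k]→L[ℝ] ℝ)
      (E := fun x : M => TangentSpace (𝓡 (4 * n + 2)) x [⋀^Fin k]→L[ℝ] Bundle.Trivial M ℝ x)
      x (a x)) x₀ ↔ ContDiffAt ℝ ∞ (chartForm a x₀) (phi x₀ x₀) := by
  rw [Bundle.contMDiffAt_section, ← contMDiffAt_comp_phi_iff (mem_extChartAt_source x₀)]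
  refine Filter.EventuallyEq.contMDiffAt_iff ?_
  filter_upwards [(isOpen_source x₀).mem_nhds (mem_extChartAt_source (I := 𝓡 (4 * n + 2)) x₀)]
    with x hx
  have hs := symmL_eq_chartD hx
  have hx2 : (phi x₀).symm (phi x₀ x) = x := (phi x₀).left_inv hx
  rw [FiberBundle.trivializationAt_continuousAlternatingMap_apply, chartForm_eq, hx2, ← hs]
  ext v
  simp [ContinuousAlternatingMap.inCoordinates]
  rfl

theorem isSmoothForm_iff {k : ℕ} (a : RoughForm n M k) :
    IsSmoothForm a ↔ ∀ x₀, ∀ y ∈ (phi (n := n) x₀).target, ContDiffAt ℝ ∞ (chartForm a x₀) y := by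
  constructor
  · intro h x₀ y hy
    exact contDiffAt_chartForm_of_center (fun x => (contMDiffAt_form_iff a x).1 (h x)) hy
  · intro h x
    exact (contMDiffAt_form_iff a x).2 (h x _ (mem_extChartAt_target x))

theorem contDiffAt_chartEnd_center {J : RoughEnd n M} (hJ : IsSmoothEnd J) (x₀ : M) :
    ContDiffAt ℝ ∞ (chartEnd J x₀) (phi x₀ x₀) := by
  rw [← contMDiffAt_comp_phi_iff (mem_extChartAt_source x₀)]
  have h := ((contMDiffAt_hom_bundle _).1 (hJ x₀)).2
  refine h.congr_of_eventuallyEq ?_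
  filter_upwards [(isOpen_source x₀).mem_nhds (mem_extChartAt_source (I := 𝓡 (4 * n + 2)) x₀)]
    with x hx
  have hs := symmL_eq_chartD hx
  have ht := continuousLinearMapAt_eq_chartT hx
  have hx2 : (phi x₀).symm (phi x₀ x) = x := (phi x₀).left_inv hx
  rw [chartEnd, hx2, ← hs, ← ht]
  rfl

theorem chartMetric_eq_metric (w : RoughForm n M 2) (J : RoughEnd n M) {x₀ : M} {y : E n}
    (hy : y ∈ (phi x₀).target) :
    chartMetric w J x₀ y = metric (chartForm w x₀ y) (chartEnd J x₀ y) := by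
  rw [chartForm_eq]
  refine (metric_pull _ _ _ _ fun v => ?_).symm
  exact chartD_comp_chartT_symm hy _

theorem chartMetric_eq_transition (w : RoughForm n M 2) (J : RoughEnd n M) {x₀ x₁ : M} {y : E n}
    (hy : y ∈ (phi x₀).target) (hy1 : (phi x₀).symm y ∈ (phi (n := n) x₁).source) (u v : E n) :
    chartMetric w J x₀ y u v = chartMetric w J x₁ (transition x₀ x₁ y)
      (fderiv ℝ (transition x₀ x₁) y u) (fderiv ℝ (transition x₀ x₁) y v) := by
  rw [chartMetric_apply, chartMetric_apply, chartD_eq_comp_fderiv hy hy1, symm_transition hy1]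
  rfl

theorem contDiffAt_chartMetric {w : RoughForm n M 2} {J : RoughEnd n M} (hw : IsSmoothForm w)
    (hJ : IsSmoothEnd J) {x₀ : M} {y : E n} (hy : y ∈ (phi x₀).target) :
    ContDiffAt ℝ ∞ (chartMetric w J x₀) y := by
  have hc : ∀ x₀, ContDiffAt ℝ ∞ (chartMetric w J x₀) (phi x₀ x₀) := by
    intro x₀
    have h0 := mem_extChartAt_target (I := 𝓡 (4 * n + 2)) x₀
    have h1 : chartMetric w J x₀ =ᶠ[nhds (phi x₀ x₀)] fun y =>
        metric (chartForm w x₀ y) (chartEnd J x₀ y) := by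
      filter_upwards [(isOpen_target x₀).mem_nhds h0] with z hz
      exact chartMetric_eq_metric w J hz
    refine ContDiffAt.congr_of_eventuallyEq ?_ h1
    refine contDiffAt_bilin (stdBasis n) fun u v => ?_
    simp only [metric_apply]
    refine contDiffAt_form_apply ((isSmoothForm_iff w).1 hw x₀ _ h0) fun i => ?_
    fin_cases i
    · exact contDiffAt_const
    · exact (contDiffAt_chartEnd_center hJ x₀).clm_apply contDiffAt_const
  -- Smoothness of `chartEnd` is available only at centers of charts, so the metric is moved to the
  -- chart centered at the point in question.
  set x₁ := (phi x₀).symm y with hx₁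
  have hy1 : (phi x₀).symm y ∈ (phi (n := n) x₁).source := mem_extChartAt_source _
  refine contDiffAt_bilin (stdBasis n) fun u v => ?_
  have h1 : (fun z => chartMetric w J x₀ z u v) =ᶠ[nhds y] fun z =>
      chartMetric w J x₁ (transition x₀ x₁ z)
      (fderiv ℝ (transition x₀ x₁) z u) (fderiv ℝ (transition x₀ x₁) z v) := by
    filter_upwards [eventually_mem_overlap hy hy1] with z hz
    exact chartMetric_eq_transition w J hz.1 hz.2 u v
  refine ContDiffAt.congr_of_eventuallyEq ?_ h1
  have hf := contDiffAt_fderiv_transition hy hy1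
  have hg := ContDiffAt.comp (g := chartMetric w J x₁) y (hc x₁) (contDiffAt_transition hy hy1)
  exact (hg.clm_apply (hf.clm_apply contDiffAt_const)).clm_apply (hf.clm_apply contDiffAt_const)

end Charts

/-! ### The exterior derivative, ĉ(dvol) and the volume density in a chart -/

section Charts

variable {n : ℕ} {M : Type*} [TopologicalSpace M] [ChartedSpace (E n) M]

/-- The value of a family of inhomogeneous forms at a point, on the model space. -/
def formsAt (a : RoughForms n M) (p : M) : Forms (E n) := a p

/-- The expression of inhomogeneous forms in the chart at `x₀`. -/
def chartForms (a : RoughForms n M) (x₀ : M) (y : E n) : Forms (E n) :=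
  pullForms (chartD x₀ y) (formsAt a ((phi x₀).symm y))

theorem chartForms_psiForms (w : RoughForm n M 2) (a : RoughForms n M) (x₀ : M) (y : E n) :
    chartForms (psiForms w a) x₀ y = psiMul (chartForm w x₀ y) (chartForms a x₀ y) :=
  pullForms_psiMul _ _ _

/-- The chosen oriented orthonormal frame at a point, as a family of vectors of the model space. -/
def frameAt (w : RoughForm n M 2) (J : RoughEnd n M) (p : M) : Fin (4 * n + 2) → E n :=
  frame n (valueAt w p) (endAt J p)

/-- The chosen oriented orthonormal frame, in the chart at `x₀`. -/
def chartFrame (w : RoughForm n M 2) (J : RoughEnd n M) (x₀ : M) (y : E n)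
    (i : Fin (4 * n + 2)) : E n :=
  chartT x₀ ((phi x₀).symm y) (frameAt w J ((phi x₀).symm y) i)

theorem chartDensity_eq (w : RoughForm n M 2) (J : RoughEnd n M) (x₀ : M) (y : E n) :
    chartDensity w J x₀ y = Real.sqrt
      (Matrix.of fun i j => chartMetric w J x₀ y (stdBasis n i) (stdBasis n j)).det := by
  simp only [stdBasis_apply]
  rfl

variable [IsManifold (𝓡 (4 * n + 2)) ∞ M]

/-- `formDeriv` is computed at each point in the chart centered there. Naturality of the exterior
derivative under the transition map makes the result independent of the chart. -/
theorem chartForm_formDeriv {k : ℕ} {a : RoughForm n M k} (ha : IsSmoothForm a) {x₀ : M} {y : E n}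
    (hy : y ∈ (phi x₀).target) : chartForm (formDeriv a) x₀ y = extDeriv (chartForm a x₀) y := by
  obtain ⟨p, hp⟩ : ∃ p, p = (phi x₀).symm y := ⟨_, rfl⟩
  have hy1 : (phi x₀).symm y ∈ (phi (n := n) p).source := by
    rw [hp]; exact mem_extChartAt_source _
  have hτ : transition x₀ p y = phi p p := by rw [transition, ← hp]
  have h1 : chartForm a x₀ =ᶠ[nhds y] fun z =>
      (chartForm a p (transition x₀ p z)).compContinuousLinearMap
        (fderiv ℝ (transition x₀ p) z) := by
    filter_upwards [eventually_mem_overlap hy hy1] with z hz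
    exact chartForm_eq_transition a hz.1 hz.2
  have ht : transition x₀ p y ∈ (phi (n := n) p).target := transition_mem hy1
  rw [h1.extDeriv_eq, extDeriv_pullback (r := ∞)
    (((isSmoothForm_iff a).1 ha p _ ht).differentiableAt (by simp))
    (contDiffAt_transition hy hy1) (by simpa using WithTop.coe_le_coe.2 (le_top : (2 : ℕ∞) ≤ ⊤))]
  have h2 : chartForm (formDeriv a) x₀ y = ((extDeriv (chartForm a p)
      (phi p p)).compContinuousLinearMap (chartT p p)).compContinuousLinearMap (chartD x₀ y) := by
    rw [chartForm_eq, ← hp]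
    rfl
  rw [h2, hτ, chartD_eq_comp_fderiv hy hy1]
  ext v
  simp only [ContinuousAlternatingMap.compContinuousLinearMap_apply]
  congr 1
  funext i
  have h3 := chartT_comp_chartD ht (fderiv ℝ (transition x₀ p) y (v i))
  rw [symm_transition hy1, ← hp] at h3
  exact h3

theorem contDiffAt_extDeriv {k : ℕ} {A : E n → E n [⋀^Fin k]→L[ℝ] ℝ} {y : E n}
    (hA : ContDiffAt ℝ ∞ A y) : ContDiffAt ℝ ∞ (extDeriv A) y := by
  have h := ContinuousLinearMap.contDiff (𝕜 := ℝ) (n := ∞) (E := E n →L[ℝ] E n [⋀^Fin k]→L[ℝ] ℝ)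
    (F := E n [⋀^Fin (k + 1)]→L[ℝ] ℝ) (ContinuousAlternatingMap.alternatizeUncurryFinCLM ℝ (E n) ℝ)
  exact ContDiffAt.comp
    (g := fun a => ContinuousAlternatingMap.alternatizeUncurryFinCLM (n := k) ℝ (E n) ℝ a) y
    h.contDiffAt (hA.fderiv_right (m := ∞) (by simp))

theorem IsSmoothForm.formDeriv {k : ℕ} {a : RoughForm n M k} (ha : IsSmoothForm a) :
    IsSmoothForm (formDeriv a) := by
  rw [isSmoothForm_iff]
  intro x₀ y hy
  refine (contDiffAt_extDeriv ((isSmoothForm_iff a).1 ha x₀ y hy)).congr_of_eventuallyEq ?_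
  filter_upwards [(isOpen_target x₀).mem_nhds hy] with z hz
  exact chartForm_formDeriv ha hz

theorem mem_smoothForms_iff {a : RoughForms n M} :
    a ∈ smoothForms n M ↔ ∀ x₀, ∀ y ∈ (phi (n := n) x₀).target, ∀ k,
      ContDiffAt ℝ ∞ (fun z => chartForms a x₀ z k) y := by
  constructor
  · intro h x₀ y hy k
    exact (isSmoothForm_iff _).1 (h k) x₀ y hy
  · intro h k
    exact (isSmoothForm_iff _).2 fun x₀ y hy => h x₀ y hy k

theorem dForms_mem {a : RoughForms n M} (ha : a ∈ smoothForms n M) :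
    dForms a ∈ smoothForms n M := by
  intro k
  rcases k with _ | k
  · exact (smoothForms n M).zero_mem 0
  · exact (ha k).formDeriv

theorem psiForms_mem {w : RoughForm n M 2} (hw : IsSmoothForm w) {a : RoughForms n M}
    (ha : a ∈ smoothForms n M) : psiForms w a ∈ smoothForms n M := by
  rw [mem_smoothForms_iff] at ha ⊢
  intro x₀ y hy k
  simp only [chartForms_psiForms]
  exact contDiffAt_psiMul (stdBasis n) ((isSmoothForm_iff w).1 hw x₀ y hy) (ha x₀ y hy) k

theorem IsCompatible.pair {w : RoughForm n M 2} {J : RoughEnd n M} (hJ : IsCompatible w J) (p : M) :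
    IsCompatiblePair (valueAt w p) (endAt J p) :=
  ⟨hJ.sq p, hJ.invariant p, hJ.tame p⟩

theorem chartD_chartFrame (w : RoughForm n M 2) (J : RoughEnd n M) {x₀ : M} {y : E n}
    (hy : y ∈ (phi x₀).target) (i : Fin (4 * n + 2)) :
    chartD x₀ y (chartFrame w J x₀ y i) = frameAt w J ((phi x₀).symm y) i :=
  chartD_comp_chartT_symm hy _

variable {w : RoughForm n M 2} {J : RoughEnd n M}

theorem isOrientedFrame_frameAt (hJ : IsCompatible w J) (p : M) :
    IsOrientedFrame (valueAt w p) (endAt J p) (frameAt w J p) :=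
  isOrientedFrame_frame (stdBasis n) (hJ.pair p)

theorem isOrientedFrame_chartFrame (hJ : IsCompatible w J) {x₀ : M} {y : E n}
    (hy : y ∈ (phi x₀).target) :
    IsOrientedFrame (chartForm w x₀ y) (chartEnd J x₀ y) (chartFrame w J x₀ y) := by
  refine isOrientedFrame_pull (chartD x₀ y) _ (endAt J ((phi x₀).symm y)) _
    (fun v => chartD_comp_chartT_symm hy _) _ ?_
  simp only [chartD_chartFrame w J hy]
  exact isOrientedFrame_frameAt hJ _

theorem chartFrame_orthonormal (hJ : IsCompatible w J) {x₀ : M} {y : E n}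
    (hy : y ∈ (phi x₀).target) (i j : Fin (4 * n + 2)) :
    chartMetric w J x₀ y (chartFrame w J x₀ y i) (chartFrame w J x₀ y j) =
      if i = j then 1 else 0 := by
  rw [chartMetric_eq_metric w J hy]
  exact (isOrientedFrame_chartFrame hJ hy).1 i j

/-- The orientation of the chart at `x₀` relative to the symplectic orientation. -/
def chartSign (w : RoughForm n M 2) (x₀ : M) (y : E n) : ℝ :=
  orientationSign (chartForm w x₀ y) (stdBasis n)

theorem det_mul_chartDensity (hJ : IsCompatible w J) {x₀ : M} {y : E n}
    (hy : y ∈ (phi x₀).target) :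
    (stdBasis n).det (chartFrame w J x₀ y) * chartDensity w J x₀ y = chartSign w x₀ y := by
  have he := isOrientedFrame_chartFrame hJ hy
  have h := det_mul_sqrt_det_gram (frameBasis he.1 (stdBasis n)) (stdBasis n)
    (by rwa [coe_frameBasis])
  rw [coe_frameBasis, ← chartMetric_eq_metric w J hy, ← chartDensity_eq] at h
  exact h

theorem chartDensity_pos (hJ : IsCompatible w J) {x₀ : M} {y : E n}
    (hy : y ∈ (phi x₀).target) : 0 < chartDensity w J x₀ y := by
  rw [chartDensity_eq]
  have he := chartFrame_orthonormal hJ hy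
  exact Real.sqrt_pos.2 (det_gram_pos (frameBasis he (stdBasis n)) _ (by rwa [coe_frameBasis]))

theorem contDiffAt_chartDensity (hw : IsSmoothForm w) (hJ : IsCompatible w J) {x₀ : M} {y : E n}
    (hy : y ∈ (phi x₀).target) : ContDiffAt ℝ ∞ (chartDensity w J x₀) y := by
  have h := chartDensity_pos hJ hy
  have h1 : chartDensity w J x₀ = fun y => Real.sqrt
      (Matrix.of fun i j => chartMetric w J x₀ y (stdBasis n i) (stdBasis n j)).det :=
    funext fun y => chartDensity_eq w J x₀ y
  rw [chartDensity_eq, Real.sqrt_pos] at h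
  rw [h1]
  refine ContDiffAt.sqrt ?_ h.ne'
  simp only [Matrix.det_apply]
  refine ContDiffAt.sum fun σ _ => ContDiffAt.const_smul _ (contDiffAt_prod fun i _ => ?_)
  exact ((contDiffAt_chartMetric hw hJ.smooth hy).clm_apply contDiffAt_const).clm_apply
    contDiffAt_const

theorem topPower_ne_zero_of_frame (hJ : IsCompatible w J) {x₀ : M} {y : E n}
    (hy : y ∈ (phi x₀).target) : topPower (chartForm w x₀ y) (stdBasis n) ≠ 0 := by
  intro h
  have h1 := (isOrientedFrame_chartFrame hJ hy).2
  have h2 := topPower_eq_det_mul (stdBasis n) (chartForm w x₀ y) (chartFrame w J x₀ y)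
  rw [h, mul_zero] at h2
  exact h1.ne' h2

/-- The top power of ω on the coordinate basis is continuous and nowhere zero, so its sign is
locally constant. -/
theorem chartSign_eventuallyEq (hw : IsSmoothForm w) (hJ : IsCompatible w J) {x₀ : M} {y : E n}
    (hy : y ∈ (phi x₀).target) : ∀ᶠ z in nhds y, chartSign w x₀ z = chartSign w x₀ y := by
  have hc : ContinuousAt (fun z => topPower (chartForm w x₀ z) (stdBasis n)) y :=
    (contDiffAt_form_apply_const (contDiffAt_wedgePow (stdBasis n)
      ((isSmoothForm_iff w).1 hw x₀ y hy) _) _).continuousAt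
  rcases (topPower_ne_zero_of_frame hJ hy).lt_or_gt with h | h
  · filter_upwards [hc.eventually (gt_mem_nhds h)] with z hz
    rw [chartSign, chartSign, orientationSign, orientationSign, if_neg hz.le.not_gt,
      if_neg h.le.not_gt]
  · filter_upwards [hc.eventually (lt_mem_nhds h)] with z hz
    rw [chartSign, chartSign, orientationSign, orientationSign, if_pos hz, if_pos h]

theorem chartForms_chatVolForms {a : RoughForms n M} {x₀ : M} {y : E n}
    (hy : y ∈ (phi x₀).target) :
    chartForms (chatVolForms w J a) x₀ y =
      chatVol (chartMetric w J x₀ y) (chartFrame w J x₀ y) (chartForms a x₀ y) := by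
  have h := pullForms_chatVol (chartD x₀ y)
    (metric (valueAt w ((phi x₀).symm y)) (endAt J ((phi x₀).symm y))) (chartFrame w J x₀ y)
    (formsAt a ((phi x₀).symm y))
  simp only [chartD_chartFrame w J hy] at h
  exact h

/-- The frame is chosen separately at each point and need not be continuous. Its determinant,
however, is a locally constant sign divided by the density, and this suffices for
`contDiffAt_chatVol`. -/
theorem chatVolForms_mem (hw : IsSmoothForm w) (hJ : IsCompatible w J) {a : RoughForms n M}
    (ha : a ∈ smoothForms n M) : chatVolForms w J a ∈ smoothForms n M := by
  rw [mem_smoothForms_iff] at ha ⊢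
  intro x₀ y hy k
  have hev : ∀ᶠ z in nhds y, z ∈ (phi (n := n) x₀).target := (isOpen_target x₀).mem_nhds hy
  have h1 : (fun z => chartForms (chatVolForms w J a) x₀ z k) =ᶠ[nhds y] fun z =>
      chatVol (chartMetric w J x₀ z) (chartFrame w J x₀ z) (chartForms a x₀ z) k := by
    filter_upwards [hev] with z hz
    rw [chartForms_chatVolForms hz]
  refine ContDiffAt.congr_of_eventuallyEq ?_ h1
  refine contDiffAt_chatVol ⟨2 * n + 1, by ring⟩ (stdBasis n)
    (contDiffAt_chartMetric hw hJ.smooth hy) ?_ ?_ (ha x₀ y hy) k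
  · filter_upwards [hev] with z hz
    exact chartFrame_orthonormal hJ hz
  · have h2 : (fun z => (stdBasis n).det (chartFrame w J x₀ z)) =ᶠ[nhds y] fun z =>
        chartSign w x₀ y * (chartDensity w J x₀ z)⁻¹ := by
      filter_upwards [hev, chartSign_eventuallyEq hw hJ hy] with z hz hz2
      rw [← hz2, ← det_mul_chartDensity hJ hz, mul_assoc,
        mul_inv_cancel₀ (chartDensity_pos hJ hz).ne', mul_one]
    refine ContDiffAt.congr_of_eventuallyEq ?_ h2
    exact contDiffAt_const.mul ((contDiffAt_chartDensity hw hJ hy).inv (chartDensity_pos hJ hy).ne')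

/-- The pointwise inner product of forms. -/
def innerAt (w : RoughForm n M 2) (J : RoughEnd n M) (a b : RoughForms n M) (p : M) : ℝ :=
  innerForms (frameAt w J p) (formsAt a p) (formsAt b p)

theorem innerAt_symm {x₀ : M} {y : E n} (hy : y ∈ (phi x₀).target) (a b : RoughForms n M) :
    innerAt w J a b ((phi x₀).symm y) =
      innerForms (chartFrame w J x₀ y) (chartForms a x₀ y) (chartForms b x₀ y) := by
  rw [chartForms, chartForms, ← innerForms_pullForms]
  simp only [chartD_chartFrame w J hy]
  rfl

/-- The Euclidean pairing `(a, b) ↦ ⟨a, ĉ(dvol) b⟩` on the model space. -/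
def stdPairing (a b : Forms (E n)) : ℝ := pairing (innerSL ℝ) (stdBasis n) a b

theorem stdBasis_orthonormal (i j : Fin (4 * n + 2)) :
    innerSL ℝ (stdBasis n i) (stdBasis n j) = if i = j then (1 : ℝ) else 0 := by
  rw [stdBasis_apply, stdBasis_apply, innerSL_apply_apply, EuclideanSpace.inner_single_left]
  simp

theorem innerAt_chatVolForms (hJ : IsCompatible w J) {x₀ : M} {y : E n} (hy : y ∈ (phi x₀).target)
    (a b : RoughForms n M) :
    innerAt w J a (chatVolForms w J b) ((phi x₀).symm y) =
      (stdBasis n).det (chartFrame w J x₀ y) *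
        stdPairing (chartForms a x₀ y) (chartForms b x₀ y) := by
  rw [innerAt_symm hy, chartForms_chatVolForms hy]
  have he := chartFrame_orthonormal hJ hy
  have h := pairing_eq_det_mul (e := frameBasis he (stdBasis n)) (f := stdBasis n)
    (g := chartMetric w J x₀ y) (g' := innerSL ℝ) ⟨2 * n + 1, by ring⟩ (by rwa [coe_frameBasis])
    stdBasis_orthonormal (chartForms a x₀ y) (chartForms b x₀ y)
  rw [coe_frameBasis] at h
  exact h

/-- The determinant from `pairing_eq_det_mul` cancels against the density. Apart from a locally
constant sign, what remains to be integrated is a pairing with constant coefficients, independent of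
the metric. -/
theorem innerAt_chatVolForms_mul_density (hJ : IsCompatible w J) {x₀ : M} {y : E n}
    (hy : y ∈ (phi x₀).target) (a b : RoughForms n M) :
    innerAt w J a (chatVolForms w J b) ((phi x₀).symm y) * chartDensity w J x₀ y =
      chartSign w x₀ y * stdPairing (chartForms a x₀ y) (chartForms b x₀ y) := by
  rw [innerAt_chatVolForms hJ hy, ← det_mul_chartDensity hJ hy]
  ring

end Charts

/-! ### Integration in charts -/

section Volume

variable {n : ℕ} {M : Type*} [TopologicalSpace M] [ChartedSpace (E n) M]
  [IsManifold (𝓡 (4 * n + 2)) ∞ M]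

variable {w : RoughForm n M 2} {J : RoughEnd n M}

omit [IsManifold (𝓡 (4 * n + 2)) ∞ M] in
theorem continuousOn_phi_symm (x₀ : M) : ContinuousOn (phi (n := n) x₀).symm (phi x₀).target :=
  continuousOn_extChartAt_symm x₀

omit [IsManifold (𝓡 (4 * n + 2)) ∞ M] in
theorem continuousOn_phi (x₀ : M) : ContinuousOn (phi (n := n) x₀) (phi (n := n) x₀).source :=
  continuousOn_extChartAt x₀

theorem continuousOn_chartDensity (hw : IsSmoothForm w) (hJ : IsCompatible w J) (x₀ : M) :
    ContinuousOn (chartDensity w J x₀) (phi x₀).target :=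
  fun _ hy => (contDiffAt_chartDensity hw hJ hy).continuousAt.continuousWithinAt

omit [IsManifold (𝓡 (4 * n + 2)) ∞ M] in
theorem chartDensity_nonneg (w : RoughForm n M 2) (J : RoughEnd n M) (x₀ : M) (y : E n) :
    0 ≤ chartDensity w J x₀ y := Real.sqrt_nonneg _

/-- The transition map carries the orthonormal frame of one chart to an orthonormal family in the
other. Both Gram determinants are the inverse squares of the frame determinants, which differ by det
L. -/
theorem chartDensity_transition (hJ : IsCompatible w J) {x₀ x₁ : M} {y : E n}
    (hy : y ∈ (phi x₀).target) (hy1 : (phi x₀).symm y ∈ (phi (n := n) x₁).source) :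
    |(fderiv ℝ (transition x₀ x₁) y).det| * chartDensity w J x₁ (transition x₀ x₁ y) =
      chartDensity w J x₀ y := by
  set L := fderiv ℝ (transition x₀ x₁) y
  have he := chartFrame_orthonormal hJ hy
  have he1 : ∀ i j, chartMetric w J x₁ (transition x₀ x₁ y) (L (chartFrame w J x₀ y i))
      (L (chartFrame w J x₀ y j)) = if i = j then 1 else 0 := by
    intro i j
    rw [← chartMetric_eq_transition w J hy hy1, he]
  have h0 := det_sq_mul_det_gram (frameBasis he (stdBasis n)) (stdBasis n) (by rwa [coe_frameBasis])
  have h1 := det_sq_mul_det_gram (frameBasis he1 (stdBasis n)) (stdBasis n)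
    (by rwa [coe_frameBasis])
  rw [coe_frameBasis] at h0 h1
  have h2 : (stdBasis n).det (fun i => L (chartFrame w J x₀ y i)) =
      L.det * (stdBasis n).det (chartFrame w J x₀ y) :=
    Module.Basis.det_comp (stdBasis n) (L : E n →ₗ[ℝ] E n) (chartFrame w J x₀ y)
  have h3 : (stdBasis n).det (chartFrame w J x₀ y) ^ 2 ≠ 0 := by
    intro h
    rw [h, zero_mul] at h0
    exact zero_ne_one h0
  rw [chartDensity_eq, chartDensity_eq, ← Real.sqrt_sq_eq_abs, ← Real.sqrt_mul (sq_nonneg _)]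
  congr 1
  refine mul_left_cancel₀ h3 ?_
  rw [h0, ← h1, h2]
  ring

theorem integrableOn_of_vanish {U K : Set (E n)} (hU : MeasurableSet U) (hK : IsCompact K)
    (hKU : K ⊆ U) {G : E n → ℝ} (hG : ContinuousOn G U) (h0 : ∀ y ∈ U \ K, G y = 0) :
    IntegrableOn G U :=
  ((hG.mono hKU).integrableOn_compact hK).of_forall_sdiff_eq_zero hU h0

omit [IsManifold (𝓡 (4 * n + 2)) ∞ M] in
theorem continuousOn_comp_phi_symm {F : M → ℝ} {x₀ : M} (hF : Continuous F) :
    ContinuousOn (fun y => F ((phi (n := n) x₀).symm y)) (phi x₀).target :=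
  hF.comp_continuousOn (continuousOn_phi_symm x₀)

omit [IsManifold (𝓡 (4 * n + 2)) ∞ M] in
theorem transition_image (x₀ x₁ : M) :
    transition x₀ x₁ '' {y | y ∈ (phi (n := n) x₀).target ∧
      (phi x₀).symm y ∈ (phi (n := n) x₁).source} =
      {y | y ∈ (phi (n := n) x₁).target ∧ (phi x₁).symm y ∈ (phi (n := n) x₀).source} := by
  ext z
  constructor
  · rintro ⟨y, ⟨hy, hy1⟩, rfl⟩
    refine ⟨transition_mem hy1, ?_⟩
    rw [symm_transition hy1]
    exact (phi x₀).map_target hy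
  · rintro ⟨hz, hz1⟩
    refine ⟨transition x₁ x₀ z, ⟨transition_mem hz1, ?_⟩, ?_⟩
    · rw [symm_transition hz1]
      exact (phi x₁).map_target hz
    · rw [transition, symm_transition hz1, (phi x₁).right_inv hz]

omit [IsManifold (𝓡 (4 * n + 2)) ∞ M] in
theorem transition_injOn (x₀ x₁ : M) : Set.InjOn (transition x₀ x₁)
    {y | y ∈ (phi (n := n) x₀).target ∧ (phi x₀).symm y ∈ (phi (n := n) x₁).source} := by
  rintro y ⟨hy, hy1⟩ z ⟨hz, hz1⟩ h
  have h1 := symm_transition hy1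
  rw [h, symm_transition hz1] at h1
  rw [← (phi x₀).right_inv hy, ← h1, (phi x₀).right_inv hz]

omit [IsManifold (𝓡 (4 * n + 2)) ∞ M] in
theorem isOpen_overlap (x₀ x₁ : M) :
    IsOpen {y | y ∈ (phi (n := n) x₀).target ∧ (phi x₀).symm y ∈ (phi (n := n) x₁).source} :=
  (continuousOn_phi_symm x₀).isOpen_inter_preimage (isOpen_target x₀) (isOpen_source x₁)

/-- The integral over one chart of a function supported in another chart. -/
theorem setIntegral_chart_change (hJ : IsCompatible w J) {F : M → ℝ} {x₀ x₁ : M}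
    (h0 : ∀ p ∉ (phi (n := n) x₀).source, F p = 0)
    (h1 : ∀ p ∉ (phi (n := n) x₁).source, F p = 0) :
    ∫ y in (phi x₁).target, F ((phi x₁).symm y) * chartDensity w J x₁ y =
      ∫ y in (phi x₀).target, F ((phi x₀).symm y) * chartDensity w J x₀ y := by
  -- As F vanishes off each of the two chart domains, both integrals reduce to the overlap, where
  -- the change of variables formula applies.
  rw [setIntegral_eq_of_subset_of_forall_sdiff_eq_zero (isOpen_target x₁).measurableSet
    (s := {y | y ∈ (phi (n := n) x₁).target ∧ (phi x₁).symm y ∈ (phi (n := n) x₀).source})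
    (fun y hy => hy.1), setIntegral_eq_of_subset_of_forall_sdiff_eq_zero
      (t := (phi x₀).target) (isOpen_target x₀).measurableSet
    (s := {y | y ∈ (phi (n := n) x₀).target ∧ (phi x₀).symm y ∈ (phi (n := n) x₁).source})
    (fun y hy => hy.1), ← transition_image x₀ x₁,
    integral_image_eq_integral_abs_det_fderiv_smul volume (isOpen_overlap x₀ x₁).measurableSet
      (f' := fun y => fderiv ℝ (transition x₀ x₁) y)
      (fun y hy => ((contDiffAt_transition hy.1 hy.2).differentiableAt
        (by simp)).hasFDerivAt.hasFDerivWithinAt) (transition_injOn x₀ x₁)]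
  · refine setIntegral_congr_fun (isOpen_overlap x₀ x₁).measurableSet fun y hy => ?_
    simp only [smul_eq_mul]
    rw [← chartDensity_transition hJ hy.1 hy.2, symm_transition hy.2]
    ring
  · rintro y ⟨hy, hy1⟩
    rw [h1, zero_mul]
    exact fun h => hy1 ⟨hy, h⟩
  · rintro y ⟨hy, hy1⟩
    rw [h0, zero_mul]
    exact fun h => hy1 ⟨hy, h⟩

omit [IsManifold (𝓡 (4 * n + 2)) ∞ M] in
theorem isCompact_image_tsupport [CompactSpace M] {F : M → ℝ} {x₀ : M}
    (hF : tsupport F ⊆ (phi (n := n) x₀).source) : IsCompact (phi (n := n) x₀ '' tsupport F) :=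
  (isClosed_tsupport F).isCompact.image_of_continuousOn ((continuousOn_phi x₀).mono hF)

omit [IsManifold (𝓡 (4 * n + 2)) ∞ M] in
theorem image_tsupport_subset {F : M → ℝ} {x₀ : M}
    (hF : tsupport F ⊆ (phi (n := n) x₀).source) :
    phi (n := n) x₀ '' tsupport F ⊆ (phi x₀).target := by
  rintro _ ⟨p, hp, rfl⟩
  exact (phi x₀).map_source (hF hp)

omit [IsManifold (𝓡 (4 * n + 2)) ∞ M] in
theorem eq_zero_of_notMem_image {F : M → ℝ} {x₀ : M} {y : E n} (hy : y ∈ (phi x₀).target)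
    (hy1 : y ∉ phi (n := n) x₀ '' tsupport F) : F ((phi x₀).symm y) = 0 := by
  by_contra h
  exact hy1 ⟨_, subset_tsupport _ h, (phi x₀).right_inv hy⟩

theorem integrableOn_chart [CompactSpace M] (hw : IsSmoothForm w) (hJ : IsCompatible w J)
    {F : M → ℝ} {x₀ : M} (hc : Continuous F) (hF : tsupport F ⊆ (phi (n := n) x₀).source) :
    IntegrableOn (fun y => F ((phi x₀).symm y) * chartDensity w J x₀ y) (phi x₀).target :=
  integrableOn_of_vanish (isOpen_target x₀).measurableSet (isCompact_image_tsupport hF)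
    (image_tsupport_subset hF)
    ((continuousOn_comp_phi_symm hc).mul (continuousOn_chartDensity hw hJ x₀))
    fun y hy => by rw [eq_zero_of_notMem_image hy.1 hy.2, zero_mul]

variable [T2Space M] [CompactSpace M]

theorem tsupport_chartPartition (i : M) :
    tsupport (chartPartition n M i) ⊆ (phi (n := n) i).source := by
  have h := Classical.choose_spec
    (SmoothPartitionOfUnity.exists_isSubordinate_chartAt_source (𝓡 (4 * n + 2)) M) i
  rw [extChartAt_source]
  exact h

theorem continuous_chartPartition (i : M) : Continuous (chartPartition n M i) :=
  (chartPartition n M i).contMDiff.continuous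

variable (n M) in
/-- The finitely many indices of nonzero functions of the partition of unity. -/
def chartIndices : Finset M :=
  ((chartPartition n M).locallyFinite.finite_nonempty_of_compact).toFinset

theorem chartPartition_eq_zero {i : M} (hi : i ∉ chartIndices n M) (p : M) :
    chartPartition n M i p = 0 := by
  by_contra h
  exact hi ((Set.Finite.mem_toFinset _).2 ⟨p, h⟩)

theorem sum_chartPartition (p : M) : ∑ i ∈ chartIndices n M, chartPartition n M i p = 1 := by
  rw [← (chartPartition n M).sum_eq_one (Set.mem_univ p)]
  refine (finsum_eq_sum_of_support_subset _ fun i hi => ?_).symm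
  by_contra h
  exact hi (chartPartition_eq_zero h p)

variable [MeasurableSpace M]

/-- The contribution of the chart at `i` to the volume measure. -/
def chartMeasure (w : RoughForm n M 2) (J : RoughEnd n M) (i : M) : Measure M :=
  Measure.map (phi i).symm ((volume.restrict (phi i).target).withDensity fun y =>
    ENNReal.ofReal (chartPartition n M i ((phi i).symm y) * chartDensity w J i y))

/-- By compactness and local finiteness only finitely many partition functions are nonzero; the
other charts contribute density 0. -/
theorem volumeMeasure_eq (w : RoughForm n M 2) (J : RoughEnd n M) :
    volumeMeasure w J = ∑ i ∈ chartIndices n M, chartMeasure w J i := by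
  have h0 : ∀ i ∉ chartIndices n M, chartMeasure w J i = 0 := by
    intro i hi
    have : (fun y => ENNReal.ofReal (chartPartition n M i ((phi i).symm y) *
        chartDensity w J i y)) = 0 := by
      funext y
      simp [chartPartition_eq_zero hi]
    rw [chartMeasure, this, withDensity_zero, Measure.map_zero]
  ext s hs
  rw [volumeMeasure, Measure.sum_apply _ hs, Measure.finsetSum_apply]
  refine tsum_eq_sum fun i hi => ?_
  change chartMeasure w J i s = 0
  rw [h0 i hi]
  rfl

omit [MeasurableSpace M] in
theorem integrableOn_chartPartition (hw : IsSmoothForm w) (hJ : IsCompatible w J) (i : M) :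
    IntegrableOn (fun y => chartPartition n M i ((phi i).symm y) * chartDensity w J i y)
      (phi i).target :=
  integrableOn_chart hw hJ (continuous_chartPartition i) (tsupport_chartPartition i)

theorem isFiniteMeasure_chartMeasure (hw : IsSmoothForm w) (hJ : IsCompatible w J) (i : M) :
    IsFiniteMeasure (chartMeasure w J i) := by
  have := isFiniteMeasure_withDensity_ofReal (integrableOn_chartPartition hw hJ i).2
  exact Measure.isFiniteMeasure_map _ _

theorem isFiniteMeasure_volumeMeasure (hw : IsSmoothForm w) (hJ : IsCompatible w J) :
    IsFiniteMeasure (volumeMeasure w J) := by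
  rw [volumeMeasure_eq]
  refine ⟨?_⟩
  rw [Measure.finsetSum_apply]
  refine ENNReal.sum_lt_top.2 fun i _ => ?_
  have := isFiniteMeasure_chartMeasure hw hJ i
  exact measure_lt_top _ _

variable [BorelSpace M]

omit [T2Space M] in
theorem integrable_of_continuous {μ : Measure M} [IsFiniteMeasure μ] {F : M → ℝ}
    (hF : Continuous F) : Integrable F μ :=
  hF.integrable_of_hasCompactSupport (HasCompactSupport.of_compactSpace F)

theorem integral_chartMeasure (hw : IsSmoothForm w) (hJ : IsCompatible w J) (i : M) {F : M → ℝ}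
    (hF : Continuous F) : ∫ p, F p ∂chartMeasure w J i =
      ∫ y in (phi i).target, (F ((phi i).symm y) * chartPartition n M i ((phi i).symm y)) *
        chartDensity w J i y := by
  have hm := (isOpen_target (n := n) i).measurableSet
  have h1 : AEMeasurable (phi (n := n) i).symm (volume.restrict (phi i).target) :=
    (continuousOn_phi_symm i).aemeasurable hm
  rw [chartMeasure, integral_map (h1.mono_ac (withDensity_absolutelyContinuous _ _))
    hF.aestronglyMeasurable]
  have h2 := (integrableOn_chartPartition hw hJ i).aestronglyMeasurable.aemeasurable
  have h3 := integral_withDensity_eq_integral_toReal_smul₀ h2.ennreal_ofReal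
    (by simp) (fun y => F ((phi i).symm y))
  rw [h3]
  refine integral_congr_ae (Filter.Eventually.of_forall fun y => ?_)
  simp only [smul_eq_mul]
  rw [ENNReal.toReal_ofReal (mul_nonneg ((chartPartition n M).nonneg _ _)
    (chartDensity_nonneg w J i y))]
  ring

/-- The integral of a function supported in a chart, computed in that chart. -/
theorem integral_volumeMeasure (hw : IsSmoothForm w) (hJ : IsCompatible w J) {F : M → ℝ} {x₀ : M}
    (hF : Continuous F) (hs : tsupport F ⊆ (phi (n := n) x₀).source) :
    ∫ p, F p ∂volumeMeasure w J =
      ∫ y in (phi x₀).target, F ((phi x₀).symm y) * chartDensity w J x₀ y := by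
  have hsupp : ∀ i, tsupport (fun p => F p * chartPartition n M i p) ⊆ (phi (n := n) x₀).source :=
    fun i => (tsupport_mul_subset_left).trans hs
  rw [volumeMeasure_eq, integral_finsetSum_measure fun i _ => by
    have := isFiniteMeasure_chartMeasure hw hJ i
    exact integrable_of_continuous hF]
  have h1 : ∀ i, ∫ p, F p ∂chartMeasure w J i = ∫ y in (phi x₀).target,
      (F ((phi x₀).symm y) * chartPartition n M i ((phi x₀).symm y)) * chartDensity w J x₀ y := by
    intro i
    rw [integral_chartMeasure hw hJ i hF]
    -- The product of F with the i-th partition function vanishes off both charts, so each summand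
    -- moves to the chart at x₀. There the partition functions add up to 1.
    refine setIntegral_chart_change hJ (F := fun p => F p * chartPartition n M i p) ?_ ?_
    · intro p hp
      have : F p = 0 := image_eq_zero_of_notMem_tsupport fun h => hp (hs h)
      simp [this]
    · intro p hp
      have : chartPartition n M i p = 0 :=
        image_eq_zero_of_notMem_tsupport fun h => hp (tsupport_chartPartition i h)
      simp [this]
  simp only [h1]
  have h2 := integral_finsetSum (μ := volume.restrict (phi x₀).target) (chartIndices n M)
    (f := fun i y => (F ((phi x₀).symm y) * chartPartition n M i ((phi x₀).symm y)) *
      chartDensity w J x₀ y) fun i _ =>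
    integrableOn_chart hw hJ (hF.mul (continuous_chartPartition i)) (hsupp i)
  rw [← h2]
  refine integral_congr_ae (Filter.Eventually.of_forall fun y => ?_)
  simp only
  rw [← Finset.sum_mul, ← Finset.mul_sum, sum_chartPartition, mul_one]

end Volume

/-! ### Derivatives of curves of forms -/

section Curves

variable {V : Type*} [NormedAddCommGroup V] [NormedSpace ℝ V] {m : ℕ} {t : ℝ}

theorem hasDerivAt_clm_apply {F G : Type*} [NormedAddCommGroup F] [NormedSpace ℝ F]
    [NormedAddCommGroup G] [NormedSpace ℝ G] (L : F →L[ℝ] G) {A : ℝ → F} {A' : F}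
    (hA : HasDerivAt A A' t) : HasDerivAt (fun s => L (A s)) (L A') t :=
  L.hasFDerivAt.comp_hasDerivAt t hA

/-- Inhomogeneous forms carry no norm here, so derivatives of curves of forms are taken degree by
degree. -/
theorem hasDerivAt_extMul (θ : V →L[ℝ] ℝ) {A : ℝ → Forms V} {A' : Forms V}
    (hA : ∀ k, HasDerivAt (fun s => A s k) (A' k) t) (k : ℕ) :
    HasDerivAt (fun s => extMul θ (A s) k) (extMul θ A' k) t := by
  rcases k with _ | k
  · exact hasDerivAt_const t _
  · have h := hasDerivAt_clm_apply (F := V [⋀^Fin k]→L[ℝ] ℝ) (G := V →L[ℝ] V [⋀^Fin k]→L[ℝ] ℝ)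
      (ContinuousLinearMap.smulRightL ℝ V (V [⋀^Fin k]→L[ℝ] ℝ) θ) (hA k)
    exact hasDerivAt_clm_apply (F := V →L[ℝ] V [⋀^Fin k]→L[ℝ] ℝ) (G := V [⋀^Fin (k + 1)]→L[ℝ] ℝ)
      (ContinuousAlternatingMap.alternatizeUncurryFinCLM (n := k) ℝ V ℝ) h

theorem hasDerivAt_intMul (v : V) {A : ℝ → Forms V} {A' : Forms V}
    (hA : ∀ k, HasDerivAt (fun s => A s k) (A' k) t) (k : ℕ) :
    HasDerivAt (fun s => intMul v (A s) k) (intMul v A' k) t := by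
  have h := hasDerivAt_clm_apply (F := V [⋀^Fin (k + 1)]→L[ℝ] ℝ)
    (G := V →L[ℝ] V [⋀^Fin k]→L[ℝ] ℝ)
    (ContinuousAlternatingMap.curryLeftLI (𝕜 := ℝ) (E := V) (F := ℝ)
      (n := k)).toContinuousLinearMap (hA (k + 1))
  exact hasDerivAt_clm_apply (F := V →L[ℝ] V [⋀^Fin k]→L[ℝ] ℝ) (G := V [⋀^Fin k]→L[ℝ] ℝ)
    (ContinuousLinearMap.apply ℝ (V [⋀^Fin k]→L[ℝ] ℝ) v) h

theorem hasDerivAt_chatVol (g : V →L[ℝ] V →L[ℝ] ℝ) (e : Fin m → V) {A : ℝ → Forms V}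
    {A' : Forms V} (hA : ∀ k, HasDerivAt (fun s => A s k) (A' k) t) (k : ℕ) :
    HasDerivAt (fun s => chatVol g e (A s) k) (chatVol g e A' k) t := by
  rw [chatVol_eq]
  induction List.finRange m generalizing k with
  | nil => exact hA k
  | cons i l ih =>
    simp only [List.map_cons, List.prod_cons, Module.End.mul_apply]
    exact (hasDerivAt_extMul (g (e i)) ih k).add (hasDerivAt_intMul (e i) ih k)

theorem hasDerivAt_form_apply {k : ℕ} {A : ℝ → V [⋀^Fin k]→L[ℝ] ℝ} {A' : V [⋀^Fin k]→L[ℝ] ℝ}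
    (hA : HasDerivAt A A' t) (v : Fin k → V) : HasDerivAt (fun s => A s v) (A' v) t := by
  have h := (ContinuousAlternatingMap.apply ℝ V ℝ v).hasFDerivAt.comp_hasDerivAt t hA
  exact h

theorem hasDerivAt_innerForms (e : Fin m → V) {A B : ℝ → Forms V} {A' B' : Forms V}
    (hA : ∀ k, HasDerivAt (fun s => A s k) (A' k) t)
    (hB : ∀ k, HasDerivAt (fun s => B s k) (B' k) t) :
    HasDerivAt (fun s => innerForms e (A s) (B s))
      (innerForms e A' (B t) + innerForms e (A t) B') t := by
  unfold innerForms
  rw [← Finset.sum_add_distrib]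
  refine HasDerivAt.fun_sum fun k _ => ?_
  rw [← mul_add, ← Finset.sum_add_distrib]
  refine HasDerivAt.const_mul _ (HasDerivAt.fun_sum fun i _ => ?_)
  exact (hasDerivAt_form_apply (hA k) _).mul (hasDerivAt_form_apply (hB k) _)

end Curves

/-! ### The local Stokes formula on the model space -/

section LocalStokes

variable {n : ℕ}

/-- The derivative of a family of forms in the direction `v`. -/
def dirDeriv (A : E n → Forms (E n)) (v y : E n) : Forms (E n) :=
  fun k => fderiv ℝ (fun z => A z k) y v

/-- The exterior derivative of a family of inhomogeneous forms on the model space. -/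
def extDerivForms (A : E n → Forms (E n)) (y : E n) : Forms (E n)
  | 0 => 0
  | k + 1 => extDeriv (fun z => A z k) y

theorem extDerivForms_eq_sum (A : E n → Forms (E n)) (y : E n) :
    extDerivForms A y =
      ∑ i, extMul (coframe (stdBasis n) i) (dirDeriv A (stdBasis n i) y) := by
  funext k
  rw [Finset.sum_apply]
  rcases k with _ | k
  · simp [extMul_zero_apply, extDerivForms]
  · simp only [extMul_succ_apply]
    exact alternatize_eq_sum (stdBasis n) (fderiv ℝ (fun z => A z k) y)

theorem hasDerivAt_line {A : E n → Forms (E n)} {y : E n}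
    (hA : ∀ k, ContDiffAt ℝ ∞ (fun z => A z k) y) (v : E n) (k : ℕ) :
    HasDerivAt (fun s : ℝ => A (y + s • v) k) (dirDeriv A v y k) 0 :=
  ((hA k).differentiableAt (by simp)).hasFDerivAt.hasLineDerivAt v

theorem contDiffAt_innerForms {m : ℕ} (e : Fin m → E n) {A B : E n → Forms (E n)} {y : E n}
    (hA : ∀ k, ContDiffAt ℝ ∞ (fun z => A z k) y) (hB : ∀ k, ContDiffAt ℝ ∞ (fun z => B z k) y) :
    ContDiffAt ℝ ∞ (fun z => innerForms e (A z) (B z)) y := by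
  unfold innerForms
  refine ContDiffAt.sum fun k _ => contDiffAt_const.mul (ContDiffAt.sum fun i _ => ?_)
  exact (contDiffAt_form_apply_const (hA k) _).mul (contDiffAt_form_apply_const (hB k) _)

theorem contDiffAt_stdPairing {A B : E n → Forms (E n)} {y : E n}
    (hA : ∀ k, ContDiffAt ℝ ∞ (fun z => A z k) y) (hB : ∀ k, ContDiffAt ℝ ∞ (fun z => B z k) y) :
    ContDiffAt ℝ ∞ (fun z => stdPairing (A z) (B z)) y :=
  contDiffAt_innerForms _ hA fun k => contDiffAt_chatVol ⟨2 * n + 1, by ring⟩ (stdBasis n)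
    contDiffAt_const (Filter.Eventually.of_forall fun _ => stdBasis_orthonormal)
    contDiffAt_const hB k

theorem stdPairing_extMul (θ : E n →L[ℝ] ℝ) (a b : Forms (E n)) :
    stdPairing (extMul θ a) b = -stdPairing a (extMul θ b) :=
  pairing_extMul ⟨2 * n + 1, by ring⟩ stdBasis_orthonormal θ a b

theorem fderiv_stdPairing {A B : E n → Forms (E n)} {y : E n}
    (hA : ∀ k, ContDiffAt ℝ ∞ (fun z => A z k) y) (hB : ∀ k, ContDiffAt ℝ ∞ (fun z => B z k) y)
    (v : E n) : fderiv ℝ (fun z => stdPairing (A z) (B z)) y v =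
      stdPairing (dirDeriv A v y) (B y) + stdPairing (A y) (dirDeriv B v y) := by
  have h1 : HasDerivAt (fun s : ℝ => stdPairing (A (y + s • v)) (B (y + s • v)))
      (fderiv ℝ (fun z => stdPairing (A z) (B z)) y v) 0 :=
    ((contDiffAt_stdPairing hA hB).differentiableAt (by simp)).hasFDerivAt.hasLineDerivAt v
  have h2 := hasDerivAt_innerForms (stdBasis n) (hasDerivAt_line hA v)
    (hasDerivAt_chatVol (innerSL ℝ) (stdBasis n) (hasDerivAt_line hB v))
  simp only [zero_smul, add_zero] at h2
  exact h1.unique h2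

theorem dirDeriv_extMul (θ : E n →L[ℝ] ℝ) {B : E n → Forms (E n)} {y : E n}
    (hB : ∀ k, ContDiffAt ℝ ∞ (fun z => B z k) y) (v : E n) :
    dirDeriv (fun z => extMul θ (B z)) v y = extMul θ (dirDeriv B v y) := by
  funext k
  have h1 := hasDerivAt_line (A := fun z => extMul θ (B z))
    (fun k => contDiffAt_extMul contDiffAt_const hB k) v k
  exact h1.unique (hasDerivAt_extMul θ (hasDerivAt_line hB v) k)

/-- The integrand of the local Stokes formula is a divergence. -/
theorem stdPairing_extDerivForms {A B : E n → Forms (E n)} {y : E n}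
    (hA : ∀ k, ContDiffAt ℝ ∞ (fun z => A z k) y) (hB : ∀ k, ContDiffAt ℝ ∞ (fun z => B z k) y) :
    stdPairing (extDerivForms A y) (B y) - stdPairing (A y) (extDerivForms B y) =
      -∑ i, fderiv ℝ (fun z => stdPairing (A z) (extMul (coframe (stdBasis n) i) (B z))) y
        (stdBasis n i) := by
  -- With d = ∑ eⁱ ∧ ∂ᵢ, moving eⁱ across the pairing with its minus sign makes the two terms the
  -- two halves of a product rule.
  have h1 : stdPairing (extDerivForms A y) (B y) = -∑ i, stdPairing (dirDeriv A (stdBasis n i) y)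
      (extMul (coframe (stdBasis n) i) (B y)) := by
    rw [extDerivForms_eq_sum, stdPairing, pairing, innerForms_sum_left, ← Finset.sum_neg_distrib]
    exact Finset.sum_congr rfl fun i _ => stdPairing_extMul _ _ _
  have h2 : stdPairing (A y) (extDerivForms B y) = ∑ i, stdPairing (A y)
      (extMul (coframe (stdBasis n) i) (dirDeriv B (stdBasis n i) y)) := by
    rw [extDerivForms_eq_sum, stdPairing, pairing, map_sum, innerForms_sum_right]
    rfl
  rw [h1, h2, ← neg_add', ← Finset.sum_add_distrib]
  congr 1
  refine Finset.sum_congr rfl fun i _ => ?_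
  rw [fderiv_stdPairing hA (contDiffAt_extMul contDiffAt_const hB), dirDeriv_extMul _ hB]

/-- The integral over an open set of a derivative of a compactly supported function. -/
theorem setIntegral_fderiv_eq_zero {U K : Set (E n)} (hU : IsOpen U) (hK : IsCompact K)
    (hKU : K ⊆ U) {G : E n → ℝ} (hG : ∀ y ∈ U, ContDiffAt ℝ ∞ G y) (h0 : ∀ y ∈ U \ K, G y = 0)
    (v : E n) : IntegrableOn (fun y => fderiv ℝ G y v) U ∧ ∫ y in U, fderiv ℝ G y v = 0 := by
  -- Extension by zero is smooth on the whole space, because G vanishes on U outside the compact set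
  -- K.
  set H : E n → ℝ := U.indicator G with hH
  have hHK : ∀ y ∉ K, H y = 0 := by
    intro y hy
    by_cases hyU : y ∈ U
    · rw [hH, Set.indicator_of_mem hyU, h0 y ⟨hyU, hy⟩]
    · exact Set.indicator_of_notMem hyU _
  have hnear : ∀ y ∉ K, H =ᶠ[nhds y] fun _ => 0 := fun y hy => by
    filter_upwards [hK.isClosed.isOpen_compl.mem_nhds hy] with z hz
    exact hHK z hz
  have hnearU : ∀ y ∈ U, H =ᶠ[nhds y] G := fun y hy => by
    filter_upwards [hU.mem_nhds hy] with z hz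
    exact Set.indicator_of_mem hz _
  have hsmooth : ContDiff ℝ ∞ H := by
    rw [contDiff_iff_contDiffAt]
    intro y
    by_cases hy : y ∈ K
    · exact (hG y (hKU hy)).congr_of_eventuallyEq (hnearU y (hKU hy))
    · exact contDiffAt_const.congr_of_eventuallyEq (hnear y hy)
  have hd0 : ∀ y ∉ K, fderiv ℝ H y v = 0 := fun y hy => by
    rw [(hnear y hy).fderiv_eq]
    simp
  have hcd : Continuous fun y => fderiv ℝ H y v :=
    (hsmooth.continuous_fderiv (by simp)).clm_apply continuous_const
  have hint : Integrable fun y => fderiv ℝ H y v :=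
    hcd.integrable_of_hasCompactSupport (HasCompactSupport.intro hK hd0)
  have hintH : Integrable H :=
    hsmooth.continuous.integrable_of_hasCompactSupport (HasCompactSupport.intro hK hHK)
  have hzero : ∫ y, fderiv ℝ H y v = 0 := by
    -- Integration by parts against the constant function 1.
    have h := integral_mul_fderiv_eq_neg_fderiv_mul_of_integrable (μ := volume) (f := H)
      (g := fun _ => (1 : ℝ)) (v := v) (by simpa using hint) (by simp) (by simpa using hintH)
      (fun y _ => hsmooth.differentiable (by simp) y) (fun y _ => differentiableAt_const _)
    simpa using h
  have hU0 : ∀ y ∈ U, fderiv ℝ H y v = fderiv ℝ G y v := fun y hy => by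
    rw [(hnearU y hy).fderiv_eq]
  refine ⟨hint.integrableOn.congr_fun hU0 hU.measurableSet, ?_⟩
  rw [← setIntegral_congr_fun hU.measurableSet hU0,
    setIntegral_eq_integral_of_forall_compl_eq_zero fun y hy => hd0 y fun h => hy (hKU h), hzero]

end LocalStokes

/-! ### The operators on forms -/

section Operators

variable {n : ℕ} {M : Type*} [TopologicalSpace M] [ChartedSpace (E n) M]
  {w : RoughForm n M 2} {J : RoughEnd n M}

theorem chatVolForms_add (a b : RoughForms n M) :
    chatVolForms w J (a + b) = chatVolForms w J a + chatVolForms w J b :=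
  funext fun _ => map_add (chatVol (V := E n) _ _) (formsAt a _) (formsAt b _)

theorem chatVolForms_smul (c : ℝ) (a : RoughForms n M) :
    chatVolForms w J (c • a) = c • chatVolForms w J a :=
  funext fun _ => map_smul (chatVol (V := E n) _ _) c (formsAt a _)

theorem chatVolForms_neg (a : RoughForms n M) :
    chatVolForms w J (-a) = -chatVolForms w J a :=
  funext fun _ => map_neg (chatVol (V := E n) _ _) (formsAt a _)

theorem psiForms_add (a b : RoughForms n M) :
    psiForms w (a + b) = psiForms w a + psiForms w b :=
  funext fun p => psiMul_add (stdBasis n) (valueAt w p) (formsAt a p) (formsAt b p)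

theorem psiForms_smul (c : ℝ) (a : RoughForms n M) :
    psiForms w (c • a) = c • psiForms w a :=
  funext fun p => psiMul_smul (stdBasis n) (valueAt w p) c (formsAt a p)

theorem formDeriv_congr {k : ℕ} {a b : RoughForm n M k} {p : M}
    (h : ∀ᶠ q in nhds p, a q = b q) : formDeriv a p = formDeriv b p := by
  have hc : Filter.Tendsto (phi (n := n) p).symm (nhds (phi p p)) (nhds p) := by
    have := (continuousAt_extChartAt_symm (I := 𝓡 (4 * n + 2)) p).tendsto
    rwa [extChartAt_to_inv] at this
  have h1 : chartForm a p =ᶠ[nhds (phi p p)] chartForm b p := by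
    filter_upwards [hc.eventually h] with y hy
    rw [chartForm, chartForm, hy]
  rw [formDeriv, formDeriv, h1.extDeriv_eq]

theorem formDeriv_zero {k : ℕ} (p : M) : formDeriv (0 : RoughForm n M k) p = 0 := by
  have h : chartForm (0 : RoughForm n M k) p = 0 := rfl
  rw [formDeriv, h]
  have h2 : extDeriv (0 : E n → E n [⋀^Fin k]→L[ℝ] ℝ) (phi p p) = 0 := by
    have := extDeriv_smul (x := phi p p) (0 : ℝ) (0 : E n → E n [⋀^Fin k]→L[ℝ] ℝ)
    simpa using this
  rw [h2]
  rfl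

theorem dForms_eq_zero {a : RoughForms n M} {p : M} (h : ∀ᶠ q in nhds p, a q = 0) :
    dForms a p = 0 := by
  funext k
  rcases k with _ | k
  · rfl
  · rw [dForms]
    change formDeriv (fun y => a y k) p = 0
    rw [formDeriv_congr (b := 0) (h.mono fun q hq => congrFun hq k), formDeriv_zero]

theorem dForms_smul (c : ℝ) (a : RoughForms n M) : dForms (c • a) = c • dForms a := by
  funext p k
  rcases k with _ | k
  · exact (smul_zero c).symm
  · have h : chartForm (fun y => (c • a) y k) p = c • chartForm (fun y => a y k) p := rfl
    change formDeriv (fun y => (c • a) y k) p = c • formDeriv (fun y => a y k) p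
    rw [formDeriv, h, extDeriv_smul]
    rfl

/-- Each letter changes the degree by ±1, so an even number of letters preserves parity. The shift q
covers both components of an even cochain, with q = 0 and q = 3. -/
theorem chatVol_parity {V : Type*} [NormedAddCommGroup V] [NormedSpace ℝ V] {m : ℕ}
    (g : V →L[ℝ] V →L[ℝ] ℝ) (e : Fin m → V) (hm : Even m) {q : ℕ} {a : Forms V}
    (ha : ∀ k, ¬ Even (k + q) → a k = 0) (k : ℕ) (hk : ¬ Even (k + q)) : chatVol g e a k = 0 := by
  have key : ∀ (l : List (Fin m)) (k : ℕ), ¬ Even (k + l.length + q) →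
      (l.map fun i => chat g (e i)).prod a k = 0 := by
    intro l
    induction l with
    | nil => exact fun k hk => ha k hk
    | cons i l ih =>
      intro k hk
      simp only [List.length_cons, List.map_cons, List.prod_cons, Module.End.mul_apply] at hk ⊢
      set b := (l.map fun i => chat g (e i)).prod a
      have h1 : intMul (e i) b k = 0 := by
        ext u
        rw [intMul_apply, ih (k + 1) (by rwa [show k + 1 + l.length = k + (l.length + 1) by ring])]
        rfl
      have h2 : extMul (g (e i)) b k = 0 := by
        rcases k with _ | k
        · rfl
        · rw [extMul_succ_apply, ih k (by rw [Nat.even_iff] at hk ⊢; omega), covectorMul_zero]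
      rw [chat_apply, Pi.add_apply, h1, h2, add_zero]
  rw [chatVol_eq]
  refine key _ k ?_
  rw [List.length_finRange]
  intro h
  refine hk ?_
  rw [show k + m + q = k + q + m by ring, Nat.even_add] at h
  exact h.2 hm

theorem chatVolForms_parity {q : ℕ} {a : RoughForms n M} (ha : ∀ x k, ¬ Even (k + q) → a x k = 0)
    (x : M) (k : ℕ) (hk : ¬ Even (k + q)) : chatVolForms w J a x k = 0 :=
  chatVol_parity (V := E n) _ _ ⟨2 * n + 1, by ring⟩ (ha x) k hk

theorem dForms_parity {q : ℕ} {a : RoughForms n M} (ha : ∀ x k, ¬ Even (k + q) → a x k = 0)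
    (x : M) (k : ℕ) (hk : ¬ Even (k + (q + 1))) : dForms a x k = 0 := by
  rcases k with _ | k
  · rfl
  · have h : (fun y => a y k) = (0 : RoughForm n M k) := by
      funext y
      exact ha y k (by rw [Nat.even_iff] at hk ⊢; omega)
    change formDeriv (fun y => a y k) x = 0
    rw [h, formDeriv_zero]

theorem psiMul_parity {V : Type*} [NormedAddCommGroup V] [NormedSpace ℝ V]
    (w : V [⋀^Fin 2]→L[ℝ] ℝ) {q : ℕ} {a : Forms V} (ha : ∀ k, ¬ Even (k + q) → a k = 0) (k : ℕ)
    (hk : ¬ Even (k + q)) : psiMul w a k = 0 := by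
  rcases k with _ | _ | _ | _ | k
  · rfl
  · rfl
  · rfl
  · rfl
  · rw [psiMul, ha k (by rw [Nat.even_iff] at hk ⊢; omega)]
    ext v
    have h4 : ((Nat.factorial 4 : ℝ) * k.factorial) ≠ 0 := by positivity
    refine mul_left_cancel₀ h4 ?_
    rw [factorial_mul_wedge_apply]
    simp

theorem psiForms_parity {q : ℕ} {a : RoughForms n M} (ha : ∀ x k, ¬ Even (k + q) → a x k = 0)
    (x : M) (k : ℕ) (hk : ¬ Even (k + q)) : psiForms w a x k = 0 :=
  psiMul_parity (valueAt w x) (ha x) k hk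

variable [IsManifold (𝓡 (4 * n + 2)) ∞ M]

theorem dForms_add {a b : RoughForms n M} (ha : a ∈ smoothForms n M) (hb : b ∈ smoothForms n M) :
    dForms (a + b) = dForms a + dForms b := by
  funext p k
  rcases k with _ | k
  · exact (add_zero _).symm
  · have h : chartForm (fun y => (a + b) y k) p =
        chartForm (fun y => a y k) p + chartForm (fun y => b y k) p := rfl
    have hp := mem_extChartAt_target (I := 𝓡 (4 * n + 2)) p
    change formDeriv (fun y => (a + b) y k) p =
      formDeriv (fun y => a y k) p + formDeriv (fun y => b y k) p
    rw [formDeriv, h, extDeriv_add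
      (((isSmoothForm_iff _).1 (ha k) p _ hp).differentiableAt (by simp))
      (((isSmoothForm_iff _).1 (hb k) p _ hp).differentiableAt (by simp))]
    rfl

theorem chartForms_dForms {a : RoughForms n M} (ha : a ∈ smoothForms n M) {x₀ : M} {y : E n}
    (hy : y ∈ (phi x₀).target) :
    chartForms (dForms a) x₀ y = extDerivForms (chartForms a x₀) y := by
  funext k
  rcases k with _ | k
  · rfl
  · exact chartForm_formDeriv (ha k) hy

theorem isOrientedFrame_frameBasis (hJ : IsCompatible w J) (p : M) :
    ∃ e : Module.Basis (Fin (4 * n + 2)) ℝ (E n), ⇑e = frameAt w J p ∧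
      ∀ i j, metric (valueAt w p) (endAt J p) (e i) (e j) = if i = j then 1 else 0 := by
  have h := (isOrientedFrame_frameAt hJ p).1
  exact ⟨frameBasis h (stdBasis n), coe_frameBasis h _, by rwa [coe_frameBasis]⟩

theorem chatVolForms_chatVolForms (hJ : IsCompatible w J) (a : RoughForms n M) :
    chatVolForms w J (chatVolForms w J a) = -a := by
  funext p
  have h := chatVol_chatVol (isOrientedFrame_frameAt hJ p).1 (formsAt a p)
  rw [reverseSign_four_mul_add_two] at h
  exact h.trans (neg_one_smul ℝ (formsAt a p))

theorem innerAt_chatVolForms_left (hJ : IsCompatible w J) (a b : RoughForms n M) (p : M) :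
    innerAt w J (chatVolForms w J a) b p = -innerAt w J a (chatVolForms w J b) p := by
  have h := innerForms_chatVol (isOrientedFrame_frameAt hJ p).1 (formsAt a p) (formsAt b p)
  rw [reverseSign_four_mul_add_two, neg_one_mul] at h
  exact h

theorem innerAt_psiForms (hJ : IsCompatible w J) (a b : RoughForms n M) (p : M) :
    innerAt w J (psiForms w a) (chatVolForms w J b) p =
      innerAt w J a (chatVolForms w J (psiForms w b)) p := by
  obtain ⟨e, he, ho⟩ := isOrientedFrame_frameBasis hJ p
  have h := pairing_psiMul (e := e) ⟨2 * n + 1, by ring⟩ ho (valueAt w p) (formsAt a p)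
    (formsAt b p)
  rw [he] at h
  exact h

theorem eq_zero_of_innerAt_self (hJ : IsCompatible w J) {a : RoughForms n M} {p : M}
    (h : innerAt w J a a p = 0) : a p = 0 := by
  obtain ⟨e, he, -⟩ := isOrientedFrame_frameBasis hJ p
  rw [innerAt, ← he, innerForms, Finset.sum_eq_zero_iff_of_nonneg fun _ _ => mul_nonneg
    (by positivity) (Finset.sum_nonneg fun _ _ => mul_self_nonneg _)] at h
  have key : formsAt a p = 0 := by
    funext k
    -- The inner product ignores degrees above the dimension, where forms vanish anyway.
    rcases le_or_gt k (4 * n + 2) with hk | hk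
    · have h1 := h k (Finset.mem_range.2 (by omega))
      rw [mul_eq_zero, or_iff_right (by positivity), Finset.sum_eq_zero_iff_of_nonneg
        fun _ _ => mul_self_nonneg _] at h1
      refine ContinuousAlternatingMap.toAlternatingMap_injective
        (e.ext_alternating fun v _ => ?_)
      exact mul_self_eq_zero.1 (h1 v (Finset.mem_univ _))
    · exact form_eq_zero_of_lt (stdBasis n) hk _
  exact key

theorem contDiffAt_innerAt (hw : IsSmoothForm w) (hJ : IsCompatible w J) {a b : RoughForms n M}
    (ha : a ∈ smoothForms n M) (hb : b ∈ smoothForms n M) {x₀ : M} {y : E n}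
    (hy : y ∈ (phi x₀).target) :
    ContDiffAt ℝ ∞ (fun z => innerAt w J a b ((phi x₀).symm z)) y := by
  -- The frame in the definition of the inner product has no regularity. Writing b as ĉ(dvol) of a
  -- smooth form gives access to the chart formula for the pairing.
  have hb2 : b = chatVolForms w J (-chatVolForms w J b) := by
    rw [chatVolForms_neg, chatVolForms_chatVolForms hJ, neg_neg]
  have hc := (smoothForms n M).neg_mem (chatVolForms_mem hw hJ hb)
  rw [hb2]
  set c := -chatVolForms w J b
  have h1 : (fun z => innerAt w J a (chatVolForms w J c) ((phi x₀).symm z)) =ᶠ[nhds y] fun z =>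
      chartSign w x₀ y * stdPairing (chartForms a x₀ z) (chartForms c x₀ z) *
        (chartDensity w J x₀ z)⁻¹ := by
    filter_upwards [(isOpen_target x₀).mem_nhds hy, chartSign_eventuallyEq hw hJ hy] with z hz hz2
    rw [← hz2, ← innerAt_chatVolForms_mul_density hJ hz, mul_assoc,
      mul_inv_cancel₀ (chartDensity_pos hJ hz).ne', mul_one]
  refine ContDiffAt.congr_of_eventuallyEq ?_ h1
  exact (contDiffAt_const.mul (contDiffAt_stdPairing (mem_smoothForms_iff.1 ha x₀ y hy)
    (mem_smoothForms_iff.1 hc x₀ y hy))).mul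
    ((contDiffAt_chartDensity hw hJ hy).inv (chartDensity_pos hJ hy).ne')

theorem continuous_innerAt (hw : IsSmoothForm w) (hJ : IsCompatible w J) {a b : RoughForms n M}
    (ha : a ∈ smoothForms n M) (hb : b ∈ smoothForms n M) : Continuous (innerAt w J a b) := by
  rw [continuous_iff_continuousAt]
  intro p
  have h1 := (contDiffAt_innerAt hw hJ ha hb (mem_extChartAt_target p)).continuousAt
  have h2 := ContinuousAt.comp (f := phi (n := n) p) (x := p) h1 (continuousAt_extChartAt p)
  refine h2.congr ?_
  filter_upwards [(isOpen_source (n := n) p).mem_nhds (mem_extChartAt_source p)] with q hq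
  simp only [Function.comp_apply]
  rw [(phi p).left_inv hq]

/-- The product of a function and a form. -/
def mulForms (ρ : M → ℝ) (a : RoughForms n M) : RoughForms n M := fun p => ρ p • a p

theorem mulForms_mem {ρ : M → ℝ} (hρ : ContMDiff (𝓡 (4 * n + 2)) 𝓘(ℝ, ℝ) ∞ ρ)
    {a : RoughForms n M} (ha : a ∈ smoothForms n M) : mulForms ρ a ∈ smoothForms n M := by
  rw [mem_smoothForms_iff] at ha ⊢
  intro x₀ y hy k
  have h1 : ContDiffAt ℝ ∞ (fun z => ρ ((phi x₀).symm z)) y :=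
    (ContMDiffAt.comp y (hρ _) (contMDiffAt_phi_symm hy)).contDiffAt
  exact h1.smul (ha x₀ y hy k)

end Operators

/-! ### Algebra of the pointwise inner product on the manifold -/

section Inner

variable {n : ℕ} {M : Type*} [TopologicalSpace M] [ChartedSpace (E n) M]
  {w : RoughForm n M 2} {J : RoughEnd n M}

theorem innerAt_mulForms (ρ : M → ℝ) (a b : RoughForms n M) (p : M) :
    innerAt w J (mulForms ρ a) b p = ρ p * innerAt w J a b p :=
  innerForms_smul_left _ _ _ _

theorem innerAt_add_left (a b c : RoughForms n M) (p : M) :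
    innerAt w J (a + b) c p = innerAt w J a c p + innerAt w J b c p :=
  innerForms_add_left _ _ _ _

theorem innerAt_comm (a b : RoughForms n M) (p : M) :
    innerAt w J a b p = innerAt w J b a p :=
  innerForms_comm _ _ _

theorem innerAt_neg_left (a b : RoughForms n M) (p : M) :
    innerAt w J (-a) b p = -innerAt w J a b p :=
  innerForms_neg_left _ _ _

theorem innerAt_eq_zero_left {a : RoughForms n M} {p : M} (h : a p = 0) (b : RoughForms n M) :
    innerAt w J a b p = 0 := by
  have h1 : formsAt a p = (0 : ℝ) • formsAt a p := by
    rw [zero_smul]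
    exact h
  rw [innerAt, h1, innerForms_smul_left, zero_mul]

end Inner

/-! ### Stokes' formula and nondegeneracy of the inner product -/

section Stokes

variable {n : ℕ} {M : Type*} [TopologicalSpace M] [ChartedSpace (E n) M]
  [IsManifold (𝓡 (4 * n + 2)) ∞ M] [T2Space M] [CompactSpace M] [MeasurableSpace M] [BorelSpace M]
  {w : RoughForm n M 2} {J : RoughEnd n M}

theorem integrable_innerAt (hw : IsSmoothForm w) (hJ : IsCompatible w J) {a b : RoughForms n M}
    (ha : a ∈ smoothForms n M) (hb : b ∈ smoothForms n M) :
    Integrable (innerAt w J a b) (volumeMeasure w J) := by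
  have := isFiniteMeasure_volumeMeasure hw hJ
  exact integrable_of_continuous (continuous_innerAt hw hJ ha hb)

omit [BorelSpace M] in
theorem l2Inner_eq (a b : RoughForms n M) :
    l2Inner w J a b = ∫ p, innerAt w J a b p ∂volumeMeasure w J := rfl

omit [BorelSpace M] in
theorem l2Inner_zero_left (b : RoughForms n M) : l2Inner w J 0 b = 0 := by
  have h : ∀ p, innerAt w J 0 b p = 0 := fun p => innerAt_eq_zero_left rfl b
  simp only [l2Inner_eq, h, integral_zero]

omit [BorelSpace M] in
theorem l2Inner_comm (a b : RoughForms n M) : l2Inner w J a b = l2Inner w J b a := by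
  simp only [l2Inner_eq, innerAt_comm]

omit [BorelSpace M] in
theorem l2Inner_neg_left (a b : RoughForms n M) : l2Inner w J (-a) b = -l2Inner w J a b := by
  simp only [l2Inner_eq, innerAt_neg_left, integral_neg]

omit [BorelSpace M] in
theorem l2Inner_neg_right (a b : RoughForms n M) : l2Inner w J a (-b) = -l2Inner w J a b := by
  rw [l2Inner_comm, l2Inner_neg_left, l2Inner_comm]

theorem l2Inner_add_left (hw : IsSmoothForm w) (hJ : IsCompatible w J) {a b c : RoughForms n M}
    (ha : a ∈ smoothForms n M) (hb : b ∈ smoothForms n M) (hc : c ∈ smoothForms n M) :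
    l2Inner w J (a + b) c = l2Inner w J a c + l2Inner w J b c := by
  simp only [l2Inner_eq, innerAt_add_left]
  exact integral_add (integrable_innerAt hw hJ ha hc) (integrable_innerAt hw hJ hb hc)

theorem l2Inner_add_right (hw : IsSmoothForm w) (hJ : IsCompatible w J) {a b c : RoughForms n M}
    (ha : a ∈ smoothForms n M) (hb : b ∈ smoothForms n M) (hc : c ∈ smoothForms n M) :
    l2Inner w J a (b + c) = l2Inner w J a b + l2Inner w J a c := by
  rw [l2Inner_comm, l2Inner_add_left hw hJ hb hc ha, l2Inner_comm b, l2Inner_comm c]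

omit [BorelSpace M] in
theorem l2Inner_chatVolForms_left (hJ : IsCompatible w J) (a b : RoughForms n M) :
    l2Inner w J (chatVolForms w J a) b = -l2Inner w J a (chatVolForms w J b) := by
  simp only [l2Inner_eq, innerAt_chatVolForms_left hJ, integral_neg]

omit [BorelSpace M] in
theorem l2Inner_psiForms (hJ : IsCompatible w J) (a b : RoughForms n M) :
    l2Inner w J (psiForms w a) (chatVolForms w J b) =
      l2Inner w J a (chatVolForms w J (psiForms w b)) := by
  simp only [l2Inner_eq, innerAt_psiForms hJ]

/-- Stokes' formula for a form supported in a chart. -/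
theorem l2Inner_dForms_of_support (hw : IsSmoothForm w) (hJ : IsCompatible w J)
    {a c : RoughForms n M} (ha : a ∈ smoothForms n M) (hc : c ∈ smoothForms n M) {x₀ : M}
    {K : Set M} (hK : IsClosed K) (hKs : K ⊆ (phi (n := n) x₀).source)
    (h0 : ∀ p ∉ K, a p = 0) :
    l2Inner w J (dForms a) (chatVolForms w J c) = l2Inner w J a (chatVolForms w J (dForms c)) := by
  have hd0 : ∀ p ∉ K, dForms a p = 0 := fun p hp => dForms_eq_zero (by
    filter_upwards [hK.isOpen_compl.mem_nhds hp] with q hq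
    exact h0 q hq)
  have hda := dForms_mem ha
  have hdc := dForms_mem hc
  have hC := chatVolForms_mem hw hJ hc
  have hdC := chatVolForms_mem hw hJ hdc
  set F₁ := innerAt w J (dForms a) (chatVolForms w J c) with hF₁
  set F₂ := innerAt w J a (chatVolForms w J (dForms c)) with hF₂
  have hs1 : tsupport F₁ ⊆ (phi (n := n) x₀).source := by
    refine (closure_minimal (fun p hp => ?_) hK).trans hKs
    by_contra h
    exact hp (innerAt_eq_zero_left (hd0 p h) _)
  have hs2 : tsupport F₂ ⊆ (phi (n := n) x₀).source := by
    refine (closure_minimal (fun p hp => ?_) hK).trans hKs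
    by_contra h
    exact hp (innerAt_eq_zero_left (h0 p h) _)
  have hc1 : Continuous F₁ := continuous_innerAt hw hJ hda hC
  have hc2 : Continuous F₂ := continuous_innerAt hw hJ ha hdC
  rw [l2Inner_eq, l2Inner_eq, integral_volumeMeasure hw hJ hc1 hs1,
    integral_volumeMeasure hw hJ hc2 hs2, ← sub_eq_zero,
    ← integral_sub (integrableOn_chart hw hJ hc1 hs1) (integrableOn_chart hw hJ hc2 hs2)]
  set U := (phi (n := n) x₀).target with hU
  have hUo : IsOpen U := isOpen_target x₀
  set A := chartForms a x₀ with hA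
  set C := chartForms c x₀ with hCdef
  have hAs := mem_smoothForms_iff.1 ha x₀
  have hCs := mem_smoothForms_iff.1 hc x₀
  -- The chart sign is locally constant, so it passes through derivatives, and the integrand becomes
  -- minus the divergence of G, which vanishes outside the compact image of K.
  set G : Fin (4 * n + 2) → E n → ℝ := fun i z =>
    chartSign w x₀ z * stdPairing (A z) (extMul (coframe (stdBasis n) i) (C z)) with hG
  have hEC : ∀ i, ∀ y ∈ U, ∀ k,
      ContDiffAt ℝ ∞ (fun z => extMul (coframe (stdBasis n) i) (C z) k) y :=
    fun i y hy => contDiffAt_extMul contDiffAt_const (hCs y hy)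
  have hGe : ∀ i, ∀ y ∈ U, G i =ᶠ[nhds y] fun z => chartSign w x₀ y *
      stdPairing (A z) (extMul (coframe (stdBasis n) i) (C z)) := by
    intro i y hy
    filter_upwards [chartSign_eventuallyEq hw hJ hy] with z hz
    rw [hG]
    simp only
    rw [hz]
  have hGs : ∀ i, ∀ y ∈ U, ContDiffAt ℝ ∞ (G i) y := fun i y hy =>
    (contDiffAt_const.mul (contDiffAt_stdPairing (hAs y hy)
      (hEC i y hy))).congr_of_eventuallyEq (hGe i y hy)
  have hG0 : ∀ i, ∀ y ∈ U \ (phi (n := n) x₀ '' K), G i y = 0 := by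
    intro i y hy
    have h1 : a ((phi x₀).symm y) = 0 := h0 _ fun h => hy.2 ⟨_, h, (phi x₀).right_inv hy.1⟩
    have h2 : A y = (0 : ℝ) • A y := by
      have h3 : formsAt a ((phi x₀).symm y) = 0 := h1
      rw [zero_smul, hA, chartForms, h3, map_zero]
    rw [hG]
    simp only
    rw [h2, stdPairing, pairing, innerForms_smul_left]
    ring
  have hKc : IsCompact (phi (n := n) x₀ '' K) :=
    hK.isCompact.image_of_continuousOn ((continuousOn_phi x₀).mono hKs)
  have hKU : phi (n := n) x₀ '' K ⊆ U := by
    rintro _ ⟨p, hp, rfl⟩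
    exact (phi x₀).map_source (hKs hp)
  have hz := fun i => setIntegral_fderiv_eq_zero hUo hKc hKU (hGs i) (hG0 i) (stdBasis n i)
  have hcongr : ∀ y ∈ U, F₁ ((phi x₀).symm y) * chartDensity w J x₀ y -
      F₂ ((phi x₀).symm y) * chartDensity w J x₀ y =
      -∑ i, fderiv ℝ (G i) y (stdBasis n i) := by
    intro y hy
    rw [hF₁, hF₂, innerAt_chatVolForms_mul_density hJ hy, innerAt_chatVolForms_mul_density hJ hy,
      chartForms_dForms ha hy, chartForms_dForms hc hy, ← mul_sub,
      stdPairing_extDerivForms (hAs y hy) (hCs y hy), mul_neg, Finset.mul_sum]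
    congr 1
    refine Finset.sum_congr rfl fun i _ => ?_
    rw [(hGe i y hy).fderiv_eq, fderiv_const_mul
      ((contDiffAt_stdPairing (hAs y hy) (hEC i y hy)).differentiableAt (by simp))]
    rfl
  rw [setIntegral_congr_fun hUo.measurableSet hcongr, integral_neg,
    integral_finsetSum _ fun i _ => (hz i).1]
  simp [(hz _).2]

omit [MeasurableSpace M] [BorelSpace M] in
theorem sum_mulForms (a : RoughForms n M) :
    ∑ i ∈ chartIndices n M, mulForms (chartPartition n M i) a = a := by
  funext p k
  rw [Finset.sum_apply, Finset.sum_apply]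
  change ∑ i ∈ chartIndices n M, chartPartition n M i p • a p k = a p k
  rw [← Finset.sum_smul, sum_chartPartition, one_smul]

omit [MeasurableSpace M] [BorelSpace M] in
theorem mulForms_chartPartition_mem {a : RoughForms n M} (ha : a ∈ smoothForms n M) (i : M) :
    mulForms (chartPartition n M i) a ∈ smoothForms n M :=
  mulForms_mem (chartPartition n M i).contMDiff ha

/-- Stokes' formula. -/
theorem l2Inner_dForms (hw : IsSmoothForm w) (hJ : IsCompatible w J) {a c : RoughForms n M}
    (ha : a ∈ smoothForms n M) (hc : c ∈ smoothForms n M) :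
    l2Inner w J (dForms a) (chatVolForms w J c) = l2Inner w J a (chatVolForms w J (dForms c)) := by
  have hC := chatVolForms_mem hw hJ hc
  have hdC := chatVolForms_mem hw hJ (dForms_mem hc)
  -- Only a has to be localised. Both sides are additive in a, but only for smooth forms, hence the
  -- induction over finite partial sums.
  have key : ∀ s : Finset M,
      l2Inner w J (dForms (∑ i ∈ s, mulForms (chartPartition n M i) a)) (chatVolForms w J c) =
        l2Inner w J (∑ i ∈ s, mulForms (chartPartition n M i) a)
          (chatVolForms w J (dForms c)) := by
    classical
    intro s
    induction s using Finset.induction_on with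
    | empty =>
      have h0 : dForms (0 : RoughForms n M) = 0 :=
        funext fun p => dForms_eq_zero (Filter.Eventually.of_forall fun _ => rfl)
      rw [Finset.sum_empty, h0, l2Inner_zero_left, l2Inner_zero_left]
    | insert i s hi ih =>
      have h1 := mulForms_chartPartition_mem ha i
      have h2 : ∑ i ∈ s, mulForms (chartPartition n M i) a ∈ smoothForms n M :=
        Submodule.sum_mem _ fun i _ => mulForms_chartPartition_mem ha i
      rw [Finset.sum_insert hi, dForms_add h1 h2,
        l2Inner_add_left hw hJ (dForms_mem h1) (dForms_mem h2) hC,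
        l2Inner_add_left hw hJ h1 h2 hdC, ih,
        l2Inner_dForms_of_support hw hJ h1 hc (isClosed_tsupport (chartPartition n M i))
          (tsupport_chartPartition i)]
      intro p hp
      rw [mulForms, image_eq_zero_of_notMem_tsupport hp, zero_smul]
  have := key (chartIndices n M)
  rwa [sum_mulForms] at this

/-- The `L²` inner product is nondegenerate. -/
theorem eq_zero_of_l2Inner (hw : IsSmoothForm w) (hJ : IsCompatible w J) {z : RoughForms n M}
    (hz : z ∈ smoothForms n M) (h : ∀ u ∈ smoothForms n M, l2Inner w J u z = 0) : z = 0 := by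
  funext p
  obtain ⟨i, hi⟩ := (chartPartition n M).exists_pos_of_mem (Set.mem_univ p)
  set ρ := chartPartition n M i with hρ
  -- The test form is ρz with ρ(p) > 0. Then ρ⟨z, z⟩ is continuous, nonnegative, supported in one
  -- chart and of integral 0. The density being positive, it vanishes throughout the chart, in
  -- particular at p.
  have hm := mulForms_chartPartition_mem hz i
  have h1 := h _ hm
  have hc : Continuous (innerAt w J (mulForms ρ z) z) := continuous_innerAt hw hJ hm hz
  have hnn : ∀ q, 0 ≤ innerAt w J (mulForms ρ z) z q := fun q => by
    rw [innerAt_mulForms]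
    exact mul_nonneg ((chartPartition n M).nonneg _ _) (innerForms_self_nonneg _ _)
  have hs : tsupport (innerAt w J (mulForms ρ z) z) ⊆ (phi (n := n) i).source := by
    refine (closure_minimal (fun q hq => ?_) (isClosed_tsupport ρ)).trans
      (tsupport_chartPartition i)
    refine subset_tsupport _ fun h => hq ?_
    rw [innerAt_mulForms, h, zero_mul]
  have hps : p ∈ (phi (n := n) i).source :=
    tsupport_chartPartition i (subset_tsupport _ hi.ne')
  have ho := isOpen_target (n := n) i
  rw [l2Inner_eq, integral_volumeMeasure hw hJ hc hs,
    setIntegral_eq_zero_iff_of_nonneg_ae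
      (Filter.Eventually.of_forall fun y => mul_nonneg (hnn _) (chartDensity_nonneg w J i y))
      (integrableOn_chart hw hJ hc hs)] at h1
  have h2 := Measure.eqOn_open_of_ae_eq h1 ho
    ((continuousOn_comp_phi_symm hc).mul (continuousOn_chartDensity hw hJ i))
    continuousOn_const ((phi i).map_source hps)
  simp only [Pi.zero_apply, (phi i).left_inv hps] at h2
  rw [mul_eq_zero, or_iff_left (chartDensity_pos hJ ((phi i).map_source hps)).ne',
    innerAt_mulForms, mul_eq_zero, or_iff_right hi.ne'] at h2
  exact eq_zero_of_innerAt_self hJ h2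

end Stokes

/-! ### The signature operator -/

section SignatureOperator

variable {n : ℕ} {M : Type*} [TopologicalSpace M] [ChartedSpace (E n) M]
  [IsManifold (𝓡 (4 * n + 2)) ∞ M] {w : RoughForm n M 2} {J : RoughEnd n M}

/-- The explicit formula for the adjoint of `∂_ψ`. -/
def adjointFormula (w : RoughForm n M 2) (J : RoughEnd n M) (v : RoughForms n M × RoughForms n M) :
    RoughForms n M × RoughForms n M :=
  (-chatVolForms w J (dForms (chatVolForms w J v.1)),
    -chatVolForms w J (psiForms w (chatVolForms w J v.1)) +
      chatVolForms w J (dForms (chatVolForms w J v.2)))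

/-- The explicit formula for the operator `[[0, -1], [1, 0]] diag(ĉ(dvol), ĉ(dvol))
(∂_ψ + ∂_ψ^*)`. -/
def operatorFormula (w : RoughForm n M 2) (J : RoughEnd n M)
    (u : RoughForms n M × RoughForms n M) : RoughForms n M × RoughForms n M :=
  (chatVolForms w J (dForms u.2) + dForms (chatVolForms w J u.2) -
      psiForms w (chatVolForms w J u.1),
    chatVolForms w J (dForms u.1) + chatVolForms w J (psiForms w u.2) +
      dForms (chatVolForms w J u.1))

theorem adjointFormula_mem (hw : IsSmoothForm w) (hJ : IsCompatible w J)
    {v : RoughForms n M × RoughForms n M} (hv : v ∈ cochains n M) :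
    adjointFormula w J v ∈ cochains n M := by
  have h1 := chatVolForms_mem hw hJ hv.1
  have h2 := chatVolForms_mem hw hJ hv.2
  exact ⟨neg_mem (chatVolForms_mem hw hJ (dForms_mem h1)),
    add_mem (neg_mem (chatVolForms_mem hw hJ (psiForms_mem hw h1)))
      (chatVolForms_mem hw hJ (dForms_mem h2))⟩

theorem operatorFormula_mem (hw : IsSmoothForm w) (hJ : IsCompatible w J)
    {u : RoughForms n M × RoughForms n M} (hu : u ∈ cochains n M) :
    operatorFormula w J u ∈ cochains n M := by
  have h1 := chatVolForms_mem hw hJ hu.1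
  have h2 := chatVolForms_mem hw hJ hu.2
  exact ⟨sub_mem (add_mem (chatVolForms_mem hw hJ (dForms_mem hu.2)) (dForms_mem h2))
      (psiForms_mem hw h1),
    add_mem (add_mem (chatVolForms_mem hw hJ (dForms_mem hu.1))
      (chatVolForms_mem hw hJ (psiForms_mem hw hu.2))) (dForms_mem h1)⟩

/-- The first component lives in even degrees and the second in odd ones. The off-diagonal entries
contain one d and exchange the parities; the diagonal entries contain ψ and preserve them. -/
theorem operatorFormula_mem_even (hw : IsSmoothForm w) (hJ : IsCompatible w J)
    {u : RoughForms n M × RoughForms n M} (hu : u ∈ evenCochains n M) :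
    operatorFormula w J u ∈ evenCochains n M := by
  obtain ⟨hu, h1, h2⟩ := hu
  refine ⟨operatorFormula_mem hw hJ hu, fun x k hk => ?_, fun x k hk => ?_⟩
  · have h1 : ∀ x k, ¬ Even (k + 0) → u.1 x k = 0 := h1
    have hk4 : ¬ Even (k + (3 + 1)) := by rw [Nat.even_iff] at hk ⊢; omega
    have e1 := chatVolForms_parity (w := w) (J := J) (dForms_parity h2) x k hk4
    have e2 := dForms_parity (chatVolForms_parity (w := w) (J := J) h2) x k hk4
    have e3 := psiForms_parity (w := w) (chatVolForms_parity (w := w) (J := J) h1) x k hk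
    change chatVolForms w J (dForms u.2) x k + dForms (chatVolForms w J u.2) x k -
      psiForms w (chatVolForms w J u.1) x k = 0
    rw [e1, e2, e3, add_zero, sub_zero]
  · have h1 : ∀ x k, ¬ Even (k + 0) → u.1 x k = 0 := h1
    have hk1 : ¬ Even (k + (0 + 1)) := by rw [Nat.even_iff] at hk ⊢; omega
    have e1 := chatVolForms_parity (w := w) (J := J) (dForms_parity h1) x k hk1
    have e2 := dForms_parity (chatVolForms_parity (w := w) (J := J) h1) x k hk1
    have e3 := chatVolForms_parity (w := w) (J := J) (psiForms_parity (w := w) h2) x k hk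
    change chatVolForms w J (dForms u.1) x k + chatVolForms w J (psiForms w u.2) x k +
      dForms (chatVolForms w J u.1) x k = 0
    rw [e1, e2, e3, add_zero, add_zero]

theorem operatorFormula_add (hw : IsSmoothForm w) (hJ : IsCompatible w J)
    {u v : RoughForms n M × RoughForms n M} (hu : u ∈ cochains n M) (hv : v ∈ cochains n M) :
    operatorFormula w J (u + v) = operatorFormula w J u + operatorFormula w J v := by
  simp only [operatorFormula, Prod.fst_add, Prod.snd_add, chatVolForms_add, psiForms_add,
    dForms_add hu.1 hv.1, dForms_add hu.2 hv.2,
    dForms_add (chatVolForms_mem hw hJ hu.1) (chatVolForms_mem hw hJ hv.1),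
    dForms_add (chatVolForms_mem hw hJ hu.2) (chatVolForms_mem hw hJ hv.2), Prod.mk_add_mk]
  congr 1 <;> abel

omit [IsManifold (𝓡 (4 * n + 2)) ∞ M] in
theorem operatorFormula_smul (c : ℝ) (u : RoughForms n M × RoughForms n M) :
    operatorFormula w J (c • u) = c • operatorFormula w J u := by
  simp only [operatorFormula, Prod.smul_fst, Prod.smul_snd, chatVolForms_smul, psiForms_smul,
    dForms_smul, Prod.smul_mk, smul_add, smul_sub]

variable [T2Space M] [CompactSpace M] [MeasurableSpace M] [BorelSpace M]

/-- Stokes' formula applied to b = -ĉ(dvol) ĉ(dvol) b, which exhibits the formal adjoint of d. -/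
theorem l2Inner_dForms_right (hw : IsSmoothForm w) (hJ : IsCompatible w J) {a b : RoughForms n M}
    (ha : a ∈ smoothForms n M) (hb : b ∈ smoothForms n M) :
    l2Inner w J (dForms a) b = -l2Inner w J a
      (chatVolForms w J (dForms (chatVolForms w J b))) := by
  rw [← l2Inner_dForms hw hJ ha (chatVolForms_mem hw hJ hb), chatVolForms_chatVolForms hJ,
    l2Inner_neg_right, neg_neg]

omit [BorelSpace M] in
theorem l2Inner_psiForms_right (hJ : IsCompatible w J) (a b : RoughForms n M) :
    l2Inner w J (psiForms w a) b = -l2Inner w J a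
      (chatVolForms w J (psiForms w (chatVolForms w J b))) := by
  rw [← l2Inner_psiForms hJ, chatVolForms_chatVolForms hJ, l2Inner_neg_right, neg_neg]

/-- This and the next three lemmas are the skew-adjointness of cd, dc, cψ and ψc with c = ĉ(dvol).
The sign comes from c* = -c; d and ψ cross the pairing with c without sign. -/
theorem l2Inner_chatVolForms_dForms (hw : IsSmoothForm w) (hJ : IsCompatible w J)
    {a b : RoughForms n M} (ha : a ∈ smoothForms n M) (hb : b ∈ smoothForms n M) :
    l2Inner w J (chatVolForms w J (dForms a)) b =
      -l2Inner w J a (chatVolForms w J (dForms b)) := by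
  rw [l2Inner_chatVolForms_left hJ, l2Inner_dForms hw hJ ha hb]

theorem l2Inner_dForms_chatVolForms (hw : IsSmoothForm w) (hJ : IsCompatible w J)
    {a b : RoughForms n M} (ha : a ∈ smoothForms n M) (hb : b ∈ smoothForms n M) :
    l2Inner w J (dForms (chatVolForms w J a)) b =
      -l2Inner w J a (dForms (chatVolForms w J b)) := by
  rw [l2Inner_dForms_right hw hJ (chatVolForms_mem hw hJ ha) hb, l2Inner_chatVolForms_left hJ,
    chatVolForms_chatVolForms hJ, l2Inner_neg_right, neg_neg]

omit [BorelSpace M] in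
theorem l2Inner_chatVolForms_psiForms (hJ : IsCompatible w J) (a b : RoughForms n M) :
    l2Inner w J (chatVolForms w J (psiForms w a)) b =
      -l2Inner w J a (chatVolForms w J (psiForms w b)) := by
  rw [l2Inner_chatVolForms_left hJ, l2Inner_psiForms hJ]

omit [BorelSpace M] in
theorem l2Inner_psiForms_chatVolForms (hJ : IsCompatible w J) (a b : RoughForms n M) :
    l2Inner w J (psiForms w (chatVolForms w J a)) b =
      -l2Inner w J a (psiForms w (chatVolForms w J b)) := by
  rw [l2Inner_psiForms_right hJ, l2Inner_chatVolForms_left hJ, chatVolForms_chatVolForms hJ,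
    l2Inner_neg_right, neg_neg]

/-- The adjoint of a matrix of operators is the transpose of the entrywise adjoints: d* and 0 in the
first row, ψ* and -d* in the second. -/
theorem isAdjointValue_adjointFormula (hw : IsSmoothForm w) (hJ : IsCompatible w J)
    {v : RoughForms n M × RoughForms n M} (hv : v ∈ cochains n M) :
    IsAdjointValue w J v (adjointFormula w J v) := by
  refine ⟨adjointFormula_mem hw hJ hv, fun u hu => ?_⟩
  have h1 := chatVolForms_mem hw hJ hv.1
  have h2 := chatVolForms_mem hw hJ hv.2
  rw [cochainInner, cochainInner, coboundary, adjointFormula]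
  simp only
  rw [l2Inner_add_left hw hJ (dForms_mem hu.1) (psiForms_mem hw hu.2) hv.1,
    l2Inner_add_right hw hJ hu.2 (neg_mem (chatVolForms_mem hw hJ (psiForms_mem hw h1)))
      (chatVolForms_mem hw hJ (dForms_mem h2)), l2Inner_neg_left, l2Inner_neg_right,
    l2Inner_neg_right, l2Inner_dForms_right hw hJ hu.1 hv.1,
    l2Inner_dForms_right hw hJ hu.2 hv.2, l2Inner_psiForms_right hJ]
  ring

/-- Nondegeneracy is tested on the cochains (u, 0) and (0, u). This identifies `coboundaryAdjoint`,
defined by choice, with the explicit formula. -/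
theorem isAdjointValue_unique (hw : IsSmoothForm w) (hJ : IsCompatible w J)
    {v z z' : RoughForms n M × RoughForms n M} (hz : IsAdjointValue w J v z)
    (hz' : IsAdjointValue w J v z') : z = z' := by
  have key : ∀ u ∈ cochains n M, cochainInner w J u z = cochainInner w J u z' :=
    fun u hu => (hz.2 u hu).symm.trans (hz'.2 u hu)
  refine Prod.ext ?_ ?_
  · refine sub_eq_zero.1 (eq_zero_of_l2Inner hw hJ (sub_mem hz.1.1 hz'.1.1) fun u hu => ?_)
    have := key (u, 0) ⟨hu, zero_mem _⟩
    simp only [cochainInner, l2Inner_zero_left, add_zero] at this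
    rw [sub_eq_add_neg, l2Inner_add_right hw hJ hu hz.1.1 (neg_mem hz'.1.1), l2Inner_neg_right,
      this, add_neg_cancel]
  · refine sub_eq_zero.1 (eq_zero_of_l2Inner hw hJ (sub_mem hz.1.2 hz'.1.2) fun u hu => ?_)
    have := key (0, u) ⟨zero_mem _, hu⟩
    simp only [cochainInner, l2Inner_zero_left, zero_add] at this
    rw [sub_eq_add_neg, l2Inner_add_right hw hJ hu hz.1.2 (neg_mem hz'.1.2), l2Inner_neg_right,
      this, add_neg_cancel]

theorem isAdjointValue_coboundaryAdjoint (hw : IsSmoothForm w) (hJ : IsCompatible w J)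
    {v : RoughForms n M × RoughForms n M} (hv : v ∈ cochains n M) :
    IsAdjointValue w J v (coboundaryAdjoint w J v) := by
  have h : ∃ z, IsAdjointValue w J v z := ⟨_, isAdjointValue_adjointFormula hw hJ hv⟩
  rw [coboundaryAdjoint, dif_pos h]
  exact h.choose_spec

/-- In -c d c and -c ψ c, the outer c on the left cancels against the c of the operator, since c² =
-1. -/
theorem signatureOperator_eq (hw : IsSmoothForm w) (hJ : IsCompatible w J)
    {u : RoughForms n M × RoughForms n M} (hu : u ∈ cochains n M) :
    signatureOperator w J u = operatorFormula w J u := by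
  rw [signatureOperator, isAdjointValue_unique hw hJ (isAdjointValue_coboundaryAdjoint hw hJ hu)
    (isAdjointValue_adjointFormula hw hJ hu), coboundary, adjointFormula, operatorFormula]
  simp only [Prod.mk_add_mk, chatVolForms_add, chatVolForms_neg, chatVolForms_chatVolForms hJ,
    neg_neg]
  congr 1
  abel

/-- The matrix is symmetric, with cd + dc in both off-diagonal places, and its entries are
skew-adjoint. The inner products are expanded entry by entry and matched. -/
theorem cochainInner_operatorFormula (hw : IsSmoothForm w) (hJ : IsCompatible w J)
    {u v : RoughForms n M × RoughForms n M} (hu : u ∈ cochains n M) (hv : v ∈ cochains n M) :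
    cochainInner w J (operatorFormula w J u) v =
      -cochainInner w J u (operatorFormula w J v) := by
  have cm := fun {a : RoughForms n M} (ha : a ∈ smoothForms n M) =>
    chatVolForms_mem (J := J) hw hJ ha
  have pm := fun {a : RoughForms n M} (ha : a ∈ smoothForms n M) => psiForms_mem hw ha
  simp only [cochainInner, operatorFormula, sub_eq_add_neg]
  rw [l2Inner_add_left hw hJ (add_mem (cm (dForms_mem hu.2)) (dForms_mem (cm hu.2)))
      (neg_mem (pm (cm hu.1))) hv.1,
    l2Inner_add_left hw hJ (cm (dForms_mem hu.2)) (dForms_mem (cm hu.2)) hv.1,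
    l2Inner_add_left hw hJ (add_mem (cm (dForms_mem hu.1)) (cm (pm hu.2))) (dForms_mem (cm hu.1))
      hv.2,
    l2Inner_add_left hw hJ (cm (dForms_mem hu.1)) (cm (pm hu.2)) hv.2,
    l2Inner_add_right hw hJ hu.1 (add_mem (cm (dForms_mem hv.2)) (dForms_mem (cm hv.2)))
      (neg_mem (pm (cm hv.1))),
    l2Inner_add_right hw hJ hu.1 (cm (dForms_mem hv.2)) (dForms_mem (cm hv.2)),
    l2Inner_add_right hw hJ hu.2 (add_mem (cm (dForms_mem hv.1)) (cm (pm hv.2)))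
      (dForms_mem (cm hv.1)),
    l2Inner_add_right hw hJ hu.2 (cm (dForms_mem hv.1)) (cm (pm hv.2)),
    l2Inner_neg_left, l2Inner_neg_right,
    l2Inner_chatVolForms_dForms hw hJ hu.2 hv.1, l2Inner_dForms_chatVolForms hw hJ hu.2 hv.1,
    l2Inner_psiForms_chatVolForms hJ, l2Inner_chatVolForms_dForms hw hJ hu.1 hv.2,
    l2Inner_chatVolForms_psiForms hJ, l2Inner_dForms_chatVolForms hw hJ hu.1 hv.2]
  ring

/-- The operator on even cochains. -/
def evenOperator (hw : IsSmoothForm w) (hJ : IsCompatible w J) :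
    evenCochains n M →ₗ[ℝ] evenCochains n M where
  toFun u := ⟨operatorFormula w J u, operatorFormula_mem_even hw hJ u.2⟩
  map_add' u v := Subtype.ext (operatorFormula_add hw hJ u.2.1 v.2.1)
  map_smul' c u := Subtype.ext (operatorFormula_smul c (u : RoughForms n M × RoughForms n M))

end SignatureOperator

end FilteredSymplectic

end

theorem proposition2 (n : ℕ) (M : Type*) [TopologicalSpace M] [T2Space M] [CompactSpace M]
    [ChartedSpace (EuclideanSpace ℝ (Fin (4 * n + 2))) M] [IsManifold (𝓡 (4 * n + 2)) ∞ M]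
    [MeasurableSpace M] [BorelSpace M]
    (w : FilteredSymplectic.RoughForm n M 2) (hw : FilteredSymplectic.IsSymplectic w)
    (J : FilteredSymplectic.RoughEnd n M) (hJ : FilteredSymplectic.IsCompatible w J) :
    (∀ v ∈ FilteredSymplectic.cochains n M,
      FilteredSymplectic.IsAdjointValue w J v (FilteredSymplectic.coboundaryAdjoint w J v)) ∧
    ∃ D : FilteredSymplectic.evenCochains n M →ₗ[ℝ] FilteredSymplectic.evenCochains n M,
      (∀ u, (D u : FilteredSymplectic.RoughForms n M × FilteredSymplectic.RoughForms n M) =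
        FilteredSymplectic.signatureOperator w J u) ∧
      ∀ u v : FilteredSymplectic.evenCochains n M, FilteredSymplectic.cochainInner w J (D u) v =
        -FilteredSymplectic.cochainInner w J u (D v) :=
  ⟨fun _ hv => FilteredSymplectic.isAdjointValue_coboundaryAdjoint hw.smooth hJ hv,
    FilteredSymplectic.evenOperator hw.smooth hJ,
    fun u => (FilteredSymplectic.signatureOperator_eq hw.smooth hJ u.2.1).symm,
    fun u v => FilteredSymplectic.cochainInner_operatorFormula hw.smooth hJ u.2.1 v.2.1⟩
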